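/- Let $\tau\in i\mathbb R_+$, let $\mathcal E_\tau=\mathbb C/(\mathbb Z+\tau\mathbb Z)$, let $\gamma=\{\tfrac\tau2+s:\ s\in[0,1]\}$ be oriented by increasing $s$ (with $q_+$ the boundary value at $q\in\gamma$ from above), and let $\mathscr D\in(0,1)$. Let $0<\epsilon<\tfrac12\mathrm{Im}\,\tau$ and let $w$ be analytic and $1$-periodic in the strip $|\mathrm{Im}\,p-\tfrac12\mathrm{Im}\,\tau|<\epsilon$ and real on $\gamma$. Let $\mathscr P_n$ be the space of elliptic functions $f$ on $\mathcal E_\tau$ with $\mathrm{div} f\ge -n(0)-(\mathscr D)$. The monic orthogonal sections are the functions $\pi_n\in\mathscr P_n\setminus\mathscr P_{n-1}$, $n=0,1,2,\dots$, with $\pi_n(p)=p^{-n}(1+\mathcal O(p))$ as $p\to0$ and $\int_\gamma\pi_n\pi_m\,e^{w(p)}\,dp=0$ for $n\ne m$; put $\|\pi_n\|^2=\int_\gamma \pi_n^2\,e^{w(p)}\,dp$. Let $\theta_j(p;\sigma)$ be the Jacobi theta functions with nome $e^{i\pi\sigma}$, normalized by $\theta_1(p+1;\sigma)=-\theta_1(p;\sigma)$,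 and let $'$ denote $d/dp$. Let $\wp$ be the Weierstrass function of the lattice $\mathbb Z+\tau\mathbb Z$, $e_1=\wp(\frac12)$, $e_2=\wp(\frac{1+\tau}2)$, $e_3=\wp(\frac\tau2)$. Let $H$ be the branch of $\sqrt{\wp(p)-e_1}$ that is single-valued on $\mathcal E_\tau\setminus\gamma$ with $H(p)=-\frac1p+\mathcal O(1)$ as $p\to0$, that is, $H(p)\,dp=\frac{dX}{2\sqrt{(X-e_2)(X-e_3)}}$ with $X=\wp(p)$, where the radical has its cut on $[e_3,e_2]$ and behaves like $X$ at infinity. Let $g(p)=\lim_{t\to0}\big(-\ln t+\int_t^pH(q)\,dq\big)$, whose real part is single-valued on $\mathcal E_\tau\setminus(\gamma\cup\{0\})$, let $\ell\in\mathbb R$ be given by $$e^{2\ell}=-e^{-i\pi\tau}\frac{\theta_1'(0;2\tau)^2}{\theta_1(\tau;2\tau)^2}>0,$$ and put $c_0=\frac12\min_{p\in\gamma\pm i\epsilon}\mathrm{Re}\,(g(p)-\ell)$. Finally let $$S(p)=\int_\gamma C(p,q)\,w(q)\,\frac{H(q_+)\,dq}{2\pi i\,H(p)},\qquad C(p,q)=\frac{\theta_1'(0;\tau)\,\theta_1(q;\tau)\,\theta_1(p-\frac12;\tau)\,\theta_1(p-q+\frac12;\tau)}{\theta_1(\frac12;\tau)\,\theta_1(p;\tau)\,\theta_1(p-q;\tau)\,\theta_1(q-\frac12;\tau)},$$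 be the Szegő function, and $S_\infty=\lim_{p\to0}S(p)$. Then $c_0>0$, the monic orthogonal sections exist, and, as $n\to\infty$, $$\|\pi_n\|^2=-2\pi\, e^{2(n-1)\ell-2S_\infty}\,e^{-i\pi\tau}\,\frac{e^{-2i\pi\mathscr D}\,\theta_1(\mathscr D;2\tau)^2}{\theta_1(\mathscr D+\tau;2\tau)^2}\,\frac{\theta_1'(0;2\tau)}{\theta_4(0;2\tau)}\left(\frac{\theta_3(0;2\tau)}{\theta_2(0;2\tau)}\right)^{(-1)^n}\big(1+\mathcal O(e^{-nc_0})\big).$$ -/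

import Mathlib

open Filter Topology Asymptotics Set
open scoped Real

namespace EllipticOrthogonality

noncomputable section

/-! ### Jacobi theta functions

`θ_j(p; σ)` with nome `exp (iπσ)`, in the normalization `θ₁(p + 1; σ) = -θ₁(p; σ)` (that is, the
classical theta functions at the argument `π p`).  Mathlib's `jacobiTheta₂ p σ` is
`∑ₙ exp (2πi n p + πi n² σ) = θ₃(p; σ)`; the other three are obtained from it by half-period
shifts, so that e.g. `θ₁(p; σ) = 2 ∑_{n ≥ 0} (-1)ⁿ exp (iπσ (n + 1/2)²) sin ((2n + 1) π p)`. -/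

/-- `θ₁(p; σ)`. -/
def theta1 (p σ : ℂ) : ℂ :=
  -Complex.I * Complex.exp (π * Complex.I * σ / 4 + π * Complex.I * p) *
    jacobiTheta₂ (p + 1 / 2 + σ / 2) σ

/-- `θ₂(p; σ)`. -/
def theta2 (p σ : ℂ) : ℂ :=
  Complex.exp (π * Complex.I * σ / 4 + π * Complex.I * p) * jacobiTheta₂ (p + σ / 2) σ

/-- `θ₃(p; σ)`. -/
def theta3 (p σ : ℂ) : ℂ := jacobiTheta₂ p σ

/-- `θ₄(p; σ)`. -/
def theta4 (p σ : ℂ) : ℂ := jacobiTheta₂ (p + 1 / 2) σ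

/-- `θ₁'(0; σ)`, the derivative with respect to the first argument. -/
def theta1DerivZero (σ : ℂ) : ℂ := deriv (fun p => theta1 p σ) 0

/-! ### The elliptic curve `ℂ / (ℤ + τℤ)` -/

/-- The pair of periods `(1, τ)`. -/
def periods (τ : UpperHalfPlane) : PeriodPair where
  ω₁ := 1
  ω₂ := τ
  indep := by
    rw [LinearIndependent.pair_iff]
    intro s t h
    have him := congrArg Complex.im h
    have hre := congrArg Complex.re h
    have ht : t = 0 := by
      have : t = 0 ∨ τ.im = 0 := by simpa using him
      exact this.resolve_right τ.im_pos.ne'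
    subst ht
    exact ⟨by simpa using hre, rfl⟩

/-- `e₂ = ℘((1 + τ)/2)`.  For `τ ∈ iℝ₊` the half-period values are real and
`e₃ < e₂ < e₁ = ℘(1/2)`. -/
def e2 (τ : UpperHalfPlane) : ℂ := (periods τ).weierstrassP (1 / 2 + τ / 2)

/-- `e₃ = ℘(τ/2)`. -/
def e3 (τ : UpperHalfPlane) : ℂ := (periods τ).weierstrassP (τ / 2)

open scoped Classical in
/-- The multiplicity at `z` of the divisor `n(0) + (D)` on `ℂ / (ℤ + τℤ)`. -/
def poleDivisor (τ : UpperHalfPlane) (D : ℝ) (n : ℤ) (z : ℂ) : ℤ :=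
  (if z ∈ (periods τ).lattice then n else 0) + (if z - D ∈ (periods τ).lattice then 1 else 0)

/-- The space `𝒫_n = 𝒪(n(0) + (D))`: elliptic functions `f` with `div f ≥ -n(0) - (D)`.
Meromorphic functions are taken in normal form, i.e. without removable singularities. -/
def sectionSpace (τ : UpperHalfPlane) (D : ℝ) (n : ℤ) : Set (ℂ → ℂ) :=
  {f | MeromorphicNFOn f univ ∧ (∀ z, f (z + 1) = f z) ∧ (∀ z, f (z + τ) = f z) ∧
    ∀ z, ((-poleDivisor τ D n z : ℤ) : WithTop ℤ) ≤ meromorphicOrderAt f z}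

/-- The pairing `∫_γ f g dμ`, where `γ` is the oval `Im p = Im τ / 2`, parametrized by
`p = τ/2 + s`, `s ∈ [0, 1]`, and `dμ = exp (w(p)) dp`. -/
def pairing (τ : UpperHalfPlane) (w f g : ℂ → ℂ) : ℂ :=
  ∫ s in (0 : ℝ)..1, f (τ / 2 + s) * g (τ / 2 + s) * Complex.exp (w (τ / 2 + s))

/-- `P n`, `n = 0, 1, 2, …`, is the sequence of monic orthogonal sections for `dμ`:
`P n ∈ 𝒫_n ∖ 𝒫_{n-1}`, `P n = p⁻ⁿ (1 + O(p))` at `p = 0`, and `∫_γ P n P m dμ = 0` for `n ≠ m`. -/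
structure IsMonicOrthogonal (τ : UpperHalfPlane) (D : ℝ) (w : ℂ → ℂ) (P : ℕ → ℂ → ℂ) :
    Prop where
  mem : ∀ n : ℕ, P n ∈ sectionSpace τ D n
  notMem : ∀ n : ℕ, P n ∉ sectionSpace τ D ((n : ℤ) - 1)
  monic : ∀ n : ℕ, (fun p : ℂ => p ^ n * P n p - 1) =O[𝓝[≠] 0] (fun p : ℂ => p)
  orthogonal : ∀ n m : ℕ, n ≠ m → pairing τ w (P n) (P m) = 0

/-! ### The `g`-function -/

/-- The branch of `√((X - e₂)(X - e₃))` with branch cut `[e₃, e₂]` that behaves like `X` at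
infinity. -/
def radical (τ : UpperHalfPlane) (X : ℂ) : ℂ :=
  (X - e3 τ) * ((X - e2 τ) / (X - e3 τ)) ^ (1 / 2 : ℂ)

/-- The branch of `√(℘(p) - e₁)` that is single valued on `ℂ / (ℤ + τℤ)` minus `γ` and has residue
`-1` at `p = 0`: `H dp = dX / (2 √((X - e₂)(X - e₃)))`, `X = ℘(p)`. -/
def H (τ : UpperHalfPlane) (p : ℂ) : ℂ :=
  (periods τ).derivWeierstrassP p / (2 * radical τ ((periods τ).weierstrassP p))

/-- The boundary value `H(q₊)` on `γ` from above (from the left of `γ`). -/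
def HPlus (τ : UpperHalfPlane) (q : ℂ) : ℂ :=
  limUnder (𝓝[>] (0 : ℝ)) fun δ : ℝ => H τ (q + δ * Complex.I)

/-- The `g`-function `g(p) = lim_{t → 0} (-ln t + ∫_t^p H(q) dq)`, so that
`g(p) = -ln p + O(p)` as `p → 0`, with the path of integration on the segment from `0` to `p`.
Used for `0 < |Im p| < Im τ / 2`. -/
def gFun (τ : UpperHalfPlane) (p : ℂ) : ℂ :=
  limUnder (𝓝[>] (0 : ℝ)) fun t : ℝ =>
    -Complex.log (t * p) + ∫ x in t..1, H τ (x * p) * p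

/-- The real constant `ℓ` with `exp (2ℓ) = -exp (-iπτ) θ₁'(0; 2τ)² / θ₁(τ; 2τ)² > 0`. -/
def ell (τ : UpperHalfPlane) : ℝ :=
  1 / 2 * Real.log (-Complex.exp (-Complex.I * π * τ) *
    theta1DerivZero (2 * τ) ^ 2 / theta1 τ (2 * τ) ^ 2).re

/-- The exponential rate `c₀ = ½ min Re (g - ℓ)` over `γ ± iε`.  Modulo the period `τ`, the contour
`γ - iε` is `Im p = Im τ / 2 - ε` and `γ + iε` is `Im p = -(Im τ / 2 - ε)`. -/
def rate (τ : UpperHalfPlane) (ε : ℝ) : ℝ :=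
  1 / 2 * sInf {r : ℝ | ∃ p : ℂ, p.re ∈ Icc (0 : ℝ) 1 ∧ |p.im| = τ.im / 2 - ε ∧
    r = (gFun τ p).re - ell τ}

/-! ### The Szegő function -/

/-- The scalar Cauchy kernel `C(p, q)` on `ℂ / (ℤ + τℤ)` normalized at the points `0`, `1/2`. -/
def cauchyKernel (τ : UpperHalfPlane) (p q : ℂ) : ℂ :=
  theta1DerivZero τ * theta1 q τ * theta1 (p - 1 / 2) τ * theta1 (p - q + 1 / 2) τ /
    (theta1 (1 / 2) τ * theta1 p τ * theta1 (p - q) τ * theta1 (q - 1 / 2) τ)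

/-- The Szegő function `S(p) = ∫_γ C(p, q) w(q) H(q₊) dq / (2πi H(p))`. -/
def szego (τ : UpperHalfPlane) (w : ℂ → ℂ) (p : ℂ) : ℂ :=
  ∫ s in (0 : ℝ)..1, cauchyKernel τ p (τ / 2 + s) * w (τ / 2 + s) * HPlus τ (τ / 2 + s) /
    (2 * π * Complex.I * H τ p)

/-- `S_∞`, the value at `p = 0` of the Szegő function (which has a removable singularity there). -/
def szegoInfty (τ : UpperHalfPlane) (w : ℂ → ℂ) : ℂ :=
  limUnder (𝓝[≠] (0 : ℂ)) (szego τ w)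

/-! ### The leading term of the norms -/

/-- The leading term of `‖π_n‖²`. -/
def leadingTerm (τ : UpperHalfPlane) (D : ℝ) (w : ℂ → ℂ) (n : ℕ) : ℂ :=
  -(2 * π) * Complex.exp (2 * ((n : ℂ) - 1) * ell τ - 2 * szegoInfty τ w) *
    Complex.exp (-Complex.I * π * τ) *
    (Complex.exp (-2 * Complex.I * π * D) * theta1 D (2 * τ) ^ 2 /
      theta1 (D + τ) (2 * τ) ^ 2) *
    (theta1DerivZero (2 * τ) / theta4 0 (2 * τ)) *
    (theta3 0 (2 * τ) / theta2 0 (2 * τ)) ^ ((-1 : ℤ) ^ n)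

end

end EllipticOrthogonality

/-!
The proof compares the orthogonal sections with an explicit function whose pairings are residues.

**The `g`-function.** With `k = θ₁'(0; 2τ) / θ₄(0; 2τ)`, the theta quotient
`gInv = θ₁(·; 2τ) / (k θ₄(·; 2τ))` is the exponential of `-g`: it vanishes at the lattice points of
the annulus `|Im p| < Im τ / 2`, changes sign under `1` and satisfies `gInv (p + τ) gInv p = k⁻²`.
Indeed `exp (2g) + k⁴ exp (-2g)` is elliptic with the poles of `℘` (`exists_weierstrassP_eq`),
which makes `℘ - e₂` and `℘ - e₃` squares and identifies `H` with the logarithmic derivative of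
`exp g` (`H_eq_gDeriv`, `re_gFun`). Moreover `k² = exp (2ℓ)`, and `|gInv| = exp (-ℓ)` on the
boundary of the annulus, so that `Re g > ℓ` inside by the maximum principle (`norm_gInv_lt`). This
gives the positivity of the rate.

**The weight.** A Cauchy integral with kernel `H`, which changes sign under `τ`, factors the weight
on `γ` as `φ(q) φ(q - τ)`, where `φ` is analytic and zero-free in a neighbourhood of the closed
annulus and `φ(0)² = exp (-2 S_∞)` (`exists_factorization`).

**The trial function.** In the closed annulus, away from `0` and `D`, the section `πₙ` is modelled
on `F(p) = const · exp (n g(p)) φ(p)⁻¹ exp (g(p - D)) M(p)`, where `M` is `θ₂/θ₄` or `θ₃/θ₄` at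
`2τ`, according to the parity of `n`, and changes sign under `2τ`. On `γ` both branches are
present, and `(F(q) + F(q - τ)) exp w(q)` is the jump `Ψ(q) - Ψ(q - τ)` of a function `Ψ` whose
factors `exp (-n g)`, `exp (-g(· - D))` and `M(· - τ)` give a zero of order `n` at `0`, one at `D`,
and a simple pole at `0`. The pairing with a monic section of degree `n` is therefore `-2πi` times
a residue at `0`, and the value of this residue is exactly the leading term (`pairing_trialFun`).
No error occurs at this stage.

**Sections close to the trial function.** The function `F` has the singularities of a monic
section, and on the lines `|Im p| = Im τ / 2 + ε'`, on the other side of `γ`, it is of size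
`exp (n ℓ - n c₀)`. A Cauchy integral with kernel `θ₁'/θ₁` then shows that the sum of its branches
on `γ` is within `O(exp (n ℓ - n c₀))` of a monic section (`exists_presection_approx`). The
additive jump of this kernel under `τ` only contributes a constant, which is itself a section.

**Conclusion.** By orthogonality, every monic section of degree `n` has the pairing `‖πₙ‖²` with
`πₙ` (`pairing_eq_of_monic`). Hence `‖πₙ‖²` differs from the leading term, which has the size of
`exp (2nℓ)`, by `O(exp (n ℓ - n c₀) ‖πₙ‖)`, and this is a relative error of `O(exp (-n c₀))`.
Existence is Gram–Schmidt for the real theta quotients `sectionBasis`, on which the pairing is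
positive definite because sections of real type are real on `γ`.
-/

namespace EllipticOrthogonality

/-! ### Theta functions -/

section Theta

variable {σ : ℂ}

lemma differentiable_theta1 (hσ : 0 < σ.im) : Differentiable ℂ (fun p => theta1 p σ) := by
  intro p
  unfold theta1
  have h := differentiableAt_jacobiTheta₂_fst (p + 1 / 2 + σ / 2) hσ
  have h2 : DifferentiableAt ℂ (fun p : ℂ => jacobiTheta₂ (p + 1 / 2 + σ / 2) σ) p :=
    DifferentiableAt.comp (f := fun p : ℂ => p + 1 / 2 + σ / 2)
      (g := fun z => jacobiTheta₂ z σ) p h (by fun_prop)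
  fun_prop

lemma differentiable_theta2 (hσ : 0 < σ.im) : Differentiable ℂ (fun p => theta2 p σ) := by
  intro p
  unfold theta2
  have h := differentiableAt_jacobiTheta₂_fst (p + σ / 2) hσ
  have h2 : DifferentiableAt ℂ (fun p : ℂ => jacobiTheta₂ (p + σ / 2) σ) p :=
    DifferentiableAt.comp (f := fun p : ℂ => p + σ / 2)
      (g := fun z => jacobiTheta₂ z σ) p h (by fun_prop)
  fun_prop

lemma differentiable_theta3 (hσ : 0 < σ.im) : Differentiable ℂ (fun p => theta3 p σ) :=
  fun p => differentiableAt_jacobiTheta₂_fst p hσ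

lemma differentiable_theta4 (hσ : 0 < σ.im) : Differentiable ℂ (fun p => theta4 p σ) := by
  intro p
  unfold theta4
  exact DifferentiableAt.comp (f := fun p : ℂ => p + 1 / 2)
      (g := fun z => jacobiTheta₂ z σ) p (differentiableAt_jacobiTheta₂_fst _ hσ) (by fun_prop)

lemma exp_pi_mul_I_mul_half_add (a : ℂ) :
    Complex.exp (a + π * Complex.I) = -Complex.exp a := by
  rw [Complex.exp_add, Complex.exp_pi_mul_I]; ring

lemma theta1_add_one (p σ : ℂ) : theta1 (p + 1) σ = -theta1 p σ := by
  unfold theta1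
  rw [show p + 1 + 1 / 2 + σ / 2 = (p + 1 / 2 + σ / 2) + 1 by ring, jacobiTheta₂_add_left,
    show π * Complex.I * σ / 4 + π * Complex.I * (p + 1)
      = (π * Complex.I * σ / 4 + π * Complex.I * p) + π * Complex.I by ring,
    exp_pi_mul_I_mul_half_add]
  ring

lemma theta2_add_one (p σ : ℂ) : theta2 (p + 1) σ = -theta2 p σ := by
  unfold theta2
  rw [show p + 1 + σ / 2 = (p + σ / 2) + 1 by ring, jacobiTheta₂_add_left,
    show π * Complex.I * σ / 4 + π * Complex.I * (p + 1)
      = (π * Complex.I * σ / 4 + π * Complex.I * p) + π * Complex.I by ring,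
    exp_pi_mul_I_mul_half_add]
  ring

lemma theta3_add_one (p σ : ℂ) : theta3 (p + 1) σ = theta3 p σ := jacobiTheta₂_add_left _ _

lemma theta4_add_one (p σ : ℂ) : theta4 (p + 1) σ = theta4 p σ := by
  unfold theta4
  rw [show p + 1 + 1 / 2 = (p + 1 / 2) + 1 by ring, jacobiTheta₂_add_left]

lemma theta1_add_self (p σ : ℂ) :
    theta1 (p + σ) σ = -Complex.exp (-(π * Complex.I * (σ + 2 * p))) * theta1 p σ := by
  unfold theta1
  rw [show p + σ + 1 / 2 + σ / 2 = (p + 1 / 2 + σ / 2) + σ by ring, jacobiTheta₂_add_left']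
  have : Complex.exp (π * Complex.I * σ / 4 + π * Complex.I * (p + σ)) *
      Complex.exp (-π * Complex.I * (σ + 2 * (p + 1 / 2 + σ / 2))) =
      -Complex.exp (-(π * Complex.I * (σ + 2 * p))) *
        Complex.exp (π * Complex.I * σ / 4 + π * Complex.I * p) := by
    rw [neg_mul (Complex.exp _), ← Complex.exp_add, ← Complex.exp_add,
      ← exp_pi_mul_I_mul_half_add, Complex.exp_eq_exp_iff_exists_int]
    exact ⟨-1, by push_cast; ring⟩
  linear_combination (-Complex.I * jacobiTheta₂ (p + 1 / 2 + σ / 2) σ) * this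

lemma theta1_neg (p σ : ℂ) : theta1 (-p) σ = -theta1 p σ := by
  unfold theta1
  rw [← jacobiTheta₂_neg_left, show p + 1 / 2 + σ / 2 = (-(-p + 1 / 2 + σ / 2) + 1) + σ by ring,
    jacobiTheta₂_add_left', jacobiTheta₂_add_left]
  have : Complex.exp (π * Complex.I * σ / 4 + π * Complex.I * (-p)) =
      -(Complex.exp (π * Complex.I * σ / 4 + π * Complex.I * p) *
        Complex.exp (-π * Complex.I * (σ + 2 * (-(-p + 1 / 2 + σ / 2) + 1)))) := by
    rw [← Complex.exp_add, ← exp_pi_mul_I_mul_half_add,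
      Complex.exp_eq_exp_iff_exists_int]
    exact ⟨0, by push_cast; ring⟩
  rw [this]
  ring

lemma theta1_zero (σ : ℂ) : theta1 0 σ = 0 := by
  have h := theta1_neg 0 σ
  rw [neg_zero] at h
  linear_combination h / 2

lemma theta4_neg (p σ : ℂ) : theta4 (-p) σ = theta4 p σ := by
  unfold theta4
  rw [← jacobiTheta₂_neg_left, show p + 1 / 2 = -(-p + 1 / 2) + 1 by ring, jacobiTheta₂_add_left]

/-- The factor picked up by `θ_j` under translation by half of the period `σ`. -/
noncomputable def halfPeriodFactor (p σ : ℂ) : ℂ :=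
  Complex.exp (-(π * Complex.I * σ / 4 + π * Complex.I * p))

lemma halfPeriodFactor_ne_zero (p σ : ℂ) : halfPeriodFactor p σ ≠ 0 := Complex.exp_ne_zero _

lemma theta4_add_half (p σ : ℂ) :
    theta4 (p + σ / 2) σ = Complex.I * halfPeriodFactor p σ * theta1 p σ := by
  unfold theta4 theta1 halfPeriodFactor
  rw [show p + σ / 2 + 1 / 2 = p + 1 / 2 + σ / 2 by ring, Complex.exp_neg]
  field_simp [Complex.exp_ne_zero]
  rw [Complex.I_sq]; ring

lemma theta3_add_half (p σ : ℂ) :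
    theta3 (p + σ / 2) σ = halfPeriodFactor p σ * theta2 p σ := by
  unfold theta3 theta2 halfPeriodFactor
  rw [Complex.exp_neg]
  field_simp [Complex.exp_ne_zero]

lemma theta2_add_half (p σ : ℂ) :
    theta2 (p + σ / 2) σ = halfPeriodFactor p σ * theta3 p σ := by
  unfold theta3 theta2 halfPeriodFactor
  rw [show p + σ / 2 + σ / 2 = p + σ by ring, jacobiTheta₂_add_left', ← mul_assoc,
    ← Complex.exp_add]
  congr 2
  ring

lemma theta1_add_half (p σ : ℂ) :
    theta1 (p + σ / 2) σ = Complex.I * halfPeriodFactor p σ * theta4 p σ := by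
  unfold theta1 theta4 halfPeriodFactor
  rw [show p + σ / 2 + 1 / 2 + σ / 2 = p + 1 / 2 + σ by ring, jacobiTheta₂_add_left']
  have : Complex.exp (π * Complex.I * σ / 4 + π * Complex.I * (p + σ / 2)) *
      Complex.exp (-π * Complex.I * (σ + 2 * (p + 1 / 2))) =
      -Complex.exp (-(π * Complex.I * σ / 4 + π * Complex.I * p)) := by
    rw [← Complex.exp_add, ← exp_pi_mul_I_mul_half_add,
      Complex.exp_eq_exp_iff_exists_int]
    exact ⟨-1, by push_cast; ring⟩
  linear_combination (-Complex.I * jacobiTheta₂ (p + 1 / 2) σ) * this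

lemma theta2_eq_theta1 (p σ : ℂ) : theta2 p σ = theta1 (p + 1 / 2) σ := by
  unfold theta1 theta2
  rw [show p + 1 / 2 + 1 / 2 + σ / 2 = (p + σ / 2) + 1 by ring, jacobiTheta₂_add_left]
  have : Complex.exp (π * Complex.I * σ / 4 + π * Complex.I * (p + 1 / 2)) =
      Complex.I * Complex.exp (π * Complex.I * σ / 4 + π * Complex.I * p) := by
    rw [show π * Complex.I * σ / 4 + π * Complex.I * (p + 1 / 2) =
      π / 2 * Complex.I + (π * Complex.I * σ / 4 + π * Complex.I * p) by ring, Complex.exp_add,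
      Complex.exp_pi_div_two_mul_I]
  rw [this]
  linear_combination (Complex.exp (π * Complex.I * σ / 4 + π * Complex.I * p) *
    jacobiTheta₂ (p + σ / 2) σ) * Complex.I_sq

/-! ### The zeros of the theta functions -/

/-- The product `∏ (1 - qⁿ x)`, `n ≥ 0`. -/
noncomputable def qProd (q x : ℂ) : ℂ := ∏' n : ℕ, (1 + -(q ^ n * x))

lemma summable_norm_qProd {q : ℂ} (hq : ‖q‖ < 1) (x : ℂ) :
    Summable (fun n : ℕ => ‖-(q ^ n * x)‖) := by
  simp only [norm_neg, norm_mul, norm_pow]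
  exact (summable_geometric_of_lt_one (norm_nonneg _) hq).mul_right _

lemma differentiable_qProd {q : ℂ} (hq : ‖q‖ < 1) : Differentiable ℂ (qProd q) := by
  intro x
  have hU : IsOpen (Metric.ball (0 : ℂ) (‖x‖ + 1)) := Metric.isOpen_ball
  have h := Summable.hasProdLocallyUniformlyOn_nat_one_add (f := fun (n : ℕ) x => -(q ^ n * x)) hU
    (u := fun n => ‖q‖ ^ n * (‖x‖ + 1))
    ((summable_geometric_of_lt_one (norm_nonneg _) hq).mul_right _)
    (.of_forall fun n y hy => by
      rw [norm_neg, norm_mul, norm_pow]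
      have : ‖y‖ < ‖x‖ + 1 := by simpa using hy
      gcongr) (fun n => by fun_prop)
  have hd : DifferentiableOn ℂ (qProd q) (Metric.ball (0 : ℂ) (‖x‖ + 1)) := by
    refine TendstoLocallyUniformlyOn.differentiableOn
      (hasProdLocallyUniformlyOn_iff_tendstoLocallyUniformlyOn.1 h) (.of_forall fun s => ?_) hU
    exact DifferentiableOn.fun_finsetProd fun i _ => by fun_prop
  exact (hd x (by simp)).differentiableAt (hU.mem_nhds (by simp))

lemma qProd_eq_mul {q : ℂ} (hq : ‖q‖ < 1) (x : ℂ) : qProd q x = (1 - x) * qProd q (q * x) := by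
  unfold qProd
  have h : Multipliable (fun n : ℕ => 1 + -(q ^ (n + 1) * x)) :=
    multipliable_one_add_of_summable
      ((summable_nat_add_iff (f := fun n : ℕ => ‖-(q ^ n * x)‖) 1).2 (summable_norm_qProd hq x))
  rw [tprod_eq_zero_mul' (f := fun n : ℕ => 1 + -(q ^ n * x)) h]
  simp only [pow_succ, mul_assoc, pow_zero, one_mul, sub_eq_add_neg]

lemma qProd_ne_zero {q : ℂ} (hq : ‖q‖ < 1) {x : ℂ} (hx : ∀ n : ℕ, q ^ n * x ≠ 1) :
    qProd q x ≠ 0 :=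
  tprod_one_add_ne_zero_of_summable
    (fun n h => hx n (by linear_combination -h)) (summable_norm_qProd hq x)

/-- The normal form of a periodic meromorphic function is periodic. -/
lemma periodic_toMeromorphicNFOn {f : ℂ → ℂ} (hf : ∀ z, MeromorphicAt f z) {ω : ℂ}
    (hω : ∀ z, f (z + ω) = f z) (z : ℂ) :
    toMeromorphicNFOn f univ (z + ω) = toMeromorphicNFOn f univ z := by
  set F := toMeromorphicNFOn f univ with hF
  have hf' : MeromorphicOn f univ := fun z _ => hf z
  have hEq : ∀ z, F =ᶠ[𝓝[≠] z] f := fun z => hf'.toMeromorphicNFOn_eq_self_on_nhdsNE (mem_univ z)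
  have hNF : MeromorphicNFOn F univ := meromorphicNFOn_toMeromorphicNFOn f univ
  have ht : Tendsto (fun y => y + ω) (𝓝[≠] z) (𝓝[≠] (z + ω)) := by
    refine tendsto_nhdsWithin_iff.2 ⟨?_, ?_⟩
    · exact ((continuous_id.add continuous_const).tendsto z).mono_left nhdsWithin_le_nhds
    · filter_upwards [self_mem_nhdsWithin] with y hy
      simpa using hy
  have hev : (fun y => F (y + ω)) =ᶠ[𝓝[≠] z] F := by
    filter_upwards [ht.eventually (hEq (z + ω)), hEq z] with y hy hy'
    rw [hy, hy', hω]
  have hn : MeromorphicNFAt (fun y => F (y + ω)) z := by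
    have := meromorphicNFAt_comp_add_const_iff_meromorphicNFAt (x := z) (c := ω) (f := F)
    exact this.2 (hNF (mem_univ _))
  exact ((hn.eventuallyEq_nhdsNE_iff_eventuallyEq_nhds (hNF (mem_univ z))).1 hev).eq_of_nhds

/-- **Liouville's theorem for elliptic functions**: without poles they are constant. -/
theorem elliptic_liouville (hσ : 0 < σ.im) {f : ℂ → ℂ} (hf : ∀ z, MeromorphicAt f z)
    (h1 : ∀ z, f (z + 1) = f z) (hs : ∀ z, f (z + σ) = f z)
    (hord : ∀ z, 0 ≤ meromorphicOrderAt f z) : ∃ c, ∀ z, ContinuousAt f z → f z = c := by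
  set F := toMeromorphicNFOn f univ with hF
  have hf' : MeromorphicOn f univ := fun z _ => hf z
  have hNF : MeromorphicNFOn F univ := meromorphicNFOn_toMeromorphicNFOn f univ
  have hAn : ∀ z, AnalyticAt ℂ F z := fun z =>
    (hNF (mem_univ z)).meromorphicOrderAt_nonneg_iff_analyticAt.1
      (by rw [hF, meromorphicOrderAt_toMeromorphicNFOn hf' (mem_univ z)]; exact hord z)
  have hEq : ∀ z, F =ᶠ[𝓝[≠] z] f := fun z => hf'.toMeromorphicNFOn_eq_self_on_nhdsNE (mem_univ z)
  have hp1 : Function.Periodic F 1 := periodic_toMeromorphicNFOn hf h1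
  have hps : Function.Periodic F σ := periodic_toMeromorphicNFOn hf hs
  have hdiff : Differentiable ℂ F := fun z => (hAn z).differentiableAt
  have hcomp : IsCompact ((fun x : ℝ × ℝ => (x.1 : ℂ) + x.2 * σ) '' (Icc 0 1 ×ˢ Icc 0 1)) :=
    (isCompact_Icc.prod isCompact_Icc).image (by fun_prop)
  have hbdd : Bornology.IsBounded (range F) := by
    refine ((hcomp.image hdiff.continuous).isBounded).subset ?_
    rintro _ ⟨z, rfl⟩
    set b := z.im / σ.im with hb
    set a := (z - b * σ).re with ha
    have hz : z = a + b * σ := by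
      apply Complex.ext
      · simp [ha]
      · simp [hb, hσ.ne']
    refine ⟨_, ⟨(Int.fract a, Int.fract b), ⟨⟨Int.fract_nonneg _, (Int.fract_lt_one _).le⟩,
      ⟨Int.fract_nonneg _, (Int.fract_lt_one _).le⟩⟩, rfl⟩, ?_⟩
    have e : z = ((Int.fract a : ℝ) + (Int.fract b : ℝ) * σ) + (⌊b⌋ : ℤ) * σ + (⌊a⌋ : ℤ) * 1 := by
      conv_lhs => rw [hz, ← Int.fract_add_floor a, ← Int.fract_add_floor b]
      push_cast; ring
    conv_rhs => rw [e, hp1.int_mul ⌊a⌋, hps.int_mul ⌊b⌋]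
  refine ⟨F 0, fun z hz => ?_⟩
  rw [← hdiff.apply_eq_apply_of_bounded hbdd z 0]
  exact (((hAn z).continuousAt.eventuallyEq_nhds_iff_eventuallyEq_nhdsNE hz).1
    (hEq z)).eq_of_nhds.symm

/-- The triple-product form of `θ₁`, up to normalization, from which its zeros can be read off. -/
noncomputable def theta1Prod (p σ : ℂ) : ℂ :=
  Complex.exp (-(π * Complex.I * p)) *
    (qProd (Complex.exp (2 * π * Complex.I * σ)) (Complex.exp (2 * π * Complex.I * p)) *
    qProd (Complex.exp (2 * π * Complex.I * σ))
      (Complex.exp (2 * π * Complex.I * σ) / Complex.exp (2 * π * Complex.I * p)))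

lemma norm_exp_two_pi_I_mul_lt_one (hσ : 0 < σ.im) :
    ‖Complex.exp (2 * π * Complex.I * σ)‖ < 1 := by
  rw [Complex.norm_exp, Real.exp_lt_one_iff]
  have : (2 * π * Complex.I * σ).re = -(2 * π * σ.im) := by simp
  rw [this]
  have := mul_pos Real.pi_pos hσ
  linarith

lemma differentiable_theta1Prod (hσ : 0 < σ.im) : Differentiable ℂ (fun p => theta1Prod p σ) := by
  have h := differentiable_qProd (norm_exp_two_pi_I_mul_lt_one hσ)
  unfold theta1Prod
  refine .mul (by fun_prop) (.mul (h.comp (by fun_prop)) (h.comp ?_))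
  exact .div (by fun_prop) (by fun_prop) fun _ => Complex.exp_ne_zero _

lemma theta1Prod_add_one (p σ : ℂ) : theta1Prod (p + 1) σ = -theta1Prod p σ := by
  unfold theta1Prod
  have : Complex.exp (2 * π * Complex.I * (p + 1)) = Complex.exp (2 * π * Complex.I * p) := by
    rw [Complex.exp_eq_exp_iff_exists_int]; exact ⟨1, by push_cast; ring⟩
  have h2 : Complex.exp (-(π * Complex.I * (p + 1))) = -Complex.exp (-(π * Complex.I * p)) := by
    rw [← exp_pi_mul_I_mul_half_add, Complex.exp_eq_exp_iff_exists_int]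
    exact ⟨-1, by push_cast; ring⟩
  rw [this, h2]; ring

lemma theta1Prod_add_self (hσ : 0 < σ.im) (p : ℂ) :
    theta1Prod (p + σ) σ =
      -Complex.exp (-(π * Complex.I * (σ + 2 * p))) * theta1Prod p σ := by
  have hq := norm_exp_two_pi_I_mul_lt_one hσ
  unfold theta1Prod
  have e1 : Complex.exp (2 * π * Complex.I * (p + σ)) =
      Complex.exp (2 * π * Complex.I * σ) * Complex.exp (2 * π * Complex.I * p) := by
    rw [← Complex.exp_add]; congr 1; ring
  have e2 : Complex.exp (-(π * Complex.I * (p + σ))) =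
      Complex.exp (-(π * Complex.I * (σ + 2 * p))) * (Complex.exp (-(π * Complex.I * p)) *
        Complex.exp (2 * π * Complex.I * p)) := by
    simp only [← Complex.exp_add]; congr 1; ring
  rw [e1, e2]
  set q := Complex.exp (2 * π * Complex.I * σ)
  set x := Complex.exp (2 * π * Complex.I * p)
  have hx : x ≠ 0 := Complex.exp_ne_zero _
  have hq0 : q ≠ 0 := Complex.exp_ne_zero _
  rw [show q / (q * x) = 1 / x by field_simp, qProd_eq_mul hq x, qProd_eq_mul hq (1 / x),
    show q * (1 / x) = q / x by ring]
  field_simp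
  ring

lemma theta1Prod_ne_zero (hσ : 0 < σ.im) {p : ℂ} (hp : ∀ m n : ℤ, p ≠ m + n * σ) :
    theta1Prod p σ ≠ 0 := by
  have hq := norm_exp_two_pi_I_mul_lt_one hσ
  refine mul_ne_zero (Complex.exp_ne_zero _)
    (mul_ne_zero (qProd_ne_zero hq fun n h => ?_) (qProd_ne_zero hq fun n h => ?_))
  · rw [← Complex.exp_nat_mul, ← Complex.exp_add, Complex.exp_eq_one_iff] at h
    obtain ⟨k, hk⟩ := h
    refine hp k (-n) ?_
    have : (2 * π * Complex.I) ≠ 0 := Complex.two_pi_I_ne_zero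
    apply mul_left_cancel₀ this
    push_cast
    linear_combination hk
  · rw [← Complex.exp_nat_mul, ← Complex.exp_sub, ← Complex.exp_add, Complex.exp_eq_one_iff] at h
    obtain ⟨k, hk⟩ := h
    refine hp (-k) (n + 1) ?_
    have : (2 * π * Complex.I) ≠ 0 := Complex.two_pi_I_ne_zero
    apply mul_left_cancel₀ this
    push_cast
    linear_combination -hk

lemma hasDerivAt_theta1Prod_zero (hσ : 0 < σ.im) :
    ∃ d : ℂ, d ≠ 0 ∧ HasDerivAt (fun p => theta1Prod p σ) d 0 := by
  have hq := norm_exp_two_pi_I_mul_lt_one hσ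
  set q := Complex.exp (2 * π * Complex.I * σ) with hqdef
  set u : ℂ → ℂ := fun p => Complex.exp (-(π * Complex.I * p)) *
    (qProd q (q * Complex.exp (2 * π * Complex.I * p)) *
      qProd q (q / Complex.exp (2 * π * Complex.I * p))) with hu
  have hP : (fun p => theta1Prod p σ) =
      fun p => (1 - Complex.exp (2 * π * Complex.I * p)) * u p := by
    funext p
    rw [theta1Prod, ← hqdef, qProd_eq_mul hq, hu]
    ring
  have hdu : DifferentiableAt ℂ u 0 := by
    have h := differentiable_qProd hq
    refine .mul (by fun_prop) (.mul (h.comp (by fun_prop) 0) (h.comp ?_ 0))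
    exact .div (by fun_prop) (by fun_prop) fun _ => Complex.exp_ne_zero _
  have hu0 : u 0 ≠ 0 := by
    have hn : ∀ n : ℕ, q ^ n * q ≠ 1 := fun n h => by
      have := congrArg norm h
      rw [← pow_succ, norm_pow, norm_one] at this
      exact (pow_lt_one₀ (norm_nonneg q) hq n.succ_ne_zero).ne this
    have := qProd_ne_zero hq hn
    simp only [hu, mul_zero, neg_zero, Complex.exp_zero, one_mul, mul_one, div_one]
    exact mul_ne_zero this this
  have h1 : HasDerivAt (fun p : ℂ => 1 - Complex.exp (2 * π * Complex.I * p))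
      (-(2 * π * Complex.I)) 0 := by
    have := ((hasDerivAt_id (0 : ℂ)).const_mul (2 * π * Complex.I)).cexp.const_sub 1
    simpa using this
  refine ⟨-(2 * π * Complex.I) * u 0, mul_ne_zero (neg_ne_zero.2 Complex.two_pi_I_ne_zero) hu0, ?_⟩
  rw [hP]
  have := h1.fun_mul hdu.hasDerivAt
  simpa using this

lemma meromorphicOrderAt_eq_of_periodic {f : ℂ → ℂ} {ω : ℂ} (h : ∀ z, f (z + ω) = f z) (z : ℂ) :
    meromorphicOrderAt f (z + ω) = meromorphicOrderAt f z := by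
  rw [← meromorphicOrderAt_comp_add_const_eq_meromorphicOrderAt]
  congr 1
  exact funext h

lemma periodic_int_mul_add_int_mul {f : ℂ → ℂ} (h1 : ∀ z, f (z + 1) = f z)
    (hs : ∀ z, f (z + σ) = f z) (m n : ℤ) (z : ℂ) : f (z + (m + n * σ)) = f z := by
  have a : Function.Periodic f 1 := h1
  have b : Function.Periodic f σ := hs
  have := ((a.int_mul m).add_period (b.int_mul n)) z
  simpa using this

/-- For a positive nome, `θ₃(0)` is a series of positive terms. -/
lemma theta3_zero_ne_zero (hσ : 0 < σ.im) (hre : σ.re = 0) : theta3 0 σ ≠ 0 := by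
  have hs := hasSum_jacobiTheta₂_term 0 hσ
  have hterm : ∀ n : ℤ, jacobiTheta₂_term n 0 σ = (Real.exp (-π * n ^ 2 * σ.im) : ℝ) := by
    intro n
    have hσ' : σ = σ.im * Complex.I := by apply Complex.ext <;> simp [hre]
    rw [jacobiTheta₂_term, hσ']
    push_cast
    congr 1
    simp only [Complex.mul_im, Complex.ofReal_re, Complex.I_im, mul_one, Complex.ofReal_im,
      Complex.I_re, mul_zero, add_zero]
    linear_combination (π * n ^ 2 * σ.im) * Complex.I_sq
  simp only [hterm] at hs
  have hre' := Complex.hasSum_re hs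
  simp only [Complex.ofReal_re] at hre'
  intro h
  have hpos := (hre'.summable).tsum_pos (fun n => (Real.exp_pos _).le) 0 (Real.exp_pos _)
  rw [hre'.tsum_eq] at hpos
  rw [theta3] at h
  simp [h] at hpos

/-- `θ₁` is a nonzero multiple of the product, since the quotient is elliptic without poles. -/
lemma theta1_eq_const_mul_theta1Prod (hσ : 0 < σ.im) (hre : σ.re = 0) :
    ∃ c : ℂ, c ≠ 0 ∧ ∀ p, theta1 p σ = c * theta1Prod p σ := by
  have hd1 := differentiable_theta1 hσ
  have hdP := differentiable_theta1Prod hσ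
  set f : ℂ → ℂ := fun p => theta1 p σ / theta1Prod p σ with hf
  have h1 : ∀ z, f (z + 1) = f z := fun z => by
    simp only [hf]; rw [theta1_add_one, theta1Prod_add_one, neg_div_neg_eq]
  have hs : ∀ z, f (z + σ) = f z := fun z => by
    simp only [hf]
    rw [theta1_add_self, theta1Prod_add_self hσ, mul_div_mul_left _ _
      (neg_ne_zero.2 (Complex.exp_ne_zero _))]
  have hmer : ∀ z, MeromorphicAt f z := fun z =>
    (hd1.analyticAt z).meromorphicAt.div (hdP.analyticAt z).meromorphicAt
  obtain ⟨d, hd0, hd⟩ := hasDerivAt_theta1Prod_zero hσ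
  have hP0 : theta1Prod 0 σ = 0 := by
    rw [theta1Prod, qProd_eq_mul (norm_exp_two_pi_I_mul_lt_one hσ)]; simp
  have hord0 : 0 ≤ meromorphicOrderAt f 0 := by
    rw [← tendsto_nhds_iff_meromorphicOrderAt_nonneg (hmer 0)]
    have t1 := (hasDerivAt_iff_tendsto_slope.1 (hd1 0).hasDerivAt)
    have t2 := (hasDerivAt_iff_tendsto_slope.1 hd)
    refine ⟨_, (t1.div t2 hd0).congr' ?_⟩
    filter_upwards [self_mem_nhdsWithin] with p hp
    have hp' : p ≠ 0 := hp
    simp only [Pi.div_apply, slope_def_field, theta1_zero, hP0, sub_zero, hf]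
    field_simp
  have hord : ∀ z, 0 ≤ meromorphicOrderAt f z := by
    intro z
    by_cases hz : ∃ m n : ℤ, z = m + n * σ
    · obtain ⟨m, n, rfl⟩ := hz
      have := meromorphicOrderAt_eq_of_periodic (periodic_int_mul_add_int_mul h1 hs m n) 0
      rw [zero_add] at this
      rwa [this]
    · push Not at hz
      exact ((hd1.analyticAt z).div (hdP.analyticAt z)
        (theta1Prod_ne_zero hσ hz)).meromorphicOrderAt_nonneg
  obtain ⟨c, hc⟩ := elliptic_liouville hσ hmer h1 hs hord
  have hc' : ∀ p, (∀ m n : ℤ, p ≠ m + n * σ) → theta1 p σ = c * theta1Prod p σ := by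
    intro p hp
    rw [← hc p ((hdP p).continuousAt |> (hd1 p).continuousAt.div <| theta1Prod_ne_zero hσ hp)]
    simp only [hf]
    rw [div_mul_cancel₀ _ (theta1Prod_ne_zero hσ hp)]
  refine ⟨c, ?_, ?_⟩
  · -- `θ₁` does not vanish at `(1 + σ) / 2`, where it is a multiple of `θ₃(0)`
    rintro rfl
    have hhalf : ∀ m n : ℤ, (1 / 2 + σ / 2 : ℂ) ≠ m + n * σ := by
      intro m n h
      have := congrArg Complex.im h
      simp at this
      have h2 : σ.im * (1 - 2 * n) = 0 := by linear_combination 2 * this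
      rcases mul_eq_zero.1 h2 with h | h
      · exact hσ.ne' h
      · have : (1 : ℤ) = 2 * n := by exact_mod_cast (by linarith : (1 : ℝ) = 2 * n)
        omega
    have h := hc' _ hhalf
    rw [zero_mul, theta1_add_half] at h
    have h4 : theta4 (1 / 2) σ = theta3 0 σ := by
      rw [theta4, theta3, show (1 / 2 + 1 / 2 : ℂ) = 0 + 1 by norm_num, jacobiTheta₂_add_left]
    rw [h4] at h
    exact mul_ne_zero (mul_ne_zero Complex.I_ne_zero (halfPeriodFactor_ne_zero _ _))
      (theta3_zero_ne_zero hσ hre) h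
  · have hcont : Continuous fun p => theta1 p σ - c * theta1Prod p σ :=
      hd1.continuous.sub (continuous_const.mul hdP.continuous)
    have hdense : Dense {p : ℂ | ∀ m n : ℤ, p ≠ m + n * σ} := by
      have : {p : ℂ | ∀ m n : ℤ, p ≠ m + n * σ} =
          (range fun x : ℤ × ℤ => (x.1 + x.2 * σ : ℂ))ᶜ := by
        ext p; simp [eq_comm]
      rw [this]
      exact (countable_range _).dense_compl ℝ
    have := hcont.ext_on hdense (continuous_const (y := (0 : ℂ)))
      (fun p hp => by simp only; rw [hc' p hp, sub_self])
    intro p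
    exact sub_eq_zero.1 (congrFun this p)

theorem theta1_ne_zero (hσ : 0 < σ.im) (hre : σ.re = 0) {p : ℂ}
    (hp : ∀ m n : ℤ, p ≠ m + n * σ) : theta1 p σ ≠ 0 := by
  obtain ⟨c, hc, h⟩ := theta1_eq_const_mul_theta1Prod hσ hre
  rw [h]
  exact mul_ne_zero hc (theta1Prod_ne_zero hσ hp)

theorem theta1DerivZero_ne_zero (hσ : 0 < σ.im) (hre : σ.re = 0) : theta1DerivZero σ ≠ 0 := by
  obtain ⟨c, hc, h⟩ := theta1_eq_const_mul_theta1Prod hσ hre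
  obtain ⟨d, hd0, hd⟩ := hasDerivAt_theta1Prod_zero hσ
  have : HasDerivAt (fun p => theta1 p σ) (c * d) 0 := by
    simp only [h]; exact hd.const_mul c
  rw [theta1DerivZero, this.deriv]
  exact mul_ne_zero hc hd0

lemma hasDerivAt_theta1_zero (hσ : 0 < σ.im) :
    HasDerivAt (fun p => theta1 p σ) (theta1DerivZero σ) 0 :=
  (differentiable_theta1 hσ 0).hasDerivAt

lemma tendsto_theta1_div (hσ : 0 < σ.im) :
    Tendsto (fun p => theta1 p σ / p) (𝓝[≠] 0) (𝓝 (theta1DerivZero σ)) := by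
  refine (hasDerivAt_iff_tendsto_slope.1 (hasDerivAt_theta1_zero hσ)).congr fun p => ?_
  rw [slope_def_field, theta1_zero, sub_zero, sub_zero]

lemma theta1_conj (hre : σ.re = 0) (p : ℂ) :
    (starRingEnd ℂ) (theta1 p σ) = theta1 ((starRingEnd ℂ) p) σ := by
  have hs : (starRingEnd ℂ) σ = -σ := by apply Complex.ext <;> simp [hre]
  rw [← neg_neg (theta1 ((starRingEnd ℂ) p) σ), ← theta1_neg]
  unfold theta1
  simp only [map_mul, map_neg, jacobiTheta₂_conj, ← Complex.exp_conj, map_add, map_div₀, hs,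
    Complex.conj_I, Complex.conj_ofReal, map_ofNat, map_one, neg_neg]
  rw [show (starRingEnd ℂ) p + 1 / 2 + -σ / 2 = -(-(starRingEnd ℂ) p + 1 / 2 + σ / 2) + 1 by ring,
    jacobiTheta₂_add_left, jacobiTheta₂_neg_left,
    show π * -Complex.I * -σ / 4 + π * -Complex.I * (starRingEnd ℂ) p =
      π * Complex.I * σ / 4 + π * Complex.I * -(starRingEnd ℂ) p by ring]
  ring

lemma theta4_conj (hre : σ.re = 0) (p : ℂ) :
    (starRingEnd ℂ) (theta4 p σ) = theta4 ((starRingEnd ℂ) p) σ := by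
  have hs : (starRingEnd ℂ) σ = -σ := by apply Complex.ext <;> simp [hre]
  unfold theta4
  rw [jacobiTheta₂_conj, hs, neg_neg, map_add, map_div₀, map_one, map_ofNat]

lemma theta1DerivZero_conj (hσ : 0 < σ.im) (hre : σ.re = 0) :
    (starRingEnd ℂ) (theta1DerivZero σ) = theta1DerivZero σ := by
  have h := (hasDerivAt_theta1_zero hσ).conj_conj
  have e : (starRingEnd ℂ) ∘ (fun p => theta1 p σ) ∘ (starRingEnd ℂ) = fun p => theta1 p σ := by
    funext p; simp [theta1_conj hre]
  rw [e, map_zero] at h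
  exact (h.unique (hasDerivAt_theta1_zero hσ))

end Theta

/-! ### Contour integrals over a period -/

section Contour

/-- Mean value property on the unit circle. -/
lemma integral_exp_two_pi_I {G : ℂ → ℂ} (hG : DifferentiableOn ℂ G (Metric.closedBall 0 1)) :
    ∫ x in (0 : ℝ)..1, G (Complex.exp (2 * π * Complex.I * x)) = G 0 := by
  have h : Real.circleAverage G 0 1 = G 0 :=
    DiffContOnCl.circleAverage (by
      rw [abs_one]; exact hG.diffContOnCl_ball Subset.rfl)
  rw [Real.circleAverage_def] at h
  rw [← h]
  have := intervalIntegral.integral_comp_mul_left (a := 0) (b := 1)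
    (fun θ : ℝ => G (circleMap 0 1 θ)) (c := 2 * π) (by positivity)
  rw [mul_zero, mul_one] at this
  rw [← this]
  refine intervalIntegral.integral_congr fun x _ => ?_
  simp only [circleMap, Complex.ofReal_one, one_mul, zero_add]
  congr 2
  push_cast; ring

lemma integral_exp_neg_two_pi_I {G : ℂ → ℂ} (hG : DifferentiableOn ℂ G (Metric.closedBall 0 1)) :
    ∫ x in (0 : ℝ)..1, G (Complex.exp (-(2 * π * Complex.I * x))) = G 0 := by
  rw [← integral_exp_two_pi_I hG]
  have h1 := intervalIntegral.integral_comp_neg (a := 0) (b := 1)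
    (fun x : ℝ => G (Complex.exp (2 * π * Complex.I * x)))
  simp only [Complex.ofReal_neg, mul_neg, neg_zero] at h1
  rw [h1]
  have hp : Function.Periodic (fun x : ℝ => G (Complex.exp (2 * π * Complex.I * x))) 1 := by
    intro x
    simp only
    congr 1
    rw [Complex.exp_eq_exp_iff_exists_int]
    exact ⟨1, by push_cast; ring⟩
  simpa using hp.intervalIntegral_add_eq (-1) 0

/-- A `1`-periodic function with simple poles of residue `1` at the integers. -/
noncomputable def expKernel (u : ℂ) : ℂ :=
  2 * π * Complex.I / (Complex.exp (2 * π * Complex.I * u) - 1)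

lemma expKernel_add_one (u : ℂ) : expKernel (u + 1) = expKernel u := by
  unfold expKernel
  congr 2
  rw [Complex.exp_eq_exp_iff_exists_int]
  exact ⟨1, by push_cast; ring⟩

lemma norm_exp_two_pi_I_mul (u : ℂ) :
    ‖Complex.exp (2 * π * Complex.I * u)‖ = Real.exp (-(2 * π * u.im)) := by
  rw [Complex.norm_exp]; congr 1; simp

lemma exp_two_pi_I_mul_sub_one_ne_zero {u : ℂ} (hu : u.im ≠ 0) :
    Complex.exp (2 * π * Complex.I * u) - 1 ≠ 0 := by
  intro h
  have h1 := congrArg norm (sub_eq_zero.1 h)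
  rw [norm_exp_two_pi_I_mul, norm_one, Real.exp_eq_one_iff] at h1
  have := Real.pi_pos
  rcases mul_eq_zero.1 (neg_eq_zero.1 h1) with h | h
  · linarith
  · exact hu h

lemma exp_two_pi_I_mul_sub_one_ne_zero' {u : ℂ} (hu : ∀ n : ℤ, u ≠ n) :
    Complex.exp (2 * π * Complex.I * u) - 1 ≠ 0 := by
  intro h
  obtain ⟨n, hn⟩ := Complex.exp_eq_one_iff.1 (sub_eq_zero.1 h)
  exact hu n (mul_left_cancel₀ Complex.two_pi_I_ne_zero (by linear_combination hn))

lemma differentiableAt_expKernel {u : ℂ} (hu : ∀ n : ℤ, u ≠ n) :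
    DifferentiableAt ℂ expKernel u := by
  unfold expKernel
  exact .div (by fun_prop) (by fun_prop) (exp_two_pi_I_mul_sub_one_ne_zero' hu)

lemma tendsto_mul_expKernel : Tendsto (fun u => u * expKernel u) (𝓝[≠] 0) (𝓝 1) := by
  have h : HasDerivAt (fun u : ℂ => Complex.exp (2 * π * Complex.I * u)) (2 * π * Complex.I) 0 := by
    simpa using ((hasDerivAt_id (0 : ℂ)).const_mul (2 * π * Complex.I)).cexp
  have h2 := ((hasDerivAt_iff_tendsto_slope.1 h).inv₀ Complex.two_pi_I_ne_zero).const_mul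
    (2 * π * Complex.I)
  rw [mul_inv_cancel₀ Complex.two_pi_I_ne_zero] at h2
  refine h2.congr fun u => ?_
  simp only [slope_def_field, mul_zero, Complex.exp_zero, sub_zero, expKernel]
  rw [inv_div]; ring

lemma integral_expKernel_of_neg {y : ℂ} (hy : y.im < 0) :
    ∫ x in (0 : ℝ)..1, expKernel (x + y) = 0 := by
  set c := Complex.exp (-(2 * π * Complex.I * y)) with hc
  have hcn : ‖c‖ < 1 := by
    rw [hc, ← mul_neg, norm_exp_two_pi_I_mul, Real.exp_lt_one_iff]
    have := Real.pi_pos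
    simp only [Complex.neg_im]
    nlinarith
  have := integral_exp_neg_two_pi_I
    (G := fun u => 2 * π * Complex.I * (c * u) / (1 - c * u)) (by
      refine .div (by fun_prop) (by fun_prop) fun u hu h => ?_
      have hu' : ‖u‖ ≤ 1 := by simpa using hu
      have h1 : ‖c * u‖ = 1 := by rw [← sub_eq_zero.1 h, norm_one]
      rw [norm_mul] at h1
      nlinarith [norm_nonneg u, norm_nonneg c])
  simp only [mul_zero, zero_div] at this
  rw [← this]
  refine intervalIntegral.integral_congr fun x _ => ?_
  simp only [expKernel, hc]
  rw [← Complex.exp_add, show -(2 * π * Complex.I * y) + -(2 * π * Complex.I * x) =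
    -(2 * π * Complex.I * (x + y)) by ring, Complex.exp_neg]
  have h1 := exp_two_pi_I_mul_sub_one_ne_zero (u := x + y) (by simpa using hy.ne)
  have h2 : Complex.exp (2 * π * Complex.I * (x + y)) ≠ 0 := Complex.exp_ne_zero _
  have h3 : 1 - (Complex.exp (2 * π * Complex.I * (x + y)))⁻¹ ≠ 0 := by
    rw [show 1 - (Complex.exp (2 * π * Complex.I * (x + y)))⁻¹ =
      (Complex.exp (2 * π * Complex.I * (x + y)) - 1) /
        Complex.exp (2 * π * Complex.I * (x + y)) by field_simp]
    exact div_ne_zero h1 h2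
  rw [div_eq_div_iff h1 h3]
  field_simp

lemma integral_expKernel_of_pos {y : ℂ} (hy : 0 < y.im) :
    ∫ x in (0 : ℝ)..1, expKernel (x + y) = -(2 * π * Complex.I) := by
  set c := Complex.exp (2 * π * Complex.I * y) with hc
  have hcn : ‖c‖ < 1 := by
    rw [hc, norm_exp_two_pi_I_mul, Real.exp_lt_one_iff]
    have := Real.pi_pos
    nlinarith
  have := integral_exp_two_pi_I
    (G := fun u => 2 * π * Complex.I / (c * u - 1)) (by
      refine .div (by fun_prop) (by fun_prop) fun u hu h => ?_
      have hu' : ‖u‖ ≤ 1 := by simpa using hu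
      have h1 : ‖c * u‖ = 1 := by rw [sub_eq_zero.1 h, norm_one]
      rw [norm_mul] at h1
      nlinarith [norm_nonneg u, norm_nonneg c])
  rw [mul_zero, zero_sub, div_neg, div_one] at this
  rw [← this]
  refine intervalIntegral.integral_congr fun x _ => ?_
  simp only [expKernel, hc]
  rw [← Complex.exp_add]
  congr 3
  ring

/-- The integral of `f` over the segment `Im p = y`, `x₀ ≤ Re p ≤ x₀ + 1`. -/
noncomputable def windowInt (x₀ : ℝ) (f : ℂ → ℂ) (y : ℝ) : ℂ :=
  ∫ x in x₀..(x₀ + 1), f (x + y * Complex.I)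

/-- The integral of `f` over the circle `Im p = y` of `ℂ / ℤ`. -/
noncomputable def lineInt (f : ℂ → ℂ) (y : ℝ) : ℂ :=
  ∫ x in (0 : ℝ)..1, f (x + y * Complex.I)

lemma windowInt_eq_lineInt {f : ℂ → ℂ} {y : ℝ} (x₀ : ℝ)
    (h : ∀ z : ℂ, z.im = y → f (z + 1) = f z) : windowInt x₀ f y = lineInt f y := by
  have hp : Function.Periodic (fun x : ℝ => f (x + y * Complex.I)) 1 := by
    intro x
    simp only
    rw [← h (x + y * Complex.I) (by simp)]
    congr 1
    push_cast; ring
  simpa [windowInt, lineInt] using hp.intervalIntegral_add_eq x₀ 0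

lemma windowInt_expKernel_sub (x₀ : ℝ) {y₁ y₂ : ℝ} {s : ℂ} (h1 : y₁ < s.im) (h2 : s.im < y₂) :
    windowInt x₀ (fun z => expKernel (z - s)) y₁ - windowInt x₀ (fun z => expKernel (z - s)) y₂ =
      2 * π * Complex.I := by
  have hper : ∀ z : ℂ, expKernel (z + 1 - s) = expKernel (z - s) := fun z => by
    rw [show z + 1 - s = (z - s) + 1 by ring, expKernel_add_one]
  rw [windowInt_eq_lineInt x₀ (fun z _ => hper z), windowInt_eq_lineInt x₀ (fun z _ => hper z)]
  unfold lineInt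
  have e1 := integral_expKernel_of_neg (y := y₁ * Complex.I - s) (by simpa using h1)
  have e2 := integral_expKernel_of_pos (y := y₂ * Complex.I - s) (by simpa using h2)
  simp only [← add_sub_assoc] at e1 e2
  rw [e1, e2]; ring

/-- **Residue theorem** on a rectangle of width one whose vertical sides cancel. -/
theorem windowInt_sub_windowInt (x₀ : ℝ) {y₁ y₂ : ℝ} (hy : y₁ ≤ y₂) (S : Finset ℂ) :
    ∀ (f r : ℂ → ℂ), (∀ s ∈ S, (x₀ < s.re ∧ s.re < x₀ + 1) ∧ y₁ < s.im ∧ s.im < y₂) →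
    (∀ z : ℂ, z.re = x₀ → y₁ ≤ z.im → z.im ≤ y₂ → f (z + 1) = f z) →
    (∀ z : ℂ, x₀ ≤ z.re → z.re ≤ x₀ + 1 → y₁ ≤ z.im → z.im ≤ y₂ → z ∉ S →
      DifferentiableAt ℂ f z) →
    (∀ s ∈ S, Tendsto (fun z => (z - s) * f z) (𝓝[≠] s) (𝓝 (r s))) →
    windowInt x₀ f y₁ - windowInt x₀ f y₂ = 2 * π * Complex.I * ∑ s ∈ S, r s := by
  classical
  induction S using Finset.induction_on with
  | empty =>
    intro f r _ hper hd _
    have h := Complex.integral_boundary_rect_eq_zero_of_differentiableOn f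
      (x₀ + y₁ * Complex.I) ((x₀ + 1 : ℝ) + y₂ * Complex.I) (by
        intro z hz
        have hz' := hz
        rw [Complex.mem_reProdIm] at hz'
        simp only [Complex.add_re, Complex.ofReal_re, Complex.mul_re, Complex.I_re, mul_zero,
          Complex.ofReal_im, Complex.I_im, mul_one, sub_self, add_zero, Complex.add_im,
          Complex.mul_im, zero_add] at hz'
        rw [uIcc_of_le (by linarith), uIcc_of_le hy] at hz'
        exact (hd z hz'.1.1 hz'.1.2 hz'.2.1 hz'.2.2 (by simp)).differentiableWithinAt)
    simp only [Complex.add_re, Complex.ofReal_re, Complex.mul_re, Complex.I_re, mul_zero,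
          Complex.ofReal_im, Complex.I_im, mul_one, sub_self, add_zero, Complex.add_im,
          Complex.mul_im, zero_add] at h
    have hv : (∫ y in y₁..y₂, f ((x₀ + 1 : ℝ) + y * Complex.I)) =
        ∫ y in y₁..y₂, f (x₀ + y * Complex.I) := by
      refine intervalIntegral.integral_congr fun y hy' => ?_
      rw [uIcc_of_le hy] at hy'
      rw [← hper (x₀ + y * Complex.I) (by simp) (by simpa using hy'.1) (by simpa using hy'.2)]
      congr 1; push_cast; ring
    rw [hv] at h
    simp only [windowInt, Finset.sum_empty, mul_zero]
    linear_combination h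
  | insert s S hs ih =>
    intro f r hS hper hd hr
    have hsS := hS s (Finset.mem_insert_self s S)
    have hyy : y₁ < y₂ := hsS.2.1.trans hsS.2.2
    -- subtract the principal part at `s` and remove the singularity
    set k : ℂ → ℂ := fun z => r s * expKernel (z - s) with hk
    have hkd : ∀ z : ℂ, x₀ ≤ z.re → z.re ≤ x₀ + 1 → z ≠ s → DifferentiableAt ℂ k z := by
      intro z hz1 hz2 hzs
      refine .const_mul (.comp z (differentiableAt_expKernel fun n hn => ?_) (by fun_prop)) _
      have hre := congrArg Complex.re hn
      simp only [Complex.sub_re, Complex.intCast_re] at hre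
      have h1 : (n : ℝ) < 1 := by linarith [hsS.1.1]
      have h2 : (-1 : ℝ) < n := by linarith [hsS.1.2]
      have h1' : n < 1 := by exact_mod_cast h1
      have h2' : -1 < n := by exact_mod_cast h2
      have : n = 0 := by omega
      rw [this, Int.cast_zero] at hn
      exact hzs (sub_eq_zero.1 hn)
    set g : ℂ → ℂ := fun z => f z - k z with hg
    set g' : ℂ → ℂ := Function.update g s (limUnder (𝓝[≠] s) g) with hg'
    have hgg' : ∀ z, z ≠ s → g' =ᶠ[𝓝 z] g := by
      intro z hz
      filter_upwards [isOpen_ne.mem_nhds hz] with w hw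
      rw [hg', Function.update_of_ne hw]
    have hlim : Tendsto (fun z => (z - s) * g z) (𝓝[≠] s) (𝓝 0) := by
      have t1 := hr s (Finset.mem_insert_self s S)
      have t2 : Tendsto (fun z => (z - s) * expKernel (z - s)) (𝓝[≠] s) (𝓝 1) := by
        refine tendsto_mul_expKernel.comp (tendsto_nhdsWithin_iff.2 ⟨?_, ?_⟩)
        · have : Tendsto (fun z : ℂ => z - s) (𝓝 s) (𝓝 (s - s)) :=
            (continuous_id.sub continuous_const).tendsto s
          rw [sub_self] at this
          exact this.mono_left nhdsWithin_le_nhds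
        · filter_upwards [self_mem_nhdsWithin] with z hz
          simpa [sub_eq_zero] using hz
      have := t1.sub (t2.const_mul (r s))
      rw [mul_one, sub_self] at this
      refine this.congr fun z => ?_
      simp only [hg, hk]; ring
    have hdg : ∀ z : ℂ, x₀ ≤ z.re → z.re ≤ x₀ + 1 → y₁ ≤ z.im → z.im ≤ y₂ →
        z ∉ insert s S → DifferentiableAt ℂ g z := fun z a b c d e =>
      (hd z a b c d e).sub (hkd z a b (fun h => e (h ▸ Finset.mem_insert_self s S)))
    have hds : DifferentiableAt ℂ g' s := by
      have hU : IsOpen ((Ioo x₀ (x₀ + 1) ×ℂ Ioo y₁ y₂) \ (S : Set ℂ)) :=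
        (isOpen_Ioo.reProdIm isOpen_Ioo).sdiff S.finite_toSet.isClosed
      have hUs : (Ioo x₀ (x₀ + 1) ×ℂ Ioo y₁ y₂) \ (S : Set ℂ) ∈ 𝓝 s :=
        hU.mem_nhds ⟨⟨hsS.1, hsS.2⟩, by simpa using hs⟩
      refine (Complex.differentiableOn_update_limUnder_of_isLittleO hUs ?_ ?_).differentiableAt hUs
      · intro z hz
        have hz1 := hz.1.1
        rw [Complex.mem_reProdIm] at hz1
        refine (hdg z hz1.1.1.le hz1.1.2.le hz1.2.1.le hz1.2.2.le ?_).differentiableWithinAt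
        rw [Finset.mem_insert]
        rintro (h | h)
        · exact hz.2 h
        · exact hz.1.2 (by simpa using h)
      · have e : Tendsto (fun z : ℂ => (z - s) * (g z - g s)) (𝓝[≠] s) (𝓝 0) := by
          have : Tendsto (fun z : ℂ => (z - s) * g s) (𝓝[≠] s) (𝓝 0) := by
            have : Tendsto (fun z : ℂ => (z - s) * g s) (𝓝 s) (𝓝 ((s - s) * g s)) :=
              Continuous.tendsto (by fun_prop) s
            rw [sub_self, zero_mul] at this
            exact this.mono_left nhdsWithin_le_nhds
          have := hlim.sub this
          rw [sub_zero] at this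
          exact this.congr fun z => by ring
        rw [isLittleO_iff_tendsto']
        · refine e.congr fun z => ?_
          rw [div_inv_eq_mul, mul_comm]
        · filter_upwards [self_mem_nhdsWithin] with z hz h
          exact absurd (inv_eq_zero.1 h) (sub_ne_zero.2 hz)
    have hmain := ih g' r (fun z hz => hS z (Finset.mem_insert_of_mem hz)) ?_ ?_ ?_
    · have hline : ∀ y : ℝ, (y = y₁ ∨ y = y₂) →
          windowInt x₀ g' y = windowInt x₀ f y - windowInt x₀ k y := by
        intro y hyc
        have hne : ∀ x : ℝ, (x + y * Complex.I : ℂ) ≠ s := by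
          intro x h
          have := congrArg Complex.im h
          simp at this
          rcases hyc with h | h <;> rw [h] at this
          · exact hsS.2.1.ne this
          · exact hsS.2.2.ne' this
        have hnS : ∀ x : ℝ, (x + y * Complex.I : ℂ) ∉ insert s S := by
          intro x h
          have := (hS _ h).2
          simp only [Complex.add_im, Complex.ofReal_im, Complex.mul_im, Complex.ofReal_re,
            Complex.I_im, mul_one, Complex.I_re, mul_zero, add_zero, zero_add] at this
          rcases hyc with h | h <;> linarith [this.1, this.2]
        have hy12 : y₁ ≤ y ∧ y ≤ y₂ := by rcases hyc with h | h <;> constructor <;> linarith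
        have hcm : Continuous fun x : ℝ => (x + y * Complex.I : ℂ) := by fun_prop
        unfold windowInt
        rw [← intervalIntegral.integral_sub]
        · refine intervalIntegral.integral_congr fun x _ => ?_
          simp only [hg', Function.update_of_ne (hne x), hg]
        · refine ContinuousOn.intervalIntegrable fun x hx => ?_
          rw [uIcc_of_le (by linarith)] at hx
          exact ((hd _ (by simpa using hx.1) (by simpa using hx.2) (by simpa using hy12.1)
            (by simpa using hy12.2) (hnS x)).continuousAt.comp (f := fun x : ℝ =>
              (x + y * Complex.I : ℂ)) hcm.continuousAt).continuousWithinAt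
        · refine ContinuousOn.intervalIntegrable fun x hx => ?_
          rw [uIcc_of_le (by linarith)] at hx
          exact ((hkd _ (by simpa using hx.1) (by simpa using hx.2) (hne x)).continuousAt.comp
            (f := fun x : ℝ => (x + y * Complex.I : ℂ)) hcm.continuousAt).continuousWithinAt
      rw [hline y₁ (.inl rfl), hline y₂ (.inr rfl)] at hmain
      have hkk : windowInt x₀ k y₁ - windowInt x₀ k y₂ = 2 * π * Complex.I * r s := by
        have := windowInt_expKernel_sub x₀ hsS.2.1 hsS.2.2
        simp only [hk, windowInt, intervalIntegral.integral_const_mul] at this ⊢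
        linear_combination r s * this
      rw [Finset.sum_insert hs]
      linear_combination hmain + hkk
    · intro z hz hz1 hz2
      have hzs : z ≠ s := fun h => by rw [h] at hz; linarith [hsS.1.1]
      have hzs' : z + 1 ≠ s := fun h => by
        have := congrArg Complex.re h
        simp at this; linarith [hsS.1.2]
      rw [(hgg' z hzs).eq_of_nhds, (hgg' _ hzs').eq_of_nhds]
      simp only [hg, hk]
      rw [hper z hz hz1 hz2, show z + 1 - s = (z - s) + 1 by ring, expKernel_add_one]
    · intro z a b c d e
      by_cases hz : z = s
      · rwa [hz]
      · exact (hdg z a b c d (by simp [hz, e])).congr_of_eventuallyEq (hgg' z hz)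
    · intro t ht
      have hts : t ≠ s := fun h => hs (h ▸ ht)
      have hSt := hS t (Finset.mem_insert_of_mem ht)
      have hkc : Tendsto (fun z => (z - t) * k z) (𝓝[≠] t) (𝓝 0) := by
        have h1 : ContinuousAt (fun z => (z - t) * k z) t :=
          (continuousAt_id.sub continuousAt_const).mul
            (hkd t hSt.1.1.le hSt.1.2.le hts).continuousAt
        have h2 := h1.tendsto
        simp only [sub_self, zero_mul] at h2
        exact h2.mono_left nhdsWithin_le_nhds
      have := (hr t (Finset.mem_insert_of_mem ht)).sub hkc
      rw [sub_zero] at this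
      refine this.congr' ?_
      filter_upwards [(hgg' t hts).filter_mono nhdsWithin_le_nhds] with z hz
      rw [hz]; simp only [hg]; ring

/-- **Residue theorem** for `1`-periodic functions on a strip. -/
theorem lineInt_sub_lineInt (x₀ : ℝ) {y₁ y₂ : ℝ} (hy : y₁ ≤ y₂) (S : Finset ℂ) {f r : ℂ → ℂ}
    (hS : ∀ s ∈ S, (x₀ < s.re ∧ s.re < x₀ + 1) ∧ y₁ < s.im ∧ s.im < y₂)
    (hper : ∀ z : ℂ, y₁ ≤ z.im → z.im ≤ y₂ → f (z + 1) = f z)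
    (hd : ∀ z : ℂ, x₀ ≤ z.re → z.re ≤ x₀ + 1 → y₁ ≤ z.im → z.im ≤ y₂ → z ∉ S →
      DifferentiableAt ℂ f z)
    (hr : ∀ s ∈ S, Tendsto (fun z => (z - s) * f z) (𝓝[≠] s) (𝓝 (r s))) :
    lineInt f y₁ - lineInt f y₂ = 2 * π * Complex.I * ∑ s ∈ S, r s := by
  rw [← windowInt_eq_lineInt x₀ (fun z hz => hper z hz.ge (by rw [hz]; exact hy)),
    ← windowInt_eq_lineInt x₀ (fun z hz => hper z (by rw [hz]; exact hy) hz.le)]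
  exact windowInt_sub_windowInt x₀ hy S f r hS (fun z _ => hper z) hd hr

/-- **Cauchy's theorem** for `1`-periodic functions on a strip. -/
theorem lineInt_eq_lineInt {y₁ y₂ : ℝ} {f : ℂ → ℂ} (hy : y₁ ≤ y₂)
    (hper : ∀ z : ℂ, y₁ ≤ z.im → z.im ≤ y₂ → f (z + 1) = f z)
    (hd : ∀ z : ℂ, y₁ ≤ z.im → z.im ≤ y₂ → DifferentiableAt ℂ f z) :
    lineInt f y₁ = lineInt f y₂ := by
  have := lineInt_sub_lineInt 0 hy ∅ (r := 0) (by simp) hper (fun z _ _ a b _ => hd z a b) (by simp)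
  simpa [sub_eq_zero] using this

/-- A function on a line `Im p = y` that is continuous and `1`-periodic in modulus is bounded. -/
lemma exists_bound_of_periodic {f : ℂ → ℂ} {y₁ y₂ : ℝ}
    (hper : ∀ z : ℂ, y₁ ≤ z.im → z.im ≤ y₂ → ‖f (z + 1)‖ = ‖f z‖)
    (hc : ∀ z : ℂ, y₁ ≤ z.im → z.im ≤ y₂ → ContinuousAt f z) :
    ∃ B : ℝ, 0 < B ∧ ∀ z : ℂ, y₁ ≤ z.im → z.im ≤ y₂ → ‖f z‖ ≤ B := by
  have hK : IsCompact (Icc (0 : ℝ) 1 ×ℂ Icc y₁ y₂) := isCompact_Icc.reProdIm isCompact_Icc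
  obtain ⟨B, hB⟩ := hK.exists_bound_of_continuousOn (f := f)
    (fun z hz => (hc z hz.2.1 hz.2.2).continuousWithinAt)
  refine ⟨max B 1, by positivity, fun z h1 h2 => le_max_of_le_left ?_⟩
  have hp : ∀ y : ℝ, y₁ ≤ y → y ≤ y₂ →
      Function.Periodic (fun x : ℝ => ‖f (x + y * Complex.I)‖) 1 := by
    intro y h1 h2 x
    simp only
    rw [← hper (x + y * Complex.I) (by simpa using h1) (by simpa using h2)]
    congr 2
    push_cast; ring
  have hz : z = (z.re : ℂ) + z.im * Complex.I := (Complex.re_add_im z).symm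
  have e := (hp z.im h1 h2).sub_int_mul_eq ⌊z.re⌋ (x := z.re)
  simp only [mul_one] at e
  rw [← hz] at e
  rw [← e]
  apply hB
  rw [Complex.mem_reProdIm]
  refine ⟨?_, by simpa using ⟨h1, h2⟩⟩
  simp only [Complex.add_re, Complex.ofReal_re, Complex.mul_re, Complex.I_re, mul_zero,
    Complex.ofReal_im, Complex.I_im, mul_one, sub_self, add_zero]
  exact ⟨Int.fract_nonneg _, (Int.fract_lt_one _).le⟩

lemma norm_lineInt_le {f : ℂ → ℂ} {y B : ℝ} (h : ∀ z : ℂ, z.im = y → ‖f z‖ ≤ B) :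
    ‖lineInt f y‖ ≤ B := by
  have := intervalIntegral.norm_integral_le_of_norm_le_const (a := (0 : ℝ)) (b := 1)
    (f := fun x : ℝ => f (x + y * Complex.I)) (C := B) (fun x _ => h _ (by simp))
  simpa [lineInt] using this

end Contour

/-! ### Orders of poles -/

section Order

variable {f : ℂ → ℂ} {a : ℂ}

lemma meromorphicOrderAt_pow_mul (hf : MeromorphicAt f a) (n : ℕ) :
    meromorphicOrderAt (fun z => (z - a) ^ n * f z) a = n + meromorphicOrderAt f a := by
  have h : MeromorphicAt (fun z : ℂ => (z - a) ^ n) a := by fun_prop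
  have := meromorphicOrderAt_mul h hf
  rw [show (fun z => (z - a) ^ n * f z) = (fun z : ℂ => (z - a) ^ n) * f from rfl, this]
  congr 1
  have h2 := meromorphicOrderAt_pow_id_sub_const (𝕜 := ℂ) (x := a) (n := n)
  rw [← h2]
  congr 1

lemma neg_le_meromorphicOrderAt_iff (hf : MeromorphicAt f a) (n : ℕ) :
    ((-n : ℤ) : WithTop ℤ) ≤ meromorphicOrderAt f a ↔
      ∃ c, Tendsto (fun z => (z - a) ^ n * f z) (𝓝[≠] a) (𝓝 c) := by
  have h : MeromorphicAt (fun z : ℂ => (z - a) ^ n * f z) a := by fun_prop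
  rw [tendsto_nhds_iff_meromorphicOrderAt_nonneg h, meromorphicOrderAt_pow_mul hf]
  cases meromorphicOrderAt f a with
  | top => simp
  | coe m =>
    norm_cast
    omega

lemma neg_lt_meromorphicOrderAt_iff (hf : MeromorphicAt f a) (n : ℕ) :
    ((-n + 1 : ℤ) : WithTop ℤ) ≤ meromorphicOrderAt f a ↔
      Tendsto (fun z => (z - a) ^ n * f z) (𝓝[≠] a) (𝓝 0) := by
  have h : MeromorphicAt (fun z : ℂ => (z - a) ^ n * f z) a := by fun_prop
  rw [tendsto_zero_iff_meromorphicOrderAt_pos h, meromorphicOrderAt_pow_mul hf]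
  cases meromorphicOrderAt f a with
  | top => simp
  | coe m =>
    norm_cast
    omega

end Order

/-! ### Elliptic functions with one simple pole -/

section Elliptic

variable {σ : ℂ}

lemma lineInt_add_period (hre : σ.re = 0) {f : ℂ → ℂ} (hs : ∀ z, f (z + σ) = f z) (y : ℝ) :
    lineInt f (y + σ.im) = lineInt f y := by
  have hσ' : σ = σ.im * Complex.I := by apply Complex.ext <;> simp [hre]
  refine intervalIntegral.integral_congr fun x _ => ?_
  rw [← hs (x + y * Complex.I)]
  congr 1
  conv_rhs => rw [hσ']
  push_cast; ring

/-- An elliptic function with at most one simple pole is constant, because the residues of an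
elliptic function add up to zero. -/
theorem elliptic_eq_const_of_simple_pole (hσ : 0 < σ.im) (hre : σ.re = 0) {f : ℂ → ℂ}
    (hf : ∀ z, MeromorphicAt f z) (h1 : ∀ z, f (z + 1) = f z) (hs : ∀ z, f (z + σ) = f z) (a : ℂ)
    (hord : ∀ z, (∀ m n : ℤ, z ≠ a + (m + n * σ)) → 0 ≤ meromorphicOrderAt f z)
    (ha : ((-1 : ℤ) : WithTop ℤ) ≤ meromorphicOrderAt f a) :
    ∃ c, ∀ z, ContinuousAt f z → f z = c := by
  refine elliptic_liouville hσ hf h1 hs fun z => ?_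
  by_cases hz : ∃ m n : ℤ, z = a + (m + n * σ)
  swap
  · push Not at hz; exact hord z hz
  obtain ⟨m, n, rfl⟩ := hz
  rw [meromorphicOrderAt_eq_of_periodic (periodic_int_mul_add_int_mul h1 hs m n)]
  set F := toMeromorphicNFOn f univ with hF
  have hf' : MeromorphicOn f univ := fun z _ => hf z
  have hNF : MeromorphicNFOn F univ := meromorphicNFOn_toMeromorphicNFOn f univ
  have hO : ∀ z, meromorphicOrderAt F z = meromorphicOrderAt f z := fun z =>
    meromorphicOrderAt_toMeromorphicNFOn hf' (mem_univ z)
  have hFm : MeromorphicAt F a := (hNF (mem_univ a)).meromorphicAt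
  rw [← hO] at ha ⊢
  obtain ⟨r, hr⟩ := (neg_le_meromorphicOrderAt_iff hFm 1).1 (by exact_mod_cast ha)
  simp only [pow_one] at hr
  have key := lineInt_sub_lineInt (a.re - 1 / 2) (y₁ := a.im - σ.im / 2) (y₂ := a.im + σ.im / 2)
    (by linarith) {a} (f := F) (r := fun _ => r)
    (by
      intro s hs
      rw [Finset.mem_singleton.1 hs]
      refine ⟨⟨?_, ?_⟩, ?_, ?_⟩ <;> linarith)
    (fun z _ _ => periodic_toMeromorphicNFOn hf h1 z)
    (by
      intro z hz1 hz2 hz3 hz4 hza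
      refine ((hNF (mem_univ z)).meromorphicOrderAt_nonneg_iff_analyticAt.1 ?_).differentiableAt
      rw [hO]
      refine hord z fun m n h => hza ?_
      have him := congrArg Complex.im h
      have hre' := congrArg Complex.re h
      simp [hre] at him hre'
      rw [him] at hz3 hz4
      rw [hre'] at hz1 hz2
      have hn1 : (-1 : ℝ) < n := by by_contra hc; nlinarith
      have hn2 : (n : ℝ) < 1 := by by_contra hc; nlinarith
      have hm1 : (-1 : ℝ) < m := by linarith
      have hm2 : (m : ℝ) < 1 := by linarith
      have hn : n = 0 := by
        have : -1 < n := by exact_mod_cast hn1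
        have : n < 1 := by exact_mod_cast hn2
        omega
      have hm : m = 0 := by
        have : -1 < m := by exact_mod_cast hm1
        have : m < 1 := by exact_mod_cast hm2
        omega
      rw [h, hn, hm]; simp)
    (fun s hs => by rw [Finset.mem_singleton.1 hs]; exact hr)
  have e := lineInt_add_period hre (periodic_toMeromorphicNFOn hf hs) (a.im - σ.im / 2)
  rw [show a.im - σ.im / 2 + σ.im = a.im + σ.im / 2 by ring] at e
  rw [← hF] at e
  rw [e, sub_self, Finset.sum_singleton] at key
  have hr0 : r = 0 := by
    rcases mul_eq_zero.1 key.symm with h | h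
    · exact absurd h Complex.two_pi_I_ne_zero
    · exact h
  rw [hr0] at hr
  have := (neg_lt_meromorphicOrderAt_iff hFm 1).2 (by simpa using hr)
  simpa using this

end Elliptic

/-! ### The exponential of the `g`-function -/

section GExp

variable {τ : UpperHalfPlane}

lemma two_tau_im_pos (τ : UpperHalfPlane) : 0 < (2 * τ : ℂ).im := by
  simpa using τ.im_pos

lemma two_tau_re (hτ : τ.re = 0) : (2 * τ : ℂ).re = 0 := by simp [hτ]

lemma coe_tau_im_pos (τ : UpperHalfPlane) : 0 < (τ : ℂ).im := τ.im_pos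

lemma coe_tau_eq (hτ : τ.re = 0) : (τ : ℂ) = τ.im * Complex.I := by
  apply Complex.ext <;> simp [hτ]

/-- `p` is not a point of the lattice `ℤ + τℤ`. -/
def OffLattice (τ : UpperHalfPlane) (p : ℂ) : Prop := ∀ m n : ℤ, p ≠ m + n * τ

lemma mem_lattice_periods {z : ℂ} :
    z ∈ (periods τ).lattice ↔ ∃ m n : ℤ, z = m + n * τ := by
  rw [PeriodPair.mem_lattice]
  simp [periods, eq_comm]

lemma offLattice_iff {z : ℂ} : OffLattice τ z ↔ z ∉ (periods τ).lattice := by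
  rw [mem_lattice_periods]; simp [OffLattice]

lemma OffLattice.add_int {p : ℂ} (h : OffLattice τ p) (a b : ℤ) :
    OffLattice τ (p + (a + b * τ)) := fun m n e =>
  h (m - a) (n - b) (by push_cast; linear_combination e)

lemma OffLattice.add_tau {p : ℂ} (h : OffLattice τ p) : OffLattice τ (p + τ) := by
  simpa using h.add_int 0 1

lemma OffLattice.sub_tau {p : ℂ} (h : OffLattice τ p) : OffLattice τ (p - τ) := by
  simpa [sub_eq_add_neg] using h.add_int 0 (-1)

lemma OffLattice.neg {p : ℂ} (h : OffLattice τ p) : OffLattice τ (-p) := fun m n e =>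
  h (-m) (-n) (by push_cast; linear_combination -e)

lemma offLattice_of_im {p : ℂ} (h0 : p.im ≠ 0) (h : |p.im| < τ.im) : OffLattice τ p := by
  rintro m n rfl
  simp only [Complex.add_im, Complex.intCast_im, Complex.mul_im, Complex.intCast_re,
    UpperHalfPlane.coe_im, zero_mul, add_zero, zero_add, abs_mul, ne_eq, mul_eq_zero,
    not_or] at h h0
  rw [abs_of_pos τ.im_pos] at h
  have h1 : |(n : ℝ)| < 1 := by by_contra hc; nlinarith [τ.im_pos]
  have h2 : |n| < 1 := by exact_mod_cast h1
  exact h0.1 (by exact_mod_cast Int.abs_lt_one_iff.1 h2)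

lemma offLattice_of_ne {p : ℂ} (h0 : ∀ n : ℤ, p ≠ n) (h : |p.im| < τ.im) : OffLattice τ p := by
  by_cases him : p.im = 0
  · rintro m n rfl
    simp only [Complex.add_im, Complex.intCast_im, Complex.mul_im, Complex.intCast_re,
      UpperHalfPlane.coe_im, zero_mul, add_zero, zero_add, mul_eq_zero] at him
    rcases him with h' | h'
    · exact h0 m (by
        have hn : n = 0 := by exact_mod_cast h'
        rw [hn]; simp)
    · exact τ.im_pos.ne' h'
  · exact offLattice_of_im him h

lemma isOpen_offLattice : IsOpen {p : ℂ | OffLattice τ p} := by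
  have : {p : ℂ | OffLattice τ p} = ((periods τ).lattice : Set ℂ)ᶜ := by
    ext p; exact offLattice_iff
  rw [this]
  exact (periods τ).isClosed_lattice.isOpen_compl

lemma OffLattice.eventually {p : ℂ} (h : OffLattice τ p) : ∀ᶠ z in 𝓝 p, OffLattice τ z :=
  isOpen_offLattice.mem_nhds h

lemma eventually_offLattice (τ : UpperHalfPlane) (a : ℂ) : ∀ᶠ z in 𝓝[≠] a, OffLattice τ z := by
  have h := (periods τ).compl_lattice_sdiff_singleton_mem_nhds a
  filter_upwards [nhdsWithin_le_nhds h, self_mem_nhdsWithin] with z hz hza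
  rw [offLattice_iff]
  exact fun hc => hz ⟨hc, hza⟩

lemma theta1_two_ne_zero (hτ : τ.re = 0) {p : ℂ} (hp : ∀ m n : ℤ, p ≠ m + n * (2 * τ)) :
    theta1 p (2 * τ) ≠ 0 :=
  theta1_ne_zero (two_tau_im_pos τ) (two_tau_re hτ) hp

lemma theta4_two_eq (p : ℂ) : theta4 p (2 * τ) =
    Complex.I * halfPeriodFactor (p - τ) (2 * τ) * theta1 (p - τ) (2 * τ) := by
  rw [← theta4_add_half]; congr 1; ring

lemma theta4_two_ne_zero (hτ : τ.re = 0) {p : ℂ} (hp : ∀ m n : ℤ, p ≠ m + (2 * n + 1) * τ) :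
    theta4 p (2 * τ) ≠ 0 := by
  rw [theta4_two_eq]
  refine mul_ne_zero (mul_ne_zero Complex.I_ne_zero (halfPeriodFactor_ne_zero _ _))
    (theta1_two_ne_zero hτ fun m n h => hp m n (by linear_combination h))

lemma theta4_two_ne_zero_of_im (hτ : τ.re = 0) {p : ℂ} (hp : |p.im| < τ.im) :
    theta4 p (2 * τ) ≠ 0 := by
  refine theta4_two_ne_zero hτ fun m n h => ?_
  have him := congrArg Complex.im h
  simp at him
  rw [him, abs_mul, abs_of_pos τ.im_pos] at hp
  have h1 : |(2 * n + 1 : ℝ)| < 1 := by by_contra hc; nlinarith [τ.im_pos]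
  have h2 : |2 * n + 1| < 1 := by exact_mod_cast h1
  have := Int.abs_lt_one_iff.1 h2
  omega

lemma OffLattice.theta1_two_ne_zero (hτ : τ.re = 0) {p : ℂ} (hp : OffLattice τ p) :
    theta1 p (2 * τ) ≠ 0 :=
  EllipticOrthogonality.theta1_two_ne_zero hτ fun m n h => hp m (2 * n) (by push_cast; rw [h]; ring)

lemma OffLattice.theta4_two_ne_zero (hτ : τ.re = 0) {p : ℂ} (hp : OffLattice τ p) :
    theta4 p (2 * τ) ≠ 0 :=
  EllipticOrthogonality.theta4_two_ne_zero hτ fun m n h => hp m (2 * n + 1) (by push_cast; rw [h])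

/-- The constant `θ₁'(0; 2τ) / θ₄(0; 2τ)`; its square is `exp (2ℓ)`. -/
noncomputable def gConst (τ : UpperHalfPlane) : ℂ := theta1DerivZero (2 * τ) / theta4 0 (2 * τ)

/-- `exp (-g)`, as a meromorphic function on `ℂ`. -/
noncomputable def gInv (τ : UpperHalfPlane) (p : ℂ) : ℂ :=
  theta1 p (2 * τ) / (gConst τ * theta4 p (2 * τ))

/-- `exp g`, as a meromorphic function on `ℂ`. -/
noncomputable def gExp (τ : UpperHalfPlane) (p : ℂ) : ℂ := (gInv τ p)⁻¹

/-- The meromorphic continuation of `H` from the annulus `|Im p| < Im τ / 2`: the logarithmic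
derivative of `exp g`. -/
noncomputable def gDeriv (τ : UpperHalfPlane) (p : ℂ) : ℂ := -(deriv (gInv τ) p / gInv τ p)

lemma theta4_zero_ne_zero (hτ : τ.re = 0) : theta4 0 (2 * τ) ≠ 0 :=
  theta4_two_ne_zero_of_im hτ (by simpa using τ.im_pos)

lemma gConst_ne_zero (hτ : τ.re = 0) : gConst τ ≠ 0 :=
  div_ne_zero (theta1DerivZero_ne_zero (two_tau_im_pos τ) (two_tau_re hτ)) (theta4_zero_ne_zero hτ)

lemma gConst_conj (hτ : τ.re = 0) : (starRingEnd ℂ) (gConst τ) = gConst τ := by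
  rw [gConst, map_div₀, theta1DerivZero_conj (two_tau_im_pos τ) (two_tau_re hτ),
    theta4_conj (two_tau_re hτ), map_zero]

lemma exp_two_ell (hτ : τ.re = 0) : (Real.exp (2 * ell τ) : ℂ) = gConst τ ^ 2 := by
  have h1 : -Complex.exp (-Complex.I * π * τ) * theta1DerivZero (2 * τ) ^ 2 /
      theta1 τ (2 * τ) ^ 2 = gConst τ ^ 2 := by
    have e : theta1 τ (2 * τ) = Complex.I * halfPeriodFactor 0 (2 * τ) * theta4 0 (2 * τ) := by
      rw [← theta1_add_half]; congr 1; ring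
    have e2 : halfPeriodFactor 0 (2 * τ) ^ 2 = Complex.exp (-Complex.I * π * τ) := by
      rw [halfPeriodFactor, ← Complex.exp_nat_mul]; congr 1; push_cast; ring
    rw [e, mul_pow, mul_pow, e2, Complex.I_sq, gConst]
    have := Complex.exp_ne_zero (-Complex.I * π * τ)
    have := theta4_zero_ne_zero hτ
    field_simp
  obtain ⟨k, hk⟩ := Complex.conj_eq_iff_real.1 (gConst_conj hτ)
  have hk0 : k ≠ 0 := fun h => gConst_ne_zero hτ (by rw [hk, h]; simp)
  rw [ell, h1, hk, ← Complex.ofReal_pow, Complex.ofReal_re,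
    show 2 * (1 / 2 * Real.log (k ^ 2)) = Real.log (k ^ 2) by ring,
    Real.exp_log (by positivity)]

lemma norm_gConst (hτ : τ.re = 0) : ‖gConst τ‖ = Real.exp (ell τ) := by
  have h := congrArg norm (exp_two_ell hτ)
  rw [norm_pow, Complex.norm_real, Real.norm_eq_abs, abs_of_pos (Real.exp_pos _),
    show 2 * ell τ = ell τ + ell τ by ring, Real.exp_add, ← sq] at h
  exact ((pow_left_inj₀ (Real.exp_pos _).le (norm_nonneg _) two_ne_zero).1 h).symm

lemma gInv_zero : gInv τ 0 = 0 := by simp [gInv, theta1_zero]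

lemma gInv_add_one (p : ℂ) : gInv τ (p + 1) = -gInv τ p := by
  rw [gInv, gInv, theta1_add_one, theta4_add_one, neg_div]

lemma gInv_neg (p : ℂ) : gInv τ (-p) = -gInv τ p := by
  rw [gInv, gInv, theta1_neg, theta4_neg, neg_div]

lemma gInv_conj (hτ : τ.re = 0) (p : ℂ) :
    (starRingEnd ℂ) (gInv τ p) = gInv τ ((starRingEnd ℂ) p) := by
  rw [gInv, gInv, map_div₀, map_mul, theta1_conj (two_tau_re hτ), theta4_conj (two_tau_re hτ),
    gConst_conj hτ]

lemma gInv_add_tau (hτ : τ.re = 0) (p : ℂ) : gInv τ (p + τ) = (gConst τ ^ 2 * gInv τ p)⁻¹ := by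
  have e1 : theta1 (p + τ) (2 * τ) =
      Complex.I * halfPeriodFactor p (2 * τ) * theta4 p (2 * τ) := by
    rw [← theta1_add_half]; congr 1; ring
  have e4 : theta4 (p + τ) (2 * τ) =
      Complex.I * halfPeriodFactor p (2 * τ) * theta1 p (2 * τ) := by
    rw [← theta4_add_half]; congr 1; ring
  have hk := gConst_ne_zero hτ
  have hI := halfPeriodFactor_ne_zero p (2 * τ)
  rw [gInv, gInv, e1, e4]
  by_cases h1 : theta1 p (2 * τ) = 0
  · simp [h1]
  by_cases h4 : theta4 p (2 * τ) = 0
  · simp [h4]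
  field_simp

lemma gExp_add_one (p : ℂ) : gExp τ (p + 1) = -gExp τ p := by
  rw [gExp, gExp, gInv_add_one, inv_neg]

lemma gExp_neg (p : ℂ) : gExp τ (-p) = -gExp τ p := by
  rw [gExp, gExp, gInv_neg, inv_neg]

lemma gExp_add_tau (hτ : τ.re = 0) (p : ℂ) : gExp τ (p + τ) = gConst τ ^ 2 / gExp τ p := by
  rw [gExp, gExp, gInv_add_tau hτ, inv_inv, div_inv_eq_mul]

lemma gExp_sub_tau (hτ : τ.re = 0) (p : ℂ) : gExp τ (p - τ) = gConst τ ^ 2 / gExp τ p := by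
  have := gExp_add_tau hτ (p - τ)
  rw [sub_add_cancel] at this
  have hk := gConst_ne_zero hτ
  rw [this]
  by_cases h : gExp τ (p - τ) = 0
  · simp [h]
  · field_simp

lemma gInv_ne_zero (hτ : τ.re = 0) {p : ℂ} (hp : OffLattice τ p) : gInv τ p ≠ 0 :=
  div_ne_zero (hp.theta1_two_ne_zero hτ) (mul_ne_zero (gConst_ne_zero hτ)
    (hp.theta4_two_ne_zero hτ))

lemma gExp_ne_zero (hτ : τ.re = 0) {p : ℂ} (hp : OffLattice τ p) : gExp τ p ≠ 0 :=
  inv_ne_zero (gInv_ne_zero hτ hp)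

lemma analyticAt_gInv_of_theta4 (hτ : τ.re = 0) {p : ℂ} (hp : theta4 p (2 * τ) ≠ 0) :
    AnalyticAt ℂ (gInv τ) p := by
  have h1 := (differentiable_theta1 (two_tau_im_pos τ)).analyticAt p
  have h4 := (differentiable_theta4 (two_tau_im_pos τ)).analyticAt p
  exact h1.div (analyticAt_const.mul h4) (mul_ne_zero (gConst_ne_zero hτ) hp)

lemma analyticAt_gInv (hτ : τ.re = 0) {p : ℂ} (hp : |p.im| < τ.im) : AnalyticAt ℂ (gInv τ) p :=
  analyticAt_gInv_of_theta4 hτ (theta4_two_ne_zero_of_im hτ hp)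

lemma meromorphicAt_gInv (p : ℂ) : MeromorphicAt (gInv τ) p := by
  have h1 := (differentiable_theta1 (two_tau_im_pos τ)).analyticAt p
  have h4 := (differentiable_theta4 (two_tau_im_pos τ)).analyticAt p
  exact h1.meromorphicAt.div (analyticAt_const.mul h4).meromorphicAt

lemma meromorphicAt_gExp (p : ℂ) : MeromorphicAt (gExp τ) p := (meromorphicAt_gInv p).inv

lemma OffLattice.analyticAt_gInv (hτ : τ.re = 0) {p : ℂ} (hp : OffLattice τ p) :
    AnalyticAt ℂ (gInv τ) p :=
  analyticAt_gInv_of_theta4 hτ (hp.theta4_two_ne_zero hτ)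

lemma OffLattice.analyticAt_gExp (hτ : τ.re = 0) {p : ℂ} (hp : OffLattice τ p) :
    AnalyticAt ℂ (gExp τ) p :=
  (hp.analyticAt_gInv hτ).inv (gInv_ne_zero hτ hp)

lemma OffLattice.analyticAt_gDeriv (hτ : τ.re = 0) {p : ℂ} (hp : OffLattice τ p) :
    AnalyticAt ℂ (gDeriv τ) p :=
  ((hp.analyticAt_gInv hτ).deriv.div (hp.analyticAt_gInv hτ) (gInv_ne_zero hτ hp)).neg

lemma hasDerivAt_gInv_zero (hτ : τ.re = 0) : HasDerivAt (gInv τ) 1 0 := by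
  have h1 := hasDerivAt_theta1_zero (two_tau_im_pos τ)
  have h4 : HasDerivAt (fun p => gConst τ * theta4 p (2 * τ)) _ 0 :=
    ((differentiable_theta4 (two_tau_im_pos τ)) 0).hasDerivAt.const_mul (gConst τ)
  have h := h1.fun_div h4 (mul_ne_zero (gConst_ne_zero hτ) (theta4_zero_ne_zero hτ))
  refine h.congr_deriv ?_
  rw [theta1_zero, zero_mul, sub_zero, gConst]
  have := theta4_zero_ne_zero hτ
  have := theta1DerivZero_ne_zero (two_tau_im_pos τ) (two_tau_re hτ)
  field_simp

lemma tendsto_gInv_div (hτ : τ.re = 0) : Tendsto (fun p => gInv τ p / p) (𝓝[≠] 0) (𝓝 1) := by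
  refine (hasDerivAt_iff_tendsto_slope.1 (hasDerivAt_gInv_zero hτ)).congr fun p => ?_
  rw [slope_def_field, gInv_zero, sub_zero, sub_zero]

lemma tendsto_mul_gExp (hτ : τ.re = 0) : Tendsto (fun p => p * gExp τ p) (𝓝[≠] 0) (𝓝 1) := by
  have := (tendsto_gInv_div hτ).inv₀ one_ne_zero
  rw [inv_one] at this
  refine this.congr fun p => ?_
  rw [inv_div, gExp, div_eq_mul_inv]

lemma tendsto_mul_gDeriv (hτ : τ.re = 0) : Tendsto (fun p => p * gDeriv τ p) (𝓝[≠] 0) (𝓝 (-1)) := by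
  have han : AnalyticAt ℂ (gInv τ) 0 := analyticAt_gInv hτ (by simpa using τ.im_pos)
  have h1 : Tendsto (deriv (gInv τ)) (𝓝[≠] 0) (𝓝 1) := by
    have := han.deriv.continuousAt.tendsto
    rw [(hasDerivAt_gInv_zero hτ).deriv] at this
    exact this.mono_left nhdsWithin_le_nhds
  have := ((tendsto_mul_gExp hτ).mul h1).neg
  rw [mul_one] at this
  refine this.congr fun p => ?_
  rw [gExp, gDeriv]; ring

lemma gDeriv_add_one (p : ℂ) : gDeriv τ (p + 1) = gDeriv τ p := by
  rw [gDeriv, gDeriv, gInv_add_one, ← deriv_comp_add_const,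
    show (fun x => gInv τ (x + 1)) = fun x => -gInv τ x from funext gInv_add_one, deriv.fun_neg,
    neg_div_neg_eq]

lemma gDeriv_neg (p : ℂ) : gDeriv τ (-p) = -gDeriv τ p := by
  have h : deriv (gInv τ) (-p) = deriv (gInv τ) p := by
    have := deriv_comp_neg (f := gInv τ) p
    rw [show (fun x => gInv τ (-x)) = fun x => -gInv τ x from funext gInv_neg,
      deriv.fun_neg] at this
    linear_combination this
  rw [gDeriv, gDeriv, gInv_neg, h, div_neg]

lemma hasDerivAt_gExp (hτ : τ.re = 0) {p : ℂ} (hp : OffLattice τ p) :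
    HasDerivAt (gExp τ) (gDeriv τ p * gExp τ p) p := by
  have h := ((hp.analyticAt_gInv hτ).differentiableAt.hasDerivAt).fun_inv (gInv_ne_zero hτ hp)
  refine h.congr_deriv ?_
  rw [gDeriv, gExp]
  have := gInv_ne_zero hτ hp
  field_simp

lemma gDeriv_add_tau (hτ : τ.re = 0) {p : ℂ} (hp : OffLattice τ p) :
    gDeriv τ (p + τ) = -gDeriv τ p := by
  have h1 : HasDerivAt (fun x => gExp τ (x + τ)) (gDeriv τ (p + τ) * gExp τ (p + τ)) p :=
    (hasDerivAt_gExp hτ hp.add_tau).comp_add_const p τ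
  have h2 : HasDerivAt (fun x => gConst τ ^ 2 * gInv τ x) (gConst τ ^ 2 * deriv (gInv τ) p) p :=
    (hp.analyticAt_gInv hτ).differentiableAt.hasDerivAt.const_mul _
  have e : (fun x => gExp τ (x + τ)) = fun x => gConst τ ^ 2 * gInv τ x := by
    funext x; rw [gExp_add_tau hτ, gExp, div_inv_eq_mul]
  rw [e] at h1
  have h := h1.unique h2
  rw [gExp_add_tau hτ] at h
  have a := gInv_ne_zero hτ hp
  have b := gConst_ne_zero hτ
  have c : deriv (gInv τ) p = -(gDeriv τ p * gInv τ p) := by rw [gDeriv]; field_simp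
  rw [c, gExp, div_inv_eq_mul] at h
  have : gConst τ ^ 2 * gInv τ p * (gDeriv τ (p + τ) + gDeriv τ p) = 0 := by linear_combination h
  rcases mul_eq_zero.1 this with h' | h'
  · exact absurd h' (mul_ne_zero (pow_ne_zero _ b) a)
  · linear_combination h'

/-- On the boundary of the annulus `|Im p| < Im τ / 2` the `g`-function has real part `ℓ`. -/
lemma norm_gInv_of_im_eq (hτ : τ.re = 0) {p : ℂ} (hp : p.im = τ.im / 2) :
    ‖gInv τ p‖ = Real.exp (-ell τ) := by
  have hT := τ.im_pos
  have hoff : OffLattice τ p := offLattice_of_im (by rw [hp]; linarith)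
    (by rw [hp, abs_of_pos (by linarith)]; linarith)
  have hc : (starRingEnd ℂ) p + τ = p := by
    apply Complex.ext
    · simp [hτ]
    · simp [hp]; ring
  have h := gInv_add_tau hτ ((starRingEnd ℂ) p)
  rw [hc, ← gInv_conj hτ] at h
  have h2 := congrArg norm h
  rw [norm_inv, norm_mul, norm_pow, norm_gConst hτ, Complex.norm_conj] at h2
  have hpos : 0 < ‖gInv τ p‖ := norm_pos_iff.2 (gInv_ne_zero hτ hoff)
  have h3 : (Real.exp (ell τ) * ‖gInv τ p‖) ^ 2 = 1 := by
    rw [← one_div, eq_div_iff (by positivity)] at h2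
    linear_combination h2
  have h4 : Real.exp (ell τ) * ‖gInv τ p‖ = 1 :=
    (pow_eq_one_iff_of_nonneg (by positivity) two_ne_zero).1 h3
  rw [Real.exp_neg]
  exact eq_inv_of_mul_eq_one_right h4

lemma norm_gInv_of_im_eq_neg (hτ : τ.re = 0) {p : ℂ} (hp : p.im = -(τ.im / 2)) :
    ‖gInv τ p‖ = Real.exp (-ell τ) := by
  rw [← norm_gInv_of_im_eq hτ (p := -p) (by simp [hp]), gInv_neg, norm_neg]

/-- `Re g > ℓ` in the annulus `|Im p| < Im τ / 2`, by the maximum principle for `exp (-g)`. -/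
theorem norm_gInv_lt (hτ : τ.re = 0) {p : ℂ} (hp : |p.im| < τ.im / 2) :
    ‖gInv τ p‖ < Real.exp (-ell τ) := by
  have hT := τ.im_pos
  have hd : ∀ z : ℂ, -(τ.im / 2) ≤ z.im → z.im ≤ τ.im / 2 → AnalyticAt ℂ (gInv τ) z :=
    fun z h1 h2 => analyticAt_gInv hτ (by rw [abs_lt]; constructor <;> linarith)
  obtain ⟨B, -, hB⟩ := exists_bound_of_periodic (f := gInv τ) (y₁ := -(τ.im / 2))
    (y₂ := τ.im / 2) (fun z _ _ => by rw [gInv_add_one, norm_neg])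
    (fun z h1 h2 => (hd z h1 h2).continuousAt)
  have hU : IsOpen (Complex.im ⁻¹' Ioo (-(τ.im / 2)) (τ.im / 2)) :=
    isOpen_Ioo.preimage Complex.continuous_im
  have hle : ∀ z : ℂ, -(τ.im / 2) ≤ z.im → z.im ≤ τ.im / 2 →
      ‖gInv τ z‖ ≤ Real.exp (-ell τ) := by
    intro z h1 h2
    refine PhragmenLindelof.horizontal_strip (f := gInv τ) (a := -(τ.im / 2)) (b := τ.im / 2)
      ?_ ?_ (fun z hz => (norm_gInv_of_im_eq_neg hτ hz).le)
      (fun z hz => (norm_gInv_of_im_eq hτ hz).le) h1 h2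
    · refine DifferentiableOn.diffContOnCl fun z hz => ?_
      have hcl : z ∈ Complex.im ⁻¹' Icc (-(τ.im / 2)) (τ.im / 2) :=
        closure_minimal (preimage_mono Ioo_subset_Icc_self)
          (isClosed_Icc.preimage Complex.continuous_im) hz
      exact (hd z hcl.1 hcl.2).differentiableAt.differentiableWithinAt
    · refine ⟨0, div_pos Real.pi_pos (by linarith), 0, ?_⟩
      refine IsBigO.of_bound B ?_
      filter_upwards [mem_inf_of_right (mem_principal_self _)] with z hz
      simpa using hB z hz.1.le hz.2.le
  rw [abs_lt] at hp
  refine lt_of_le_of_ne (hle p hp.1.le hp.2.le) fun heq => ?_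
  have hmax : IsMaxOn (norm ∘ gInv τ) (Complex.im ⁻¹' Ioo (-(τ.im / 2)) (τ.im / 2)) p := by
    intro z hz
    simp only [mem_ofPred_eq, Function.comp, heq]
    exact hle z hz.1.le hz.2.le
  have := Complex.norm_eqOn_of_isPreconnected_of_isMaxOn
    (((convex_Ioo _ _).linear_preimage Complex.imLm).isPreconnected) hU
    (fun z hz => (hd z hz.1.le hz.2.le).differentiableAt.differentiableWithinAt) hp hmax
    (x := 0) (by simpa using hT)
  simp only [Function.comp, gInv_zero, norm_zero, Function.const, heq] at this
  exact (Real.exp_pos _).ne this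

end GExp

/-! ### The differential `H` and the `g`-function -/

section GFun

variable {τ : UpperHalfPlane}

lemma weierstrassP_add_one (z : ℂ) :
    (periods τ).weierstrassP (z + 1) = (periods τ).weierstrassP z :=
  (periods τ).weierstrassP_add_coe z ⟨1, mem_lattice_periods.2 ⟨1, 0, by simp⟩⟩

lemma weierstrassP_add_tau (z : ℂ) :
    (periods τ).weierstrassP (z + τ) = (periods τ).weierstrassP z :=
  (periods τ).weierstrassP_add_coe z ⟨τ, mem_lattice_periods.2 ⟨0, 1, by simp⟩⟩

lemma derivWeierstrassP_add_tau (z : ℂ) :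
    (periods τ).derivWeierstrassP (z + τ) = (periods τ).derivWeierstrassP z :=
  (periods τ).derivWeierstrassP_add_coe z ⟨τ, mem_lattice_periods.2 ⟨0, 1, by simp⟩⟩

lemma tendsto_sq_mul_weierstrassP :
    Tendsto (fun p => p ^ 2 * (periods τ).weierstrassP p) (𝓝[≠] 0) (𝓝 1) := by
  have h0 : (0 : ℂ) ∈ (periods τ).lattice := zero_mem _
  have hc := ((periods τ).analyticAt_weierstrassPExcept 0).continuousAt
  have : Tendsto (fun p : ℂ => p ^ 2 * (periods τ).weierstrassPExcept 0 p + 1) (𝓝 0)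
      (𝓝 ((0 : ℂ) ^ 2 * (periods τ).weierstrassPExcept 0 0 + 1)) :=
    ((continuousAt_id.pow 2).mul hc).add continuousAt_const
  rw [zero_pow two_ne_zero, zero_mul, zero_add] at this
  refine (this.mono_left nhdsWithin_le_nhds).congr' ?_
  filter_upwards [self_mem_nhdsWithin] with p hp
  have hp' : p ≠ 0 := hp
  have := (periods τ).weierstrassPExcept_add ⟨0, h0⟩ p
  simp only [sub_zero] at this
  rw [← this]
  field_simp
  simp

/-- `exp (2g) + exp (4ℓ - 2g)` and `℘` have the same poles, hence differ by a constant. -/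
lemma exists_weierstrassP_eq (hτ : τ.re = 0) : ∃ c : ℂ, ∀ p, OffLattice τ p →
    (periods τ).weierstrassP p = gExp τ p ^ 2 + gExp τ (p + τ) ^ 2 - c := by
  set f : ℂ → ℂ := fun p => gExp τ p ^ 2 + gExp τ (p + τ) ^ 2 - (periods τ).weierstrassP p with hf
  have hs2 : ∀ p, gExp τ (p + τ + τ) = gExp τ p := fun p => by
    rw [gExp_add_tau hτ, gExp_add_tau hτ]
    have := gConst_ne_zero hτ
    by_cases h : gExp τ p = 0
    · simp [h]
    · field_simp
  have hm1 : ∀ z, MeromorphicAt (fun p => gExp τ (p + τ)) z := fun z => by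
    have := meromorphicAt_gExp (τ := τ) (z + τ)
    exact this.comp_analyticAt (f := gExp τ) (g := fun p => p + (τ : ℂ)) (by fun_prop)
  have hm : ∀ z, MeromorphicAt f z := fun z =>
    (((meromorphicAt_gExp z).pow 2).add ((hm1 z).pow 2)).sub
      ((periods τ).meromorphic_weierstrassP z)
  have han : ∀ z, OffLattice τ z → AnalyticAt ℂ f z := by
    intro z hz
    refine (((hz.analyticAt_gExp hτ).pow 2).add (AnalyticAt.pow ?_ 2)).sub
      ((periods τ).analyticOnNhd_weierstrassP z (offLattice_iff.1 hz))
    exact AnalyticAt.comp (g := gExp τ) (f := fun p => p + (τ : ℂ))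
      (hz.add_tau.analyticAt_gExp hτ) (by fun_prop)
  obtain ⟨c, hc⟩ := elliptic_eq_const_of_simple_pole (coe_tau_im_pos τ) hτ hm
    (fun z => by
      simp only [hf]
      rw [add_right_comm, gExp_add_one, gExp_add_one, weierstrassP_add_one]; ring)
    (fun z => by
      simp only [hf]
      rw [hs2, weierstrassP_add_tau]; ring) 0
    (fun z hz => (han z fun m n h => hz m n (by rw [h, zero_add])).meromorphicOrderAt_nonneg)
    (by
      have h := (neg_lt_meromorphicOrderAt_iff (hm 0) 2).2 ?_
      · exact_mod_cast h
      have t1 := (tendsto_mul_gExp hτ).pow 2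
      have t2 : Tendsto (fun p : ℂ => p ^ 2 * gExp τ (p + τ) ^ 2) (𝓝[≠] 0) (𝓝 0) := by
        have hc0 : ContinuousAt (fun p : ℂ => p ^ 2 * (gConst τ ^ 2 * gInv τ p) ^ 2) 0 :=
          (continuousAt_id.pow 2).mul ((continuousAt_const.mul
            (hasDerivAt_gInv_zero hτ).continuousAt).pow 2)
        have := hc0.tendsto
        simp only [ne_eq, OfNat.ofNat_ne_zero, not_false_eq_true, zero_pow, zero_mul] at this
        refine (this.mono_left nhdsWithin_le_nhds).congr fun p => ?_
        rw [gExp_add_tau hτ, gExp, div_inv_eq_mul]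
      have := (t1.add t2).sub (tendsto_sq_mul_weierstrassP (τ := τ))
      rw [one_pow, add_zero, sub_self] at this
      refine this.congr fun p => ?_
      simp only [hf]; ring)
  refine ⟨c, fun p hp => ?_⟩
  have := hc p (han p hp).continuousAt
  simp only [hf] at this
  linear_combination -this

lemma tau_div_two_im : ((τ : ℂ) / 2).im = τ.im / 2 := by simp

lemma norm_gExp_gt (hτ : τ.re = 0) {p : ℂ} (hp : |p.im| < τ.im / 2) (ho : OffLattice τ p) :
    Real.exp (ell τ) < ‖gExp τ p‖ := by
  rw [gExp, norm_inv, lt_inv_comm₀ (Real.exp_pos _) (norm_pos_iff.2 (gInv_ne_zero hτ ho)),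
    ← Real.exp_neg]
  exact norm_gInv_lt hτ hp

/-- In the annulus `|Im p| < Im τ / 2`, `H` is the derivative of the `g`-function. -/
theorem H_eq_gDeriv (hτ : τ.re = 0) {p : ℂ} (hp : |p.im| < τ.im / 2) (ho : OffLattice τ p) :
    H τ p = gDeriv τ p := by
  have hT := τ.im_pos
  obtain ⟨c, hc⟩ := exists_weierstrassP_eq hτ
  set L := gConst τ ^ 2 with hL
  have hL0 : L ≠ 0 := pow_ne_zero _ (gConst_ne_zero hτ)
  -- the values at the half periods
  have ho3 : OffLattice τ (τ / 2 : ℂ) := offLattice_of_im (by simp [hT.ne']) (by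
    rw [tau_div_two_im]
    rw [abs_of_pos (by linarith)]; linarith)
  have ho2 : OffLattice τ (1 / 2 + τ / 2 : ℂ) := offLattice_of_im (by simp [hT.ne']) (by
    simp only [Complex.add_im, Complex.div_ofNat_im, Complex.one_im, zero_div, zero_add,
      UpperHalfPlane.coe_im]
    rw [abs_of_pos (by linarith)]; linarith)
  have h3 : gExp τ (τ / 2) ^ 2 = -L := by
    have h := gExp_add_tau hτ (-(τ / 2 : ℂ))
    rw [show -(τ / 2 : ℂ) + τ = τ / 2 by ring, gExp_neg] at h
    have := gExp_ne_zero hτ ho3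
    rw [eq_div_iff (neg_ne_zero.2 this)] at h
    linear_combination -h
  have h2 : gExp τ (1 / 2 + τ / 2) ^ 2 = L := by
    have h := gExp_add_tau hτ (-(-1 / 2 + τ / 2 : ℂ))
    have h1 := gExp_add_one (τ := τ) (-1 / 2 + τ / 2 : ℂ)
    rw [show (-1 / 2 + τ / 2 + 1 : ℂ) = 1 / 2 + τ / 2 by ring] at h1
    rw [show -(-1 / 2 + τ / 2 : ℂ) + τ = 1 / 2 + τ / 2 by ring, gExp_neg, ← h1] at h
    have := gExp_ne_zero hτ ho2
    rw [eq_div_iff this] at h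
    linear_combination h
  have he3 : e3 τ = -2 * L - c := by
    rw [e3, hc _ ho3, gExp_add_tau hτ, div_pow, h3]
    field_simp; ring
  have he2 : e2 τ = 2 * L - c := by
    rw [e2, hc _ ho2, gExp_add_tau hτ, div_pow, h2]
    field_simp; ring
  set E := gExp τ p with hE
  have hE0 : E ≠ 0 := gExp_ne_zero hτ ho
  have hnorm : ‖L / E ^ 2‖ < 1 := by
    have hEpos : 0 < ‖E ^ 2‖ := norm_pos_iff.2 (pow_ne_zero 2 hE0)
    rw [norm_div, div_lt_one hEpos, norm_pow E, hL, norm_pow (gConst τ), norm_gConst hτ]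
    exact pow_lt_pow_left₀ (norm_gExp_gt hτ hp ho) (Real.exp_pos _).le two_ne_zero
  -- `℘ - e₃` and `℘ - e₂` are squares in terms of `t = exp (2ℓ - 2g)`, where `‖t‖ < 1`
  set t := L / E ^ 2 with ht
  have htL : L = t * E ^ 2 := by rw [ht]; field_simp
  have h1t : 1 + t ≠ 0 := fun h => by
    rw [show t = -1 by linear_combination h] at hnorm; simp at hnorm
  have h1t' : 1 - t ≠ 0 := fun h => by
    rw [show t = 1 by linear_combination -h] at hnorm; simp at hnorm
  have hX : (periods τ).weierstrassP p = E ^ 2 + t ^ 2 * E ^ 2 - c := by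
    rw [hc p ho, gExp_add_tau hτ, ← hL, htL, ← hE]; field_simp
  have hrad : radical τ ((periods τ).weierstrassP p) = E ^ 2 * (1 + t) * (1 - t) := by
    have a3 : (periods τ).weierstrassP p - e3 τ = E ^ 2 * (1 + t) ^ 2 := by
      rw [hX, he3, htL]; ring
    have a2 : (periods τ).weierstrassP p - e2 τ = E ^ 2 * (1 - t) ^ 2 := by
      rw [hX, he2, htL]; ring
    rw [radical, a3, a2, mul_div_mul_left _ _ (pow_ne_zero 2 hE0), ← div_pow, one_div,
      Complex.sq_cpow_two_inv]
    · field_simp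
    · -- the Cayley transform maps the unit disc to the right half plane
      have h : ((1 - t) / (1 + t)).re = (1 - ‖t‖ ^ 2) / Complex.normSq (1 + t) := by
        rw [Complex.div_re, ← Complex.normSq_eq_norm_sq, Complex.normSq_apply t, ← add_div]
        congr 1
        simp; ring
      rw [h]
      exact div_pos (by nlinarith [norm_nonneg t]) (Complex.normSq_pos.2 h1t)
  have hder : (periods τ).derivWeierstrassP p = 2 * gDeriv τ p * (E ^ 2 * (1 + t) * (1 - t)) := by
    rw [← (periods τ).deriv_weierstrassP]
    have hd1 := hasDerivAt_gExp hτ ho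
    have hd2 : HasDerivAt (fun x => gExp τ (x + τ)) _ p :=
      (hasDerivAt_gExp hτ ho.add_tau).comp_add_const p τ
    have hd := ((hd1.fun_pow 2).fun_add (hd2.fun_pow 2)).sub_const c
    have hev : (fun x => gExp τ x ^ 2 + gExp τ (x + τ) ^ 2 - c) =ᶠ[𝓝 p]
        (periods τ).weierstrassP := by
      filter_upwards [ho.eventually] with z hz using (hc z hz).symm
    rw [(hd.congr_of_eventuallyEq hev.symm).deriv, gDeriv_add_tau hτ ho, gExp_add_tau hτ, ← hE,
      ← hL, htL]
    field_simp
    push_cast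
    ring
  rw [H, hrad, hder]
  field_simp

/-- On `γ`, the boundary value of `H` from above is minus the continuation of `H` from below. -/
lemma HPlus_eq (hτ : τ.re = 0) (s : ℝ) : HPlus τ (τ / 2 + s) = -gDeriv τ (τ / 2 + s) := by
  have hT := τ.im_pos
  have hoq : OffLattice τ ((τ : ℂ) / 2 + s - τ) := offLattice_of_im (by simp; linarith) (by
    simp only [Complex.sub_im, Complex.add_im, tau_div_two_im, Complex.ofReal_im, add_zero,
      UpperHalfPlane.coe_im]
    rw [abs_lt]; constructor <;> linarith)
  refine Tendsto.limUnder_eq ?_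
  have e := gDeriv_add_tau hτ hoq
  rw [sub_add_cancel] at e
  rw [e, neg_neg]
  have hcont : ContinuousAt (fun δ : ℝ => gDeriv τ ((τ : ℂ) / 2 + s - τ + δ * Complex.I)) 0 := by
    refine ContinuousAt.comp (g := gDeriv τ)
      (f := fun δ : ℝ => (τ : ℂ) / 2 + s - τ + δ * Complex.I) ?_ (by fun_prop)
    simpa using (hoq.analyticAt_gDeriv hτ).continuousAt
  have ht := hcont.tendsto
  simp only [Complex.ofReal_zero, zero_mul, add_zero] at ht
  refine (ht.mono_left nhdsWithin_le_nhds).congr' ?_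
  have hsmall : ∀ᶠ δ : ℝ in 𝓝[>] (0 : ℝ), δ < τ.im / 2 :=
    nhdsWithin_le_nhds (gt_mem_nhds (by linarith))
  filter_upwards [hsmall, self_mem_nhdsWithin] with δ h1 h2
  have h2' : 0 < δ := h2
  have him : ((τ : ℂ) / 2 + s - τ + δ * Complex.I).im = -(τ.im / 2) + δ := by
    simp; ring
  rw [← H_eq_gDeriv hτ (by rw [him, abs_lt]; constructor <;> linarith)
    (offLattice_of_im (by rw [him]; linarith) (by rw [him, abs_lt]; constructor <;> linarith))]
  unfold H
  have e1 : (τ : ℂ) / 2 + s + δ * Complex.I = ((τ : ℂ) / 2 + s - τ + δ * Complex.I) + τ := by ring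
  rw [e1, weierstrassP_add_tau, derivWeierstrassP_add_tau]

/-- `Re g = log |exp g|`. -/
theorem re_gFun (hτ : τ.re = 0) {p : ℂ} (h0 : p.im ≠ 0) (hp : |p.im| < τ.im / 2) :
    (gFun τ p).re = -Real.log ‖gInv τ p‖ := by
  have hT := τ.im_pos
  have hp0 : p ≠ 0 := fun h => h0 (by simp [h])
  have him : ∀ x : ℝ, ((x : ℂ) * p).im = x * p.im := fun x => by simp
  have habs : ∀ x : ℝ, 0 ≤ x → x ≤ 1 → |((x : ℂ) * p).im| < τ.im / 2 := fun x hx0 hx1 => by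
    rw [him, abs_mul, abs_of_nonneg hx0]
    exact lt_of_le_of_lt (mul_le_of_le_one_left (abs_nonneg _) hx1) hp
  have hoff : ∀ x : ℝ, 0 < x → x ≤ 1 → OffLattice τ ((x : ℂ) * p) := fun x hx0 hx1 =>
    offLattice_of_im (by rw [him]; exact mul_ne_zero hx0.ne' h0)
      (lt_trans (habs x hx0.le hx1) (by linarith))
  -- the regular part `-v'/v` of `H`, where `exp (-g) = p v`
  set v : ℂ → ℂ := dslope (gInv τ) 0 with hv
  have hvne : ∀ z : ℂ, z ≠ 0 → v z = gInv τ z / z := fun z hz => by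
    rw [hv, dslope_of_ne _ hz, slope_def_field, gInv_zero, sub_zero, sub_zero]
  have hvan : ∀ z : ℂ, |z.im| < τ.im / 2 → AnalyticAt ℂ v z := by
    intro z hz
    have hU : IsOpen {z : ℂ | |z.im| < τ.im / 2} :=
      isOpen_lt (by fun_prop) continuous_const
    have hd : DifferentiableOn ℂ v {z : ℂ | |z.im| < τ.im / 2} := by
      rw [hv, Complex.differentiableOn_dslope (hU.mem_nhds (by simpa using hT))]
      exact fun w hw =>
        (analyticAt_gInv hτ (lt_trans hw (by linarith))).differentiableAt.differentiableWithinAt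
    exact hd.analyticAt (hU.mem_nhds hz)
  have hv0 : v 0 = 1 := by rw [hv, dslope_same, (hasDerivAt_gInv_zero hτ).deriv]
  have hvn0 : ∀ x : ℝ, 0 ≤ x → x ≤ 1 → v (x * p) ≠ 0 := by
    intro x hx0 hx1
    rcases hx0.eq_or_lt with rfl | hx
    · simp [hv0]
    · have hxp : (x : ℂ) * p ≠ 0 := mul_ne_zero (by exact_mod_cast hx.ne') hp0
      rw [hvne _ hxp]
      exact div_ne_zero (gInv_ne_zero hτ (hoff x hx hx1)) hxp
  set k : ℝ → ℂ := fun x => -(deriv v (x * p) / v (x * p)) * p with hk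
  have hkc : ContinuousOn k (Icc 0 1) := by
    intro x hx
    have hc : ContinuousAt (fun x : ℝ => (x : ℂ) * p) x := by fun_prop
    have ha := hvan _ (habs x hx.1 hx.2)
    refine ContinuousAt.continuousWithinAt ?_
    exact (((ContinuousAt.comp (g := deriv v) (f := fun x : ℝ => (x : ℂ) * p)
      ha.deriv.continuousAt hc).div (ContinuousAt.comp (g := v) (f := fun x : ℝ => (x : ℂ) * p)
      ha.continuousAt hc) (hvn0 x hx.1 hx.2)).neg).mul continuousAt_const
  have hHk : ∀ x : ℝ, 0 < x → x ≤ 1 → H τ (x * p) * p = ((-x⁻¹ : ℝ) : ℂ) + k x := by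
    intro x hx0 hx1
    have hxC : (x : ℂ) ≠ 0 := by exact_mod_cast hx0.ne'
    have hxp : (x : ℂ) * p ≠ 0 := mul_ne_zero hxC hp0
    rw [H_eq_gDeriv hτ (habs x hx0.le hx1) (hoff x hx0 hx1), gDeriv, hk]
    have ha := (hvan _ (habs x hx0.le hx1)).differentiableAt.hasDerivAt
    have hd := (hasDerivAt_id ((x : ℂ) * p)).fun_mul ha
    have hev : gInv τ =ᶠ[𝓝 ((x : ℂ) * p)] fun z => id z * v z := by
      filter_upwards [isOpen_ne.mem_nhds hxp] with z hz
      have hz' : z ≠ 0 := hz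
      rw [hvne z hz', id]; field_simp
    have hvx := hvn0 x hx0.le hx1
    rw [(hd.congr_of_eventuallyEq hev).deriv, hev.eq_of_nhds]
    simp only [id, one_mul]
    push_cast
    field_simp
    ring
  have hkint : IntervalIntegrable k MeasureTheory.volume 0 1 :=
    ContinuousOn.intervalIntegrable (by rwa [uIcc_of_le zero_le_one])
  have hexpr : ∀ t ∈ Ioc (0 : ℝ) 1, -Complex.log (t * p) + ∫ x in t..1, H τ (x * p) * p =
      -Complex.log p + ∫ x in t..1, k x := by
    intro t ht
    have e1 : (∫ x in t..1, H τ (x * p) * p) = ∫ x in t..1, (((-x⁻¹ : ℝ) : ℂ) + k x) := by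
      refine intervalIntegral.integral_congr fun x hx => ?_
      rw [uIcc_of_le ht.2] at hx
      exact hHk x (lt_of_lt_of_le ht.1 hx.1) hx.2
    have hi : IntervalIntegrable (fun x : ℝ => ((-x⁻¹ : ℝ) : ℂ)) MeasureTheory.volume t 1 := by
      refine ContinuousOn.intervalIntegrable fun x hx => ?_
      rw [uIcc_of_le ht.2] at hx
      exact (Complex.continuous_ofReal.continuousAt.comp
        (continuousAt_inv₀ (lt_of_lt_of_le ht.1 hx.1).ne').neg).continuousWithinAt
    rw [e1, intervalIntegral.integral_add hi
      (hkint.mono_set (by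
        rw [uIcc_of_le ht.2, uIcc_of_le zero_le_one]; exact Icc_subset_Icc_left ht.1.le)),
      intervalIntegral.integral_ofReal, intervalIntegral.integral_neg,
      integral_inv_of_pos ht.1 one_pos, Complex.log_ofReal_mul ht.1 hp0, one_div, Real.log_inv,
      neg_neg]
    ring
  have hlim : Tendsto (fun t : ℝ => -Complex.log (t * p) + ∫ x in t..1, H τ (x * p) * p)
      (𝓝[>] 0) (𝓝 (-Complex.log p + ∫ x in (0 : ℝ)..1, k x)) := by
    have hc : ContinuousOn (fun t => ∫ x in t..1, k x) (uIcc 0 1) := by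
      have := intervalIntegral.continuousOn_primitive_interval_left (a := (0 : ℝ)) (b := 1) (f := k)
        (μ := MeasureTheory.volume) (by
          rw [uIcc_of_le zero_le_one]
          exact hkc.integrableOn_Icc)
      exact this
    have h1 := (hc 0 left_mem_uIcc).tendsto
    rw [uIcc_of_le zero_le_one] at h1
    have h2 := h1.mono_left (nhdsWithin_mono (0 : ℝ) Ioc_subset_Icc_self)
    rw [nhdsWithin_Ioc_eq_nhdsGT one_pos] at h2
    refine (h2.const_add (-Complex.log p)).congr' ?_
    filter_upwards [Ioc_mem_nhdsGT one_pos] with t ht using (hexpr t ht).symm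
  rw [gFun, hlim.limUnder_eq]
  -- the real part is computed before passing to the limit
  have hre := (Complex.continuous_re.tendsto _).comp hlim
  refine tendsto_nhds_unique hre ?_
  have hder : ∀ x : ℝ, 0 < x → x ≤ 1 → HasDerivAt (fun x : ℝ => Real.log (‖gExp τ (x * p)‖ ^ 2))
      (2 * (H τ (x * p) * p).re) x := by
    intro x hx0 hx1
    have h1 : HasDerivAt (fun x : ℝ => gExp τ (x * p))
        (gDeriv τ (x * p) * gExp τ (x * p) * p) x := by
      have hin : HasDerivAt (fun x : ℝ => (x : ℂ) * p) p x := by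
        simpa using (Complex.ofRealCLM.hasDerivAt (x := x)).mul_const p
      exact HasDerivAt.comp (h₂ := gExp τ) (h := fun x : ℝ => (x : ℂ) * p) x
        (hasDerivAt_gExp hτ (hoff x hx0 hx1)) hin
    have hne : ‖gExp τ (x * p)‖ ^ 2 ≠ 0 :=
      pow_ne_zero 2 (norm_ne_zero_iff.2 (gExp_ne_zero hτ (hoff x hx0 hx1)))
    refine (h1.norm_sq.log hne).congr_deriv ?_
    rw [H_eq_gDeriv hτ (habs x hx0.le hx1) (hoff x hx0 hx1), div_eq_iff hne, Complex.inner,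
      ← Complex.normSq_eq_norm_sq]
    rw [show gDeriv τ (x * p) * gExp τ (x * p) * p * (starRingEnd ℂ) (gExp τ (x * p)) =
      (gDeriv τ (x * p) * p) * (gExp τ (x * p) * (starRingEnd ℂ) (gExp τ (x * p))) by ring,
      Complex.mul_conj, Complex.re_mul_ofReal]
    ring
  have hE1 : Tendsto (fun t : ℝ => ‖(t : ℂ) * p * gExp τ (t * p)‖) (𝓝[>] 0) (𝓝 1) := by
    have h := (tendsto_mul_gExp hτ).norm
    rw [norm_one] at h
    refine h.comp (f := fun t : ℝ => (t : ℂ) * p) (tendsto_nhdsWithin_iff.2 ⟨?_, ?_⟩)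
    · have : Tendsto (fun t : ℝ => (t : ℂ) * p) (𝓝 0) (𝓝 ((0 : ℝ) * p)) :=
        Continuous.tendsto (by fun_prop) 0
      simp only [Complex.ofReal_zero, zero_mul] at this
      exact this.mono_left nhdsWithin_le_nhds
    · filter_upwards [self_mem_nhdsWithin] with t ht
      have : t ≠ 0 := (show 0 < t from ht).ne'
      exact mul_ne_zero (by exact_mod_cast this) hp0
  have hlog := (Real.continuousAt_log one_ne_zero).tendsto.comp hE1
  rw [Real.log_one] at hlog
  have hfin := hlog.const_sub (-Real.log ‖gInv τ p‖)
  rw [sub_zero] at hfin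
  refine hfin.congr' ?_
  filter_upwards [Ioc_mem_nhdsGT one_pos] with t ht
  have ht0 : (t : ℂ) * p ≠ 0 := mul_ne_zero (by exact_mod_cast ht.1.ne') hp0
  have hint : IntervalIntegrable (fun x : ℝ => H τ (x * p) * p) MeasureTheory.volume t 1 := by
    refine (ContinuousOn.intervalIntegrable (u := fun x : ℝ => gDeriv τ (x * p) * p)
      fun x hx => ?_).congr fun x hx => ?_
    · rw [uIcc_of_le ht.2] at hx
      exact ((ContinuousAt.comp (g := gDeriv τ) (f := fun x : ℝ => (x : ℂ) * p)
        ((hoff x (lt_of_lt_of_le ht.1 hx.1) hx.2).analyticAt_gDeriv hτ).continuousAt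
        (by fun_prop)).mul continuousAt_const).continuousWithinAt
    · rw [uIoc_of_le ht.2] at hx
      have hx0 := lt_trans ht.1 hx.1
      rw [H_eq_gDeriv hτ (habs x hx0.le hx.2) (hoff x hx0 hx.2)]
  have hFTC := intervalIntegral.integral_eq_sub_of_hasDerivAt (a := t) (b := 1)
    (f := fun x : ℝ => Real.log (‖gExp τ (x * p)‖ ^ 2))
    (f' := fun x : ℝ => 2 * (H τ (x * p) * p).re) (fun x hx => by
      rw [uIcc_of_le ht.2] at hx
      exact hder x (lt_of_lt_of_le ht.1 hx.1) hx.2)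
    ((intervalIntegrable_iff_integrableOn_Ioc_of_le ht.2 |>.2
      ((intervalIntegrable_iff_integrableOn_Ioc_of_le ht.2).1 hint).re).const_mul 2)
  rw [intervalIntegral.integral_const_mul] at hFTC
  have hreint : (∫ x in t..1, H τ (x * p) * p).re = ∫ x in t..1, (H τ (x * p) * p).re := by
    have := Complex.reCLM.intervalIntegral_comp_comm hint
    simpa using this.symm
  simp only [Function.comp]
  rw [Complex.add_re, hreint, Complex.neg_re, Complex.log_re]
  simp only [Real.log_pow, Complex.ofReal_one, one_mul] at hFTC
  have hg1 : ‖gExp τ (t * p)‖ ≠ 0 := norm_ne_zero_iff.2 (gExp_ne_zero hτ (hoff t ht.1 ht.2))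
  rw [norm_mul _ (gExp τ _), Real.log_mul (norm_ne_zero_iff.2 ht0) hg1]
  have hgi : Real.log ‖gExp τ p‖ = -Real.log ‖gInv τ p‖ := by rw [gExp, norm_inv, Real.log_inv]
  rw [← hgi]
  push_cast at hFTC
  linarith

end GFun

/-! ### The exponential rate -/

section Rate

variable {τ : UpperHalfPlane} {ε : ℝ}

lemma log_norm_gInv_lt (hτ : τ.re = 0) {p : ℂ} (h0 : p.im ≠ 0) (hp : |p.im| < τ.im / 2) :
    0 < -Real.log ‖gInv τ p‖ - ell τ := by
  have hT := τ.im_pos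
  have h1 : 0 < ‖gInv τ p‖ :=
    norm_pos_iff.2 (gInv_ne_zero hτ (offLattice_of_im h0 (by linarith)))
  have h2 := Real.log_lt_log h1 (norm_gInv_lt hτ hp)
  rw [Real.log_exp] at h2
  linarith

lemma rateSet_eq (hτ : τ.re = 0) (hε : 0 < ε) (hετ : ε < τ.im / 2) :
    {r : ℝ | ∃ p : ℂ, p.re ∈ Icc (0 : ℝ) 1 ∧ |p.im| = τ.im / 2 - ε ∧ r = (gFun τ p).re - ell τ} =
    (fun p => -Real.log ‖gInv τ p‖ - ell τ) ''
      {p : ℂ | p.re ∈ Icc (0 : ℝ) 1 ∧ |p.im| = τ.im / 2 - ε} := by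
  have key : ∀ p : ℂ, |p.im| = τ.im / 2 - ε → (gFun τ p).re = -Real.log ‖gInv τ p‖ := by
    intro p hp
    exact re_gFun hτ (fun h => by rw [h, abs_zero] at hp; linarith) (by rw [hp]; linarith)
  ext r
  constructor
  · rintro ⟨p, h1, h2, rfl⟩
    exact ⟨p, ⟨h1, h2⟩, by simp only [key p h2]⟩
  · rintro ⟨p, ⟨h1, h2⟩, rfl⟩
    exact ⟨p, h1, h2, by rw [key p h2]⟩

lemma isCompact_rateSet (hτ : τ.re = 0) (hε : 0 < ε) (hετ : ε < τ.im / 2) :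
    IsCompact ((fun p => -Real.log ‖gInv τ p‖ - ell τ) ''
      {p : ℂ | p.re ∈ Icc (0 : ℝ) 1 ∧ |p.im| = τ.im / 2 - ε}) := by
  refine IsCompact.image_of_continuousOn ?_ ?_
  · have : IsClosed {p : ℂ | p.re ∈ Icc (0 : ℝ) 1 ∧ |p.im| = τ.im / 2 - ε} :=
      (isClosed_Icc.preimage Complex.continuous_re).inter
        (isClosed_eq (by fun_prop) continuous_const)
    refine (isCompact_Icc.reProdIm (isCompact_Icc (a := -(τ.im / 2)) (b := τ.im / 2))
      ).of_isClosed_subset this (s := Icc (0:ℝ) 1 ×ℂ Icc (-(τ.im / 2)) (τ.im / 2)) ?_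
    rintro p ⟨h1, h2⟩
    refine ⟨h1, ?_⟩
    have := abs_le.1 (show |p.im| ≤ τ.im / 2 by linarith)
    exact ⟨this.1, this.2⟩
  · rintro p ⟨-, h2⟩
    have hoff : OffLattice τ p := offLattice_of_im
      (fun h => by rw [h, abs_zero] at h2; linarith) (by rw [h2]; linarith [τ.im_pos])
    exact ((((hoff.analyticAt_gInv hτ).continuousAt.norm).log
      (norm_ne_zero_iff.2 (gInv_ne_zero hτ hoff))).neg.sub continuousAt_const).continuousWithinAt

theorem rate_pos (hτ : τ.re = 0) (hε : 0 < ε) (hετ : ε < τ.im / 2) : 0 < rate τ ε := by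
  rw [rate, rateSet_eq hτ hε hετ]
  have hne : ((fun p => -Real.log ‖gInv τ p‖ - ell τ) ''
      {p : ℂ | p.re ∈ Icc (0 : ℝ) 1 ∧ |p.im| = τ.im / 2 - ε}).Nonempty := by
    refine Set.Nonempty.image _ ⟨(τ.im / 2 - ε : ℝ) * Complex.I, by simp, ?_⟩
    have : 0 < τ.im / 2 - ε := by linarith
    simp only [Complex.mul_im, Complex.ofReal_re, Complex.I_im, mul_one, Complex.ofReal_im,
      Complex.I_re, mul_zero, add_zero]
    exact abs_of_pos this
  obtain ⟨p, ⟨-, hp⟩, h⟩ := (isCompact_rateSet hτ hε hετ).sInf_mem hne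
  rw [← h]
  have := log_norm_gInv_lt hτ (p := p) (fun h => by rw [h, abs_zero] at hp; linarith)
    (by rw [hp]; linarith)
  simp only
  linarith

/-- The rate is half of the positive minimum of `Re (g - ℓ)` over `γ ± iε`, so that the bound
`Re (g - ℓ) ≥ rate` still holds on lines slightly closer to `γ`. -/
theorem exists_norm_gInv_le (hτ : τ.re = 0) (hε : 0 < ε) (hετ : ε < τ.im / 2) :
    ∃ ε' : ℝ, 0 < ε' ∧ ε' < ε ∧ ∀ p : ℂ, |p.im| = τ.im / 2 - ε' →
      ‖gInv τ p‖ ≤ Real.exp (-(ell τ + rate τ ε)) := by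
  have hT := τ.im_pos
  have hr := rate_pos hτ hε hετ
  have hstrict : ∀ x ∈ Icc (0 : ℝ) 1,
      ‖gInv τ (x + (τ.im / 2 - ε : ℝ) * Complex.I)‖ < Real.exp (-(ell τ + rate τ ε)) := by
    intro x hx
    set p : ℂ := x + (τ.im / 2 - ε : ℝ) * Complex.I with hp
    have him : p.im = τ.im / 2 - ε := by simp [hp]
    have hre : p.re = x := by simp [hp]
    have habs : |p.im| = τ.im / 2 - ε := by rw [him]; exact abs_of_pos (by linarith)
    have hmem : -Real.log ‖gInv τ p‖ - ell τ ∈ (fun p => -Real.log ‖gInv τ p‖ - ell τ) ''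
      {p : ℂ | p.re ∈ Icc (0 : ℝ) 1 ∧ |p.im| = τ.im / 2 - ε} := ⟨p, ⟨by rwa [hre], habs⟩, rfl⟩
    have h1 := csInf_le (isCompact_rateSet hτ hε hετ).bddBelow hmem
    have h2 : sInf ((fun p => -Real.log ‖gInv τ p‖ - ell τ) ''
      {p : ℂ | p.re ∈ Icc (0 : ℝ) 1 ∧ |p.im| = τ.im / 2 - ε}) = 2 * rate τ ε := by
      rw [rate, rateSet_eq hτ hε hετ]; ring
    rw [h2] at h1
    have hpos : 0 < ‖gInv τ p‖ := norm_pos_iff.2 (gInv_ne_zero hτ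
      (offLattice_of_im (by rw [him]; linarith) (by rw [habs]; linarith)))
    rw [← Real.log_lt_iff_lt_exp hpos]
    linarith
  have hev : ∀ᶠ δ in 𝓝 ε, ∀ x ∈ Icc (0 : ℝ) 1,
      ‖gInv τ (x + (τ.im / 2 - δ : ℝ) * Complex.I)‖ < Real.exp (-(ell τ + rate τ ε)) := by
    refine isCompact_Icc.eventually_forall_of_forall_eventually fun x hx => ?_
    have hc : ContinuousAt (fun z : ℝ × ℝ =>
        ‖gInv τ (z.2 + (τ.im / 2 - z.1 : ℝ) * Complex.I)‖) (ε, x) := by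
      refine ContinuousAt.norm (ContinuousAt.comp (g := gInv τ)
        (f := fun z : ℝ × ℝ => (z.2 + (τ.im / 2 - z.1 : ℝ) * Complex.I : ℂ)) ?_ (by fun_prop))
      refine (analyticAt_gInv hτ ?_).continuousAt
      simp only [Complex.add_im, Complex.ofReal_im, Complex.mul_im, Complex.ofReal_re,
        Complex.I_im, mul_one, Complex.I_re, mul_zero, add_zero, zero_add]
      rw [abs_lt]; constructor <;> linarith
    exact hc.eventually_lt continuousAt_const (hstrict x hx)
  obtain ⟨ε', h1, h2⟩ := ((hev.filter_mono (nhdsWithin_le_nhds (s := Iio ε))).and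
    (Ioo_mem_nhdsLT hε)).exists
  refine ⟨ε', h2.1, h2.2, ?_⟩
  have hpos : ∀ p : ℂ, p.im = τ.im / 2 - ε' → ‖gInv τ p‖ ≤ Real.exp (-(ell τ + rate τ ε)) := by
    intro p hp
    have hper : Function.Periodic (fun x : ℝ => ‖gInv τ (x + p.im * Complex.I)‖) 1 := by
      intro x
      simp only
      rw [← norm_neg (gInv τ (x + p.im * Complex.I)), ← gInv_add_one]
      congr 2; push_cast; ring
    have e := hper.sub_int_mul_eq ⌊p.re⌋ (x := p.re)
    simp only [mul_one] at e
    rw [Complex.re_add_im, hp] at e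
    rw [← e]
    exact (h1 _ ⟨Int.fract_nonneg _, (Int.fract_lt_one _).le⟩).le
  intro p hp
  rcases abs_cases p.im with ⟨h, -⟩ | ⟨h, -⟩
  · exact hpos p (by rw [← h, hp])
  · have := hpos (-p) (by rw [Complex.neg_im, ← h, hp])
    rwa [gInv_neg, norm_neg] at this

end Rate

/-! ### The Szegő function and the factorization of the weight -/

section Convolution

lemma line_im (x y : ℝ) : ((x : ℂ) + y * Complex.I).im = y := by simp

lemma continuousOn_line {f : ℂ → ℂ} {y : ℝ}
    (hf : ∀ x ∈ Icc (0 : ℝ) 1, ContinuousAt f (x + y * Complex.I)) :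
    ContinuousOn (fun x : ℝ => f (x + y * Complex.I)) (Icc 0 1) := fun x hx =>
  (ContinuousAt.comp (f := fun x : ℝ => (x : ℂ) + y * Complex.I) (g := f) (hf x hx)
    (by fun_prop)).continuousWithinAt

lemma intervalIntegrable_line {f : ℂ → ℂ} {y : ℝ}
    (hf : ∀ x ∈ Icc (0 : ℝ) 1, ContinuousAt f (x + y * Complex.I)) :
    IntervalIntegrable (fun x : ℝ => f (x + y * Complex.I)) MeasureTheory.volume 0 1 :=
  ContinuousOn.intervalIntegrable (by rw [uIcc_of_le zero_le_one]; exact continuousOn_line hf)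

lemma differentiableAt_lineInt_convolution {k f : ℂ → ℂ} {y : ℝ} {p₀ : ℂ}
    (hk : ∀ x ∈ Icc (0 : ℝ) 1, AnalyticAt ℂ k (p₀ - (x + y * Complex.I)))
    (hf : ∀ x ∈ Icc (0 : ℝ) 1, ContinuousAt f (x + y * Complex.I)) :
    DifferentiableAt ℂ (fun p => lineInt (fun q => k (p - q) * f q) y) p₀ := by
  set V : Set ℂ := {z | AnalyticAt ℂ k z} with hV
  have hVo : IsOpen V := isOpen_analyticAt ℂ k
  set K : Set ℂ := (fun x : ℝ => p₀ - (x + y * Complex.I)) '' Icc 0 1 with hK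
  have hKc : IsCompact K := isCompact_Icc.image (by fun_prop)
  have hKV : K ⊆ V := by rintro _ ⟨x, hx, rfl⟩; exact hk x hx
  obtain ⟨r, hr, hrV⟩ := hKc.exists_cthickening_subset_open hVo hKV
  obtain ⟨B, hB⟩ := (hKc.cthickening (r := r)).exists_bound_of_continuousOn (f := deriv k)
    (fun z hz => (hrV hz : AnalyticAt ℂ k z).deriv.continuousAt.continuousWithinAt)
  obtain ⟨B', hB'⟩ := (isCompact_Icc (a := (0 : ℝ)) (b := 1)).exists_bound_of_continuousOn
    (continuousOn_line hf)
  have hmem : ∀ x ∈ Icc (0 : ℝ) 1, ∀ p ∈ Metric.ball p₀ r,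
      p - (x + y * Complex.I) ∈ Metric.cthickening r K := by
    intro x hx p hp
    refine Metric.mem_cthickening_of_dist_le _ (p₀ - (x + y * Complex.I)) _ _
      (mem_image_of_mem _ hx) ?_
    rw [dist_sub_right]
    exact (Metric.mem_ball.1 hp).le
  have hint : ∀ g : ℂ → ℂ, (∀ z ∈ V, ContinuousAt g z) → ∀ p ∈ Metric.ball p₀ r,
      IntervalIntegrable (fun x : ℝ => g (p - (x + y * Complex.I)) * f (x + y * Complex.I))
        MeasureTheory.volume 0 1 := by
    intro g hg p hp
    refine intervalIntegrable_line (f := fun q => g (p - q) * f q) fun x hx => ?_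
    exact (ContinuousAt.comp (g := g) (f := fun q : ℂ => p - q) (hg _ (hrV (hmem x hx p hp)))
      (by fun_prop)).mul (hf x hx)
  have hb : Metric.ball p₀ r ∈ 𝓝 p₀ := Metric.ball_mem_nhds _ hr
  have hI : uIoc (0 : ℝ) 1 ⊆ Icc 0 1 := by rw [uIoc_of_le zero_le_one]; exact Ioc_subset_Icc_self
  refine (intervalIntegral.hasDerivAt_integral_of_dominated_loc_of_deriv_le
    (μ := MeasureTheory.volume) (a := (0 : ℝ)) (b := 1)
    (F := fun p (x : ℝ) => k (p - (x + y * Complex.I)) * f (x + y * Complex.I))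
    (F' := fun p (x : ℝ) => deriv k (p - (x + y * Complex.I)) * f (x + y * Complex.I))
    (bound := fun _ => B * B') hb ?_ ?_ ?_ ?_ ?_ ?_).2.differentiableAt
  · filter_upwards [hb] with p hp
    exact (hint k (fun z hz => AnalyticAt.continuousAt hz) p hp).def'.aestronglyMeasurable
  · exact hint k (fun z hz => AnalyticAt.continuousAt hz) p₀ (Metric.mem_ball_self hr)
  · exact (hint (deriv k) (fun z hz => (AnalyticAt.deriv hz).continuousAt) p₀
      (Metric.mem_ball_self hr)).def'.aestronglyMeasurable
  · refine Eventually.of_forall fun x hx p hp => ?_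
    have h1 := hB _ (hmem x (hI hx) p hp)
    rw [norm_mul]
    exact mul_le_mul h1 (hB' x (hI hx)) (norm_nonneg _) ((norm_nonneg _).trans h1)
  · exact intervalIntegrable_const
  · refine Eventually.of_forall fun x hx p hp => ?_
    have h1 : AnalyticAt ℂ k (p - (x + y * Complex.I)) := hrV (hmem x (hI hx) p hp)
    exact (h1.differentiableAt.hasDerivAt.comp_sub_const p _).mul_const _

end Convolution

section Szego

variable {τ : UpperHalfPlane} {w : ℂ → ℂ}

lemma tau_div_two_add (hτ : τ.re = 0) (s : ℝ) :
    (τ : ℂ) / 2 + s = s + (τ.im / 2 : ℝ) * Complex.I := by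
  rw [coe_tau_eq hτ]; push_cast; ring

lemma OffLattice.theta1_ne_zero (hτ : τ.re = 0) {p : ℂ} (hp : OffLattice τ p) :
    theta1 p τ ≠ 0 :=
  EllipticOrthogonality.theta1_ne_zero (coe_tau_im_pos τ) hτ hp

lemma offLattice_line {y : ℝ} (h0 : y ≠ 0) (h : |y| < τ.im) (x : ℝ) :
    OffLattice τ (x + y * Complex.I) :=
  offLattice_of_im (by rwa [line_im]) (by rwa [line_im])

lemma tendsto_szego_prefactor (hτ : τ.re = 0) :
    Tendsto (fun p => theta1DerivZero τ * theta1 (p - 1 / 2) τ /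
      (theta1 (1 / 2) τ * (theta1 p τ / p * (p * gDeriv τ p)) * (2 * π * Complex.I))) (𝓝[≠] 0)
      (𝓝 (2 * π * Complex.I)⁻¹) := by
  have hT := τ.im_pos
  have hσ := coe_tau_im_pos τ
  have hhalf : OffLattice τ (1 / 2 : ℂ) := offLattice_of_ne (fun n h => by
    have h2 : (2 * n : ℂ) = 1 := by linear_combination -2 * h
    have h3 : 2 * n = 1 := by exact_mod_cast h2
    omega) (by simpa using hT)
  have hθ : ∀ z, AnalyticAt ℂ (fun p => theta1 p τ) z := fun z =>
    (differentiable_theta1 hσ).analyticAt z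
  have hd0 := theta1DerivZero_ne_zero hσ hτ
  have ht0 := hhalf.theta1_ne_zero hτ
  have t1 : Tendsto (fun p : ℂ => theta1 (p - 1 / 2) τ) (𝓝[≠] 0) (𝓝 (-theta1 (1 / 2) τ)) := by
    have hc : ContinuousAt (fun p : ℂ => theta1 (p - 1 / 2) τ) 0 :=
      ContinuousAt.comp (g := fun p => theta1 p τ) (f := fun u : ℂ => u - 1 / 2)
        (hθ _).continuousAt (by fun_prop)
    have := hc.tendsto
    rw [zero_sub, theta1_neg] at this
    exact this.mono_left nhdsWithin_le_nhds
  have h := (t1.const_mul (theta1DerivZero τ)).div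
    ((((tendsto_theta1_div hσ).mul (tendsto_mul_gDeriv hτ)).const_mul
      (theta1 (1 / 2) τ)).mul_const (2 * π * Complex.I))
    (mul_ne_zero (mul_ne_zero ht0 (mul_ne_zero hd0 (by simp))) Complex.two_pi_I_ne_zero)
  have hl : theta1DerivZero τ * -theta1 (1 / 2) τ /
      (theta1 (1 / 2) τ * (theta1DerivZero τ * -1) * (2 * π * Complex.I)) =
      (2 * π * Complex.I)⁻¹ := by
    have := Complex.two_pi_I_ne_zero
    generalize theta1 (1 / 2) τ = A at ht0 ⊢
    field_simp
  rw [hl] at h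
  exact h

/-- The value at `0` of the Szegő function: the Cauchy kernel and `H` have the same singularity at
`p = 0`, so that their quotient tends to `1`. -/
theorem szegoInfty_eq (hτ : τ.re = 0)
    (hw : ∀ x ∈ Icc (0 : ℝ) 1, ContinuousAt w (x + (τ.im / 2 : ℝ) * Complex.I)) :
    szegoInfty τ w = (2 * π * Complex.I)⁻¹ * lineInt (fun q => -(gDeriv τ q * w q)) (τ.im / 2) := by
  have hT := τ.im_pos
  have hT2 : |τ.im / 2| < τ.im := by rw [abs_of_pos (by linarith)]; linarith
  have hσ := coe_tau_im_pos τ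
  set k : ℂ → ℂ := fun u => theta1 (u + 1 / 2) τ / theta1 u τ with hk
  set f : ℂ → ℂ := fun q => theta1 q τ / theta1 (q - 1 / 2) τ * -(gDeriv τ q * w q) with hf
  have hθ : ∀ z, AnalyticAt ℂ (fun p => theta1 p τ) z := fun z =>
    (differentiable_theta1 hσ).analyticAt z
  have hshift : ∀ q : ℂ, q.im = τ.im / 2 → OffLattice τ (q - 1 / 2) := fun q hq =>
    offLattice_of_im (by simp [hq, hT.ne']) (by simpa [hq] using hT2)
  have hkan : ∀ x ∈ Icc (0 : ℝ) 1, AnalyticAt ℂ k (0 - (x + (τ.im / 2 : ℝ) * Complex.I)) := by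
    intro x _
    have ho := (offLattice_line (by positivity) hT2 x).neg
    rw [zero_sub]
    refine AnalyticAt.div ?_ (hθ _) (ho.theta1_ne_zero hτ)
    exact AnalyticAt.comp (g := fun p => theta1 p τ) (f := fun u : ℂ => u + 1 / 2) (hθ _)
      (by fun_prop)
  have hfc : ∀ x ∈ Icc (0 : ℝ) 1, ContinuousAt f (x + (τ.im / 2 : ℝ) * Complex.I) := by
    intro x hx
    have ho := offLattice_line (τ := τ) (y := τ.im / 2) (by positivity) hT2 x
    have hne := (hshift _ (line_im x (τ.im / 2))).theta1_ne_zero hτ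
    have hgw := ((ho.analyticAt_gDeriv hτ).continuousAt.mul (hw x hx)).neg
    generalize (x : ℂ) + (τ.im / 2 : ℝ) * Complex.I = q at hne hgw ⊢
    have hsh : ContinuousAt (fun u : ℂ => theta1 (u - 1 / 2) τ) q :=
      ContinuousAt.comp (g := fun p => theta1 p τ) (f := fun u : ℂ => u - 1 / 2)
        (hθ _).continuousAt (by fun_prop)
    exact ((hθ q).continuousAt.div hsh hne).mul hgw
  have hcont := (differentiableAt_lineInt_convolution hkan hfc).continuousAt.tendsto
  have h0 : lineInt (fun q => k (0 - q) * f q) (τ.im / 2) =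
      lineInt (fun q => -(gDeriv τ q * w q)) (τ.im / 2) := by
    refine intervalIntegral.integral_congr fun x _ => ?_
    set q : ℂ := x + (τ.im / 2 : ℝ) * Complex.I with hq
    have ho : OffLattice τ q := offLattice_line (by positivity) hT2 x
    have h1 := ho.theta1_ne_zero hτ
    have h2 := (hshift q (line_im _ _)).theta1_ne_zero hτ
    simp only [hk, hf]
    rw [zero_sub, theta1_neg, show -q + 1 / 2 = -(q - 1 / 2) by ring, theta1_neg]
    generalize theta1 (q - 1 / 2) τ = A at h2 ⊢
    field_simp
  rw [h0] at hcont
  have hpre := tendsto_szego_prefactor hτ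
  refine Tendsto.limUnder_eq ?_
  refine (hpre.mul (hcont.mono_left nhdsWithin_le_nhds)).congr' ?_
  have hsmall : ∀ᶠ p : ℂ in 𝓝[≠] 0, |p.im| < τ.im / 2 := by
    have : ∀ᶠ p : ℂ in 𝓝 0, |p.im| < τ.im / 2 :=
      ContinuousAt.eventually_lt (by fun_prop) continuousAt_const (by simpa using hT)
    exact this.filter_mono nhdsWithin_le_nhds
  filter_upwards [hsmall, eventually_offLattice τ 0, self_mem_nhdsWithin] with p hp ho hp0
  have hp0' : p ≠ 0 := hp0
  rw [lineInt, ← intervalIntegral.integral_const_mul, szego]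
  refine intervalIntegral.integral_congr fun x _ => ?_
  rw [HPlus_eq hτ, tau_div_two_add hτ, cauchyKernel, H_eq_gDeriv hτ hp ho]
  simp only [hk, hf]
  rw [show theta1 p τ / p * (p * gDeriv τ p) = theta1 p τ * gDeriv τ p by
    rw [← mul_assoc, div_mul_cancel₀ _ hp0']]
  generalize (x : ℂ) + (τ.im / 2 : ℝ) * Complex.I = q
  generalize theta1 (p - 1 / 2) τ = A₁
  generalize theta1 (1 / 2) τ = A₂
  generalize theta1 (q - 1 / 2) τ = A₃
  generalize theta1 (p - q + 1 / 2) τ = A₄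
  generalize theta1 (p - q) τ = A₅
  generalize theta1 p τ = A₆
  simp only [div_eq_mul_inv, mul_inv]
  ring

/-- The logarithm of the outer factors of the weight, as a Cauchy integral over the line
`Im q = y`; the kernel `gDeriv` has simple poles at the lattice and changes sign under `τ`. -/
noncomputable def logFactor (τ : UpperHalfPlane) (w : ℂ → ℂ) (y : ℝ) (p : ℂ) : ℂ :=
  -((2 * π * Complex.I)⁻¹ * lineInt (fun q => gDeriv τ (p - q) * w q) y)

/-- **Factorization of the weight**: `exp w = φ(q) φ(q - τ)` around `γ`, with `φ` analytic and
zero-free in a neighbourhood of `|Im p| ≤ Im τ / 2`. -/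
theorem exists_factorization (hτ : τ.re = 0) {ε ε' : ℝ} (hε' : 0 < ε') (hεε : ε' < ε)
    (hετ : ε < τ.im / 2)
    (hw : AnalyticOnNhd ℂ w {p : ℂ | |p.im - τ.im / 2| < ε})
    (hwper : ∀ p : ℂ, |p.im - τ.im / 2| < ε → w (p + 1) = w p) :
    ∃ φ : ℂ → ℂ, (∀ p, φ p ≠ 0) ∧ (∀ p, φ (p + 1) = φ p) ∧
      (∀ p : ℂ, |p.im| < τ.im / 2 + ε' → AnalyticAt ℂ φ p) ∧
      (∀ q : ℂ, |q.im - τ.im / 2| < ε' → φ q * φ (q - τ) = Complex.exp (w q)) ∧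
      φ 0 ^ 2 = Complex.exp (-2 * szegoInfty τ w) := by
  have hT := τ.im_pos
  -- moving the line of integration to `Im q = a` or `Im q = b` continues the Cauchy integral
  -- beyond either side of the annulus
  obtain ⟨y, hy1, hy2⟩ := exists_between hεε
  set a := τ.im / 2 + y with ha
  set b := τ.im / 2 - y with hb
  have hwan : ∀ q : ℂ, b ≤ q.im → q.im ≤ a → AnalyticAt ℂ w q := fun q h1 h2 =>
    hw q (show |q.im - τ.im / 2| < ε by rw [abs_lt]; constructor <;> linarith)
  have hwp : ∀ q : ℂ, b ≤ q.im → q.im ≤ a → w (q + 1) = w q := fun q h1 h2 =>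
    hwper q (show |q.im - τ.im / 2| < ε by rw [abs_lt]; constructor <;> linarith)
  have hg1 : ∀ u, gDeriv τ (u - 1) = gDeriv τ u := fun u => by
    rw [← gDeriv_add_one (u - 1), sub_add_cancel]
  have hdiff : ∀ y' : ℝ, b ≤ y' → y' ≤ a → ∀ p : ℂ, p.im ≠ y' → |p.im - y'| < τ.im →
      DifferentiableAt ℂ (logFactor τ w y') p := by
    intro y' h1 h2 p hp1 hp2
    refine (DifferentiableAt.const_mul (differentiableAt_lineInt_convolution (fun x _ => ?_)
      (fun x _ => ?_)) _).neg
    · refine (offLattice_of_im ?_ ?_).analyticAt_gDeriv hτ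
      · rw [Complex.sub_im, line_im]; exact sub_ne_zero.2 hp1
      · rwa [Complex.sub_im, line_im]
    · exact (hwan _ (by rwa [line_im]) (by rwa [line_im])).continuousAt
  have hsame : ∀ p : ℂ, |p.im| < b → logFactor τ w a p = logFactor τ w b p := by
    intro p hp
    rw [abs_lt] at hp
    simp only [logFactor]
    rw [lineInt_eq_lineInt (y₁ := b) (y₂ := a) (by linarith)]
    · intro z h1 h2
      rw [hwp z h1 h2, ← sub_sub, hg1]
    · intro z h1 h2
      have hoff : OffLattice τ (p - z) := by
        refine offLattice_of_im ?_ ?_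
        · rw [Complex.sub_im]; intro h; linarith
        · rw [Complex.sub_im, abs_lt]; constructor <;> linarith
      refine DifferentiableAt.mul ?_ (hwan z h1 h2).differentiableAt
      exact DifferentiableAt.comp (g := gDeriv τ) (f := fun z : ℂ => p - z) z
        (hoff.analyticAt_gDeriv hτ).differentiableAt (by fun_prop)
  set s : ℂ → ℂ := fun p => if 0 ≤ p.im then logFactor τ w a p else logFactor τ w b p with hs
  have hsa : ∀ p : ℂ, -b < p.im → s p = logFactor τ w a p := by
    intro p hp
    simp only [hs]
    split_ifs with h
    · rfl
    · exact (hsame p (by rw [abs_lt]; constructor <;> linarith)).symm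
  have hsb : ∀ p : ℂ, p.im < b → s p = logFactor τ w b p := by
    intro p hp
    simp only [hs]
    split_ifs with h
    · exact hsame p (by rw [abs_lt]; constructor <;> linarith)
    · rfl
  have hoa : IsOpen {p : ℂ | -b < p.im ∧ p.im < a} :=
    (isOpen_lt continuous_const Complex.continuous_im).inter
      (isOpen_lt Complex.continuous_im continuous_const)
  have hob : IsOpen {p : ℂ | -a < p.im ∧ p.im < b} :=
    (isOpen_lt continuous_const Complex.continuous_im).inter
      (isOpen_lt Complex.continuous_im continuous_const)
  have hsan : ∀ p : ℂ, |p.im| < τ.im / 2 + ε' → AnalyticAt ℂ s p := by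
    intro p hp
    rw [abs_lt] at hp
    rcases le_total 0 p.im with h | h
    · have hd : DifferentiableOn ℂ s {p : ℂ | -b < p.im ∧ p.im < a} := by
        intro z hz
        have h1 := hdiff a (by linarith) le_rfl z hz.2.ne
          (by rw [abs_lt]; constructor <;> linarith [hz.1, hz.2])
        exact h1.differentiableWithinAt.congr (fun u hu => hsa u hu.1) (hsa z hz.1)
      exact hd.analyticAt (hoa.mem_nhds ⟨by linarith, by linarith⟩)
    · have hd : DifferentiableOn ℂ s {p : ℂ | -a < p.im ∧ p.im < b} := by
        intro z hz
        have h1 := hdiff b le_rfl (by linarith) z hz.2.ne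
          (by rw [abs_lt]; constructor <;> linarith [hz.1, hz.2])
        exact h1.differentiableWithinAt.congr (fun u hu => hsb u hu.2) (hsb z hz.2)
      exact hd.analyticAt (hob.mem_nhds ⟨by linarith, by linarith⟩)
  have hlog1 : ∀ y' p, logFactor τ w y' (p + 1) = logFactor τ w y' p := by
    intro y' p
    simp only [logFactor]
    congr 4
    ext q
    rw [add_sub_right_comm, gDeriv_add_one]
  refine ⟨fun p => Complex.exp (s p), fun p => Complex.exp_ne_zero _, fun p => ?_,
    fun p hp => (hsan p hp).cexp, fun q hq => ?_, ?_⟩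
  · simp only [hs, Complex.add_im, Complex.one_im, add_zero, hlog1]
  · rw [abs_lt] at hq
    rw [← Complex.exp_add, hsa q (by linarith), hsb (q - τ) (by
      rw [Complex.sub_im, UpperHalfPlane.coe_im]; linarith)]
    congr 1
    -- because of the change of sign under `τ`, the sum of the logarithms is a difference of
    -- integrals over two lines, that is, the residue at `q`
    have hflip : lineInt (fun u => gDeriv τ (q - τ - u) * w u) b =
        -lineInt (fun u => gDeriv τ (q - u) * w u) b := by
      rw [lineInt, lineInt, ← intervalIntegral.integral_neg]
      refine intervalIntegral.integral_congr fun x _ => ?_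
      have ho : OffLattice τ (q - τ - (x + b * Complex.I)) := by
        refine offLattice_of_im ?_ ?_ <;>
          rw [Complex.sub_im, Complex.sub_im, line_im, UpperHalfPlane.coe_im]
        · intro h; linarith
        · rw [abs_lt]; constructor <;> linarith
      have e := gDeriv_add_tau hτ ho
      rw [show q - τ - (x + b * Complex.I) + τ = q - (x + b * Complex.I) by ring] at e
      rw [e]; ring
    have hres := lineInt_sub_lineInt (q.re - 1 / 2) (y₁ := b) (y₂ := a) (by linarith) {q}
      (f := fun u => gDeriv τ (q - u) * w u) (r := w)
      (by
        intro u hu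
        rw [Finset.mem_singleton] at hu
        subst hu
        refine ⟨⟨by linarith, by linarith⟩, by linarith, by linarith⟩)
      (fun z h1 h2 => by rw [hwp z h1 h2, ← sub_sub, hg1])
      (by
        intro z h1 h2 h3 h4 hz
        rw [Finset.mem_singleton] at hz
        have hoff : OffLattice τ (q - z) := by
          refine offLattice_of_ne (fun n hn => ?_) (by
            rw [Complex.sub_im, abs_lt]; constructor <;> linarith)
          have hre := congrArg Complex.re hn
          simp only [Complex.sub_re, Complex.intCast_re] at hre
          have hn0 : n = 0 := by
            have l1 : (-1 : ℝ) < n := by linarith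
            have l2 : (n : ℝ) < 1 := by linarith
            have l1' : -1 < n := by exact_mod_cast l1
            have l2' : n < 1 := by exact_mod_cast l2
            omega
          rw [hn0, Int.cast_zero] at hn
          exact hz (sub_eq_zero.1 hn).symm
        refine DifferentiableAt.mul ?_ (hwan z h3 h4).differentiableAt
        exact DifferentiableAt.comp (g := gDeriv τ) (f := fun z : ℂ => q - z) z
          (hoff.analyticAt_gDeriv hτ).differentiableAt (by fun_prop))
      (by
        intro u hu
        rw [Finset.mem_singleton] at hu
        subst hu
        have ht : Tendsto (fun z : ℂ => u - z) (𝓝[≠] u) (𝓝[≠] 0) := by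
          refine tendsto_nhdsWithin_iff.2 ⟨?_, ?_⟩
          · have : Tendsto (fun z : ℂ => u - z) (𝓝 u) (𝓝 (u - u)) :=
              Continuous.tendsto (by fun_prop) u
            rw [sub_self] at this
            exact this.mono_left nhdsWithin_le_nhds
          · filter_upwards [self_mem_nhdsWithin] with z hz
            exact sub_ne_zero.2 (Ne.symm hz)
        have hwc := (hwan u (by linarith) (by linarith)).continuousAt.tendsto
        have := (((tendsto_mul_gDeriv hτ).comp ht).neg).mul
          (hwc.mono_left (nhdsWithin_le_nhds (s := {u}ᶜ)))
        rw [neg_neg, one_mul] at this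
        refine this.congr fun z => ?_
        simp only [Function.comp]
        ring)
    rw [Finset.sum_singleton] at hres
    simp only [logFactor, hflip]
    have h2 := Complex.two_pi_I_ne_zero
    field_simp
    linear_combination hres
  · rw [← Complex.exp_nat_mul]
    congr 1
    have h0 : s 0 = logFactor τ w a 0 := hsa 0 (by simp; linarith)
    rw [h0, szegoInfty_eq hτ (fun x _ => (hwan _ (by rw [line_im]; linarith)
      (by rw [line_im]; linarith)).continuousAt), logFactor]
    have e1 : lineInt (fun q => gDeriv τ (0 - q) * w q) a =
        lineInt (fun q => -(gDeriv τ q * w q)) a := by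
      congr 1; ext q; rw [zero_sub, gDeriv_neg]; ring
    have e2 : lineInt (fun q => -(gDeriv τ q * w q)) (τ.im / 2) =
        lineInt (fun q => -(gDeriv τ q * w q)) a := by
      refine lineInt_eq_lineInt (by linarith) (fun z h1 h2 => ?_) (fun z h1 h2 => ?_)
      · rw [gDeriv_add_one, hwp z (by linarith) h2]
      · exact (((offLattice_of_im (by linarith) (by rw [abs_lt]; constructor <;> linarith)
          ).analyticAt_gDeriv hτ).differentiableAt.mul
          (hwan z (by linarith) h2).differentiableAt).neg
    rw [e1, e2]
    push_cast
    ring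

end Szego

/-! ### Sections of `𝒪(n(0) + (D))` -/

section Sections

variable {τ : UpperHalfPlane} {D : ℝ} {n : ℕ} {f g : ℂ → ℂ}

lemma offLattice_ofReal {x : ℝ} (h0 : 0 < x) (h1 : x < 1) : OffLattice τ (x : ℂ) := by
  refine offLattice_of_ne (fun n h => ?_) (by simpa using τ.im_pos)
  have h' : x = n := by exact_mod_cast h
  rw [h'] at h0 h1
  have h0' : 0 < n := by exact_mod_cast h0
  have h1' : n < 1 := by exact_mod_cast h1
  omega

lemma offLattice_div {D : ℝ} (hD : D ∈ Ioo (0 : ℝ) 1) {k : ℕ} (hk : k ≠ 0) :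
    OffLattice τ ((D / (2 * k) : ℝ) : ℂ) ∧ OffLattice τ ((D - D / (2 * k) : ℝ) : ℂ) := by
  have hk1 : (1 : ℝ) ≤ k := by exact_mod_cast Nat.one_le_iff_ne_zero.2 hk
  have h1 : 0 < D / (2 * k) := div_pos hD.1 (by linarith)
  have h2 : D / (2 * k) ≤ D / 2 := by
    refine div_le_div_of_nonneg_left hD.1.le two_pos (by linarith)
  have := hD.1
  have := hD.2
  exact ⟨offLattice_ofReal h1 (by linarith), offLattice_ofReal (by linarith) (by linarith)⟩

/-- `z` is neither a point of the lattice nor a translate of `D`. -/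
def OffPoles (τ : UpperHalfPlane) (D : ℝ) (z : ℂ) : Prop := OffLattice τ z ∧ OffLattice τ (z - D)

lemma offPoles_of_im {z : ℂ} (h0 : z.im ≠ 0) (h : |z.im| < τ.im) : OffPoles τ D z :=
  ⟨offLattice_of_im h0 h, offLattice_of_im (by simpa using h0) (by simpa using h)⟩

/-- Sections of `𝒪(n(0) + (D))`, without a condition on the values at the points of the divisor:
elliptic functions, analytic off the divisor, with a pole of order at most `n` at `0` and at most
one at `D`. -/
structure IsPresection (τ : UpperHalfPlane) (D : ℝ) (n : ℕ) (f : ℂ → ℂ) : Prop where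
  meromorphicAt : ∀ z, MeromorphicAt f z
  add_one : ∀ z, f (z + 1) = f z
  add_tau : ∀ z, f (z + τ) = f z
  analyticAt : ∀ z, OffPoles τ D z → AnalyticAt ℂ f z
  tendsto_zero : ∃ c, Tendsto (fun p => p ^ n * f p) (𝓝[≠] 0) (𝓝 c)
  tendsto_D : ∃ c, Tendsto (fun p => (p - D) * f p) (𝓝[≠] (D : ℂ)) (𝓝 c)

lemma IsPresection.sub (hf : IsPresection τ D n f) (hg : IsPresection τ D n g) :
    IsPresection τ D n (fun z => f z - g z) where
  meromorphicAt z := (hf.meromorphicAt z).sub (hg.meromorphicAt z)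
  add_one z := by rw [hf.add_one, hg.add_one]
  add_tau z := by rw [hf.add_tau, hg.add_tau]
  analyticAt z hz := (hf.analyticAt z hz).sub (hg.analyticAt z hz)
  tendsto_zero := by
    obtain ⟨c, hc⟩ := hf.tendsto_zero
    obtain ⟨d, hd⟩ := hg.tendsto_zero
    exact ⟨c - d, (hc.sub hd).congr fun p => by ring⟩
  tendsto_D := by
    obtain ⟨c, hc⟩ := hf.tendsto_D
    obtain ⟨d, hd⟩ := hg.tendsto_D
    exact ⟨c - d, (hc.sub hd).congr fun p => by ring⟩

lemma IsPresection.const_mul (hf : IsPresection τ D n f) (a : ℂ) :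
    IsPresection τ D n (fun z => a * f z) where
  meromorphicAt z := (MeromorphicAt.const a z).mul (hf.meromorphicAt z)
  add_one z := by rw [hf.add_one]
  add_tau z := by rw [hf.add_tau]
  analyticAt z hz := analyticAt_const.mul (hf.analyticAt z hz)
  tendsto_zero := by
    obtain ⟨c, hc⟩ := hf.tendsto_zero
    exact ⟨a * c, (hc.const_mul a).congr fun p => by ring⟩
  tendsto_D := by
    obtain ⟨c, hc⟩ := hf.tendsto_D
    exact ⟨a * c, (hc.const_mul a).congr fun p => by ring⟩

lemma IsPresection.add (hf : IsPresection τ D n f) (hg : IsPresection τ D n g) :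
    IsPresection τ D n (fun z => f z + g z) := by
  simpa using hf.sub (hg.const_mul (-1))

lemma isPresection_const (a : ℂ) : IsPresection τ D 0 (fun _ => a) where
  meromorphicAt z := MeromorphicAt.const a z
  add_one z := rfl
  add_tau z := rfl
  analyticAt z hz := analyticAt_const
  tendsto_zero := ⟨a, by simp⟩
  tendsto_D := ⟨(D - D) * a, by
    have : ContinuousAt (fun p : ℂ => (p - D) * a) D := by fun_prop
    exact this.tendsto.mono_left nhdsWithin_le_nhds⟩

lemma tendsto_pow_nhdsNE_zero {m : ℕ} (hm : m ≠ 0) :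
    Tendsto (fun p : ℂ => p ^ m) (𝓝[≠] 0) (𝓝 0) := by
  have : ContinuousAt (fun p : ℂ => p ^ m) 0 := by fun_prop
  have h := this.tendsto
  rw [zero_pow hm] at h
  exact h.mono_left nhdsWithin_le_nhds

lemma IsPresection.tendsto_of_lt (hf : IsPresection τ D n f) {m : ℕ} (h : n < m) :
    Tendsto (fun p => p ^ m * f p) (𝓝[≠] 0) (𝓝 0) := by
  obtain ⟨c, hc⟩ := hf.tendsto_zero
  have := (tendsto_pow_nhdsNE_zero (Nat.sub_ne_zero_of_lt h)).mul hc
  rw [zero_mul] at this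
  refine this.congr fun p => ?_
  rw [← mul_assoc, ← pow_add, Nat.sub_add_cancel h.le]

lemma IsPresection.mono (hf : IsPresection τ D n f) {m : ℕ} (h : n ≤ m) : IsPresection τ D m f := by
  rcases h.eq_or_lt with rfl | h
  · exact hf
  · exact ⟨hf.1, hf.2, hf.3, hf.4, ⟨0, hf.tendsto_of_lt h⟩, hf.6⟩

lemma isPresection_sum {ι : Type*} (s : Finset ι) (F : ι → ℂ → ℂ)
    (h : ∀ i ∈ s, IsPresection τ D n (F i)) : IsPresection τ D n (fun z => ∑ i ∈ s, F i z) := by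
  classical
  induction s using Finset.induction_on with
  | empty => simpa using (isPresection_const (τ := τ) (D := D) 0).mono (Nat.zero_le n)
  | insert a s ha ih =>
    simp only [Finset.sum_insert ha]
    exact (h a (Finset.mem_insert_self a s)).add (ih fun i hi => h i (Finset.mem_insert_of_mem hi))

lemma IsPresection.of_tendsto_zero (hf : IsPresection τ D (n + 1) f)
    (h : Tendsto (fun p => p ^ (n + 1) * f p) (𝓝[≠] 0) (𝓝 0)) : IsPresection τ D n f := by
  refine ⟨hf.1, hf.2, hf.3, hf.4, ?_, hf.6⟩
  have := (neg_lt_meromorphicOrderAt_iff (hf.meromorphicAt 0) (n + 1)).2 (by simpa using h)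
  rw [show (-((n + 1 : ℕ) : ℤ) + 1 : ℤ) = -n by push_cast; ring] at this
  simpa using (neg_le_meromorphicOrderAt_iff (hf.meromorphicAt 0) n).1 this

/-- `h⁰(𝒪((D))) = 1`: an elliptic function cannot have a single simple pole. -/
lemma IsPresection.eq_const (hτ : τ.re = 0) (hf : IsPresection τ D 0 f) {c : ℂ}
    (hc : Tendsto f (𝓝[≠] 0) (𝓝 c)) {z : ℂ} (hz : OffPoles τ D z) : f z = c := by
  have h0 : 0 ≤ meromorphicOrderAt f 0 :=
    (tendsto_nhds_iff_meromorphicOrderAt_nonneg (hf.meromorphicAt 0)).1 ⟨c, hc⟩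
  obtain ⟨d, hd⟩ := elliptic_eq_const_of_simple_pole (coe_tau_im_pos τ) hτ hf.meromorphicAt
    hf.add_one hf.add_tau D (fun z hz => by
      by_cases hl : OffLattice τ z
      · exact (hf.analyticAt z ⟨hl, fun m n h => hz m n (by linear_combination h)⟩
          ).meromorphicOrderAt_nonneg
      · simp only [OffLattice, not_forall, not_not] at hl
        obtain ⟨m, n, rfl⟩ := hl
        rwa [← zero_add ((m : ℂ) + n * τ), meromorphicOrderAt_eq_of_periodic
          (periodic_int_mul_add_int_mul hf.add_one hf.add_tau m n)])
    (by
      have := (neg_le_meromorphicOrderAt_iff (hf.meromorphicAt D) 1).2 (by simpa using hf.tendsto_D)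
      simpa using this)
  rw [hd z (hf.analyticAt z hz).continuousAt]
  refine tendsto_nhds_unique ?_ hc
  refine tendsto_const_nhds.congr' ?_
  filter_upwards [(hf.meromorphicAt 0).eventually_analyticAt] with p hp using
    (hd p hp.continuousAt).symm

/-- Monic presections of degrees `0, 1, …, n` span the sections of degree `n`. -/
lemma IsPresection.exists_eq_sum (hτ : τ.re = 0) {B : ℕ → ℂ → ℂ}
    (hB : ∀ k, IsPresection τ D k (B k))
    (hB1 : ∀ k, Tendsto (fun p => p ^ k * B k p) (𝓝[≠] 0) (𝓝 1)) (hf : IsPresection τ D n f) :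
    ∃ c : ℕ → ℂ, ∀ z, OffPoles τ D z → f z = ∑ k ∈ Finset.range (n + 1), c k * B k z := by
  induction n generalizing f with
  | zero =>
    obtain ⟨c, hc⟩ := hf.tendsto_zero
    refine ⟨fun _ => c, fun z hz => ?_⟩
    rw [hf.eq_const hτ (by simpa using hc) hz]
    have := (hB 0).eq_const hτ (by simpa using hB1 0) hz
    simp [this]
  | succ n ih =>
    obtain ⟨c, hc⟩ := hf.tendsto_zero
    have h : IsPresection τ D n (fun z => f z - c * B (n + 1) z) := by
      refine (hf.sub ((hB (n + 1)).const_mul c)).of_tendsto_zero ?_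
      have := hc.sub ((hB1 (n + 1)).const_mul c)
      rw [mul_one, sub_self] at this
      exact this.congr fun p => by ring
    obtain ⟨d, hd⟩ := ih h
    refine ⟨fun k => if k = n + 1 then c else d k, fun z hz => ?_⟩
    simp only
    rw [Finset.sum_range_succ, if_pos rfl, Finset.sum_congr rfl fun k hk => by
      rw [if_neg (Finset.mem_range.1 hk).ne], ← hd z hz]
    ring

lemma poleDivisor_of_offPoles {z : ℂ} (hz : OffPoles τ D z) (m : ℤ) :
    poleDivisor τ D m z = 0 := by
  rw [poleDivisor, if_neg (offLattice_iff.1 hz.1), if_neg (offLattice_iff.1 hz.2), add_zero]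

lemma poleDivisor_add (m : ℤ) (a b : ℤ) (z : ℂ) :
    poleDivisor τ D m (z + (a + b * τ)) = poleDivisor τ D m z := by
  have hl : ((a : ℂ) + b * τ) ∈ (periods τ).lattice := mem_lattice_periods.2 ⟨a, b, rfl⟩
  have h1 : z + (a + b * τ) ∈ (periods τ).lattice ↔ z ∈ (periods τ).lattice :=
    add_mem_cancel_right hl
  have h2 : z + (a + b * τ) - D ∈ (periods τ).lattice ↔ z - D ∈ (periods τ).lattice := by
    rw [add_sub_right_comm]; exact add_mem_cancel_right hl
  classical
  unfold poleDivisor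
  exact congrArg₂ _ (if_congr h1 rfl rfl) (if_congr h2 rfl rfl)

lemma poleDivisor_zero (hD : D ∈ Ioo (0 : ℝ) 1) (m : ℤ) : poleDivisor τ D m 0 = m := by
  have : OffLattice τ (0 - D : ℂ) := by
    rw [zero_sub]; exact (offLattice_ofReal hD.1 hD.2).neg
  rw [poleDivisor, if_pos (zero_mem _), if_neg (offLattice_iff.1 this), add_zero]

lemma poleDivisor_D (hD : D ∈ Ioo (0 : ℝ) 1) (m : ℤ) : poleDivisor τ D m D = 1 := by
  rw [poleDivisor, if_neg (offLattice_iff.1 (offLattice_ofReal hD.1 hD.2)), sub_self,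
    if_pos (zero_mem _), zero_add]

lemma isPresection_of_mem (hD : D ∈ Ioo (0 : ℝ) 1) (hf : f ∈ sectionSpace τ D n) :
    IsPresection τ D n f := by
  obtain ⟨hNF, h1, hs, hord⟩ := hf
  have hm : ∀ z, MeromorphicAt f z := fun z => (hNF (mem_univ z)).meromorphicAt
  refine ⟨hm, h1, hs, fun z hz => ?_, ?_, ?_⟩
  · rw [← (hNF (mem_univ z)).meromorphicOrderAt_nonneg_iff_analyticAt]
    have := hord z
    rw [poleDivisor_of_offPoles hz] at this
    simpa using this
  · have := hord 0
    rw [poleDivisor_zero hD] at this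
    simpa using (neg_le_meromorphicOrderAt_iff (hm 0) n).1 this
  · have := hord D
    rw [poleDivisor_D hD] at this
    simpa using (neg_le_meromorphicOrderAt_iff (hm D) 1).1 (by simpa using this)

lemma tendsto_zero_of_mem_pred (hD : D ∈ Ioo (0 : ℝ) 1)
    (hf : f ∈ sectionSpace τ D ((n : ℤ) - 1)) :
    Tendsto (fun p => p ^ n * f p) (𝓝[≠] 0) (𝓝 0) := by
  obtain ⟨hNF, h1, hs, hord⟩ := hf
  have := hord 0
  rw [poleDivisor_zero hD, neg_sub, ← neg_add_eq_sub] at this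
  simpa using (neg_lt_meromorphicOrderAt_iff (hNF (mem_univ 0)).meromorphicAt n).1 this

lemma IsPresection.toMeromorphicNFOn_mem (hD : D ∈ Ioo (0 : ℝ) 1) (hf : IsPresection τ D n f) :
    toMeromorphicNFOn f univ ∈ sectionSpace τ D n := by
  have hm : MeromorphicOn f univ := fun z _ => hf.meromorphicAt z
  refine ⟨meromorphicNFOn_toMeromorphicNFOn f univ,
    periodic_toMeromorphicNFOn hf.meromorphicAt hf.add_one,
    periodic_toMeromorphicNFOn hf.meromorphicAt hf.add_tau, fun z => ?_⟩
  rw [meromorphicOrderAt_toMeromorphicNFOn hm (mem_univ z)]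
  have hper := fun a b : ℤ => meromorphicOrderAt_eq_of_periodic
    (periodic_int_mul_add_int_mul hf.add_one hf.add_tau a b)
  by_cases h1 : OffLattice τ z
  · by_cases h2 : OffLattice τ (z - D)
    · rw [poleDivisor_of_offPoles ⟨h1, h2⟩]
      simpa using (hf.analyticAt z ⟨h1, h2⟩).meromorphicOrderAt_nonneg
    · simp only [OffLattice, not_forall, not_not] at h2
      obtain ⟨a, b, h⟩ := h2
      rw [show z = D + (a + b * τ) by linear_combination h, hper, poleDivisor_add, poleDivisor_D hD]
      have := (neg_le_meromorphicOrderAt_iff (hf.meromorphicAt D) 1).2 (by simpa using hf.tendsto_D)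
      simpa using this
  · simp only [OffLattice, not_forall, not_not] at h1
    obtain ⟨a, b, h⟩ := h1
    rw [show z = 0 + (a + b * τ) by linear_combination h, hper, poleDivisor_add,
      poleDivisor_zero hD]
    exact (neg_le_meromorphicOrderAt_iff (hf.meromorphicAt 0) n).2 (by simpa using hf.tendsto_zero)

lemma toMeromorphicNFOn_eq_of_analyticAt (hf : ∀ z, MeromorphicAt f z) {z : ℂ}
    (hz : AnalyticAt ℂ f z) : toMeromorphicNFOn f univ z = f z := by
  have hm : MeromorphicOn f univ := fun z _ => hf z
  rw [toMeromorphicNFOn_eq_toMeromorphicNFAt hm (mem_univ z),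
    toMeromorphicNFAt_eq_self.2 hz.meromorphicNFAt]

/-- For a meromorphic function, the error in a limit at `0` is `O(p)`. -/
lemma isBigO_sub_one_iff (hf : MeromorphicAt f 0) :
    (fun p : ℂ => p ^ n * f p - 1) =O[𝓝[≠] 0] (fun p : ℂ => p) ↔
      Tendsto (fun p => p ^ n * f p) (𝓝[≠] 0) (𝓝 1) := by
  constructor
  · intro h
    have h0 : Tendsto (fun p : ℂ => p) (𝓝[≠] 0) (𝓝 0) := by
      simpa using tendsto_pow_nhdsNE_zero one_ne_zero
    have := (h.trans_tendsto h0).add_const 1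
    simpa using this
  · intro h
    have hm : MeromorphicAt (fun p : ℂ => p⁻¹ * (p ^ n * f p - 1)) 0 := by fun_prop
    have hm' : MeromorphicAt (fun p : ℂ => p ^ n * f p - 1) 0 := by fun_prop
    have h1 : 0 < meromorphicOrderAt (fun p : ℂ => p ^ n * f p - 1) 0 := by
      rw [← tendsto_zero_iff_meromorphicOrderAt_pos hm']
      simpa using h.sub_const 1
    have h2 : 0 ≤ meromorphicOrderAt (fun p : ℂ => p⁻¹ * (p ^ n * f p - 1)) 0 := by
      have e : meromorphicOrderAt (fun p : ℂ => p⁻¹ * (p ^ n * f p - 1)) 0 =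
          meromorphicOrderAt (fun p : ℂ => p⁻¹) 0 +
            meromorphicOrderAt (fun p : ℂ => p ^ n * f p - 1) 0 :=
        meromorphicOrderAt_mul (by fun_prop) hm'
      have e2 : meromorphicOrderAt (fun p : ℂ => p⁻¹) 0 = -1 := by
        have := meromorphicOrderAt_inv (f := (id : ℂ → ℂ)) (x := 0)
        rw [meromorphicOrderAt_id] at this
        exact this
      rw [e, e2]
      cases hh : meromorphicOrderAt (fun p : ℂ => p ^ n * f p - 1) 0 with
      | top => simp
      | coe m =>
        rw [hh] at h1
        have : 0 < m := by exact_mod_cast h1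
        have h3 : ((0 : ℤ) : WithTop ℤ) ≤ ((-1 + m : ℤ) : WithTop ℤ) :=
          WithTop.coe_le_coe.2 (by omega)
        exact h3
    obtain ⟨c, hc⟩ := (tendsto_nhds_iff_meromorphicOrderAt_nonneg hm).2 h2
    have := (hc.isBigO_one ℂ).mul (isBigO_refl (fun p : ℂ => p) (𝓝[≠] 0))
    simp only [one_mul] at this
    refine this.congr' ?_ EventuallyEq.rfl
    filter_upwards [self_mem_nhdsWithin] with p hp
    have : p ≠ 0 := hp
    field_simp

end Sections

/-! ### Theta quotients with prescribed poles -/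

section Basis

variable {τ : UpperHalfPlane} {D : ℝ} {k : ℕ}

/-- The quotient `θ₁(p - D/2k)ᵏ θ₁(p - D/2) / (θ₁(p)ᵏ θ₁(p - D))` is elliptic, because its zeros and
its poles have the same sum `D`. -/
noncomputable def sectionQuotient (τ : UpperHalfPlane) (D : ℝ) (k : ℕ) (p : ℂ) : ℂ :=
  theta1 (p - (D / (2 * k) : ℝ)) τ ^ k * theta1 (p - (D / 2 : ℝ)) τ /
    (theta1 p τ ^ k * theta1 (p - D) τ)

/-- The leading coefficient at `0` of `sectionQuotient`. -/
noncomputable def sectionLead (τ : UpperHalfPlane) (D : ℝ) (k : ℕ) : ℂ :=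
  theta1 (-(D / (2 * k) : ℝ)) τ ^ k * theta1 (-(D / 2 : ℝ)) τ /
    (theta1DerivZero τ ^ k * theta1 (-D) τ)

/-- A real monic section with a pole of order exactly `k` at `0`. -/
noncomputable def sectionBasis (τ : UpperHalfPlane) (D : ℝ) (k : ℕ) (p : ℂ) : ℂ :=
  if k = 0 then 1 else (sectionLead τ D k)⁻¹ * sectionQuotient τ D k p

lemma sectionLead_ne_zero (hτ : τ.re = 0) (hD : D ∈ Ioo (0 : ℝ) 1) (hk : k ≠ 0) :
    sectionLead τ D k ≠ 0 := by
  have h1 := (offLattice_div (τ := τ) hD hk).1.neg.theta1_ne_zero hτ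
  have h2 := (offLattice_div (τ := τ) hD one_ne_zero).1.neg.theta1_ne_zero hτ
  rw [Nat.cast_one, mul_one] at h2
  exact div_ne_zero (mul_ne_zero (pow_ne_zero _ h1) h2) (mul_ne_zero (pow_ne_zero _
    (theta1DerivZero_ne_zero (coe_tau_im_pos τ) hτ))
    ((offLattice_ofReal hD.1 hD.2).neg.theta1_ne_zero hτ))

lemma theta1_add_tau_sub (p : ℂ) (a : ℝ) : theta1 (p + τ - a) τ =
    -Complex.exp (-(π * Complex.I * (τ + 2 * p))) * Complex.exp (2 * π * Complex.I * a) *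
      theta1 (p - a) τ := by
  rw [add_sub_right_comm, theta1_add_self]
  congr 1
  rw [neg_mul, ← Complex.exp_add]
  congr 2
  ring

lemma sectionQuotient_add_tau (hk : k ≠ 0) (p : ℂ) :
    sectionQuotient τ D k (p + τ) = sectionQuotient τ D k p := by
  have hk' : (k : ℂ) ≠ 0 := by exact_mod_cast hk
  have e0 : theta1 (p + τ) τ = -Complex.exp (-(π * Complex.I * (τ + 2 * p))) * theta1 p τ :=
    theta1_add_self _ _
  have hA : Complex.exp (2 * π * Complex.I * (D / (2 * k) : ℝ)) ^ k *
      Complex.exp (2 * π * Complex.I * (D / 2 : ℝ)) = Complex.exp (2 * π * Complex.I * D) := by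
    rw [← Complex.exp_nat_mul, ← Complex.exp_add]
    congr 1
    push_cast
    field_simp
    ring
  rw [sectionQuotient, sectionQuotient, theta1_add_tau_sub, theta1_add_tau_sub,
    theta1_add_tau_sub, e0, ← hA]
  have h1 : -Complex.exp (-(π * Complex.I * (τ + 2 * p))) ≠ 0 :=
    neg_ne_zero.2 (Complex.exp_ne_zero _)
  have h2 := Complex.exp_ne_zero (2 * π * Complex.I * (D / (2 * k) : ℝ))
  have h3 := Complex.exp_ne_zero (2 * π * Complex.I * (D / 2 : ℝ))
  generalize -Complex.exp (-(π * Complex.I * (τ + 2 * p))) = e at h1 ⊢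
  generalize Complex.exp (2 * π * Complex.I * (D / (2 * k) : ℝ)) = A at h2 ⊢
  generalize Complex.exp (2 * π * Complex.I * (D / 2 : ℝ)) = B at h3 ⊢
  generalize theta1 (p - (D / (2 * k) : ℝ)) τ = X
  generalize theta1 (p - (D / 2 : ℝ)) τ = Y
  have hc : e ^ k * A ^ k * e * B ≠ 0 := by positivity
  rw [show (e * A * X) ^ k * (e * B * Y) = (e ^ k * A ^ k * e * B) * (X ^ k * Y) by ring,
    show (e * theta1 p τ) ^ k * (e * (A ^ k * B) * theta1 (p - D) τ) =
      (e ^ k * A ^ k * e * B) * (theta1 p τ ^ k * theta1 (p - D) τ) by ring,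
    mul_div_mul_left _ _ hc]

lemma sectionQuotient_add_one (p : ℂ) :
    sectionQuotient τ D k (p + 1) = sectionQuotient τ D k p := by
  simp only [sectionQuotient, add_sub_right_comm, theta1_add_one, neg_pow (theta1 _ _) k]
  have : ((-1 : ℂ) ^ k) ≠ 0 := pow_ne_zero _ (by norm_num)
  rw [show ∀ a b c : ℂ, a * b * -c = (-a) * (b * c) by intros; ring,
    show ∀ a b c : ℂ, a * b * -c = (-a) * (b * c) by intros; ring,
    mul_div_mul_left _ _ (neg_ne_zero.2 this)]

lemma analyticAt_theta1_sub (a : ℂ) (z : ℂ) : AnalyticAt ℂ (fun p => theta1 (p - a) τ) z :=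
  AnalyticAt.comp (g := fun p => theta1 p τ) (f := fun p : ℂ => p - a)
    ((differentiable_theta1 (coe_tau_im_pos τ)).analyticAt _) (by fun_prop)

lemma analyticAt_theta1 (z : ℂ) : AnalyticAt ℂ (fun p => theta1 p τ) z :=
  (differentiable_theta1 (coe_tau_im_pos τ)).analyticAt _

lemma tendsto_sectionQuotient (hτ : τ.re = 0) (hD : D ∈ Ioo (0 : ℝ) 1) :
    Tendsto (fun p => p ^ k * sectionQuotient τ D k p) (𝓝[≠] 0) (𝓝 (sectionLead τ D k)) := by
  have hc : ∀ a : ℂ, Tendsto (fun p => theta1 (p - a) τ) (𝓝[≠] 0) (𝓝 (theta1 (-a) τ)) := by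
    intro a
    have := (analyticAt_theta1_sub (τ := τ) a 0).continuousAt.tendsto
    rw [zero_sub] at this
    exact this.mono_left nhdsWithin_le_nhds
  have h := (((hc (D / (2 * k) : ℝ)).pow k).mul (hc (D / 2 : ℝ))).div
    (((tendsto_theta1_div (coe_tau_im_pos τ)).pow k).mul (hc D))
    (mul_ne_zero (pow_ne_zero _ (theta1DerivZero_ne_zero (coe_tau_im_pos τ) hτ))
      ((offLattice_ofReal hD.1 hD.2).neg.theta1_ne_zero hτ))
  refine h.congr' ?_
  filter_upwards [self_mem_nhdsWithin] with p hp
  have hp' : p ≠ 0 := hp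
  simp only [Pi.div_apply, sectionQuotient, div_pow]
  rw [div_mul_eq_mul_div, div_div_eq_mul_div]
  ring

lemma tendsto_sub_D_mul_sectionQuotient (hτ : τ.re = 0) (hD : D ∈ Ioo (0 : ℝ) 1) (hk : k ≠ 0) :
    ∃ c, c ≠ 0 ∧ Tendsto (fun p => (p - D) * sectionQuotient τ D k p) (𝓝[≠] (D : ℂ)) (𝓝 c) := by
  have hc : ∀ a : ℂ, Tendsto (fun p => theta1 (p - a) τ) (𝓝[≠] (D : ℂ)) (𝓝 (theta1 (D - a) τ)) :=
    fun a => (analyticAt_theta1_sub (τ := τ) a D).continuousAt.tendsto.mono_left nhdsWithin_le_nhds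
  have h0 : Tendsto (fun p => theta1 p τ) (𝓝[≠] (D : ℂ)) (𝓝 (theta1 D τ)) :=
    (analyticAt_theta1 (τ := τ) D).continuousAt.tendsto.mono_left nhdsWithin_le_nhds
  have ht : Tendsto (fun z : ℂ => z - D) (𝓝[≠] (D : ℂ)) (𝓝[≠] 0) := by
    refine tendsto_nhdsWithin_iff.2 ⟨?_, ?_⟩
    · have : Tendsto (fun z : ℂ => z - D) (𝓝 (D : ℂ)) (𝓝 ((D : ℂ) - D)) :=
        Continuous.tendsto (by fun_prop) _
      rw [sub_self] at this
      exact this.mono_left nhdsWithin_le_nhds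
    · filter_upwards [self_mem_nhdsWithin] with z hz
      exact sub_ne_zero.2 hz
  have hd := theta1DerivZero_ne_zero (coe_tau_im_pos τ) hτ
  have hq := (tendsto_theta1_div (coe_tau_im_pos τ)).comp ht
  have hD0 := (offLattice_ofReal (τ := τ) hD.1 hD.2).theta1_ne_zero hτ
  have h := (((hc (D / (2 * k) : ℝ)).pow k).mul (hc (D / 2 : ℝ))).div
    ((h0.pow k).mul hq) (mul_ne_zero (pow_ne_zero _ hD0) hd)
  refine ⟨_, ?_, h.congr' ?_⟩
  · have h1 := (offLattice_div (τ := τ) hD hk).2.theta1_ne_zero hτ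
    have h2 := (offLattice_div (τ := τ) hD one_ne_zero).2.theta1_ne_zero hτ
    rw [Nat.cast_one, mul_one] at h2
    rw [Complex.ofReal_sub] at h1 h2
    exact div_ne_zero (mul_ne_zero (pow_ne_zero _ h1) h2) (mul_ne_zero (pow_ne_zero _ hD0) hd)
  · filter_upwards [self_mem_nhdsWithin] with p hp
    have hp' : p - D ≠ 0 := sub_ne_zero.2 hp
    simp only [Pi.div_apply, sectionQuotient, Function.comp]
    rw [mul_div_assoc', div_div_eq_mul_div]
    ring

lemma isPresection_sectionBasis (hτ : τ.re = 0) (hD : D ∈ Ioo (0 : ℝ) 1) (k : ℕ) :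
    IsPresection τ D k (sectionBasis τ D k) := by
  rcases eq_or_ne k 0 with rfl | hk
  · have : sectionBasis τ D 0 = fun _ => 1 := by ext; simp [sectionBasis]
    rw [this]
    exact isPresection_const 1
  have e : sectionBasis τ D k = fun p => (sectionLead τ D k)⁻¹ * sectionQuotient τ D k p := by
    ext; simp [sectionBasis, hk]
  rw [e]
  refine IsPresection.const_mul ?_ _
  have hnum : ∀ z, AnalyticAt ℂ (fun p => theta1 (p - (D / (2 * k) : ℝ)) τ ^ k *
      theta1 (p - (D / 2 : ℝ)) τ) z := fun z =>
    ((analyticAt_theta1_sub _ z).pow k).mul (analyticAt_theta1_sub _ z)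
  have hden : ∀ z, AnalyticAt ℂ (fun p => theta1 p τ ^ k * theta1 (p - D) τ) z := fun z =>
    ((analyticAt_theta1 z).pow k).mul (analyticAt_theta1_sub _ z)
  exact ⟨fun z => (hnum z).meromorphicAt.div (hden z).meromorphicAt,
    sectionQuotient_add_one, sectionQuotient_add_tau hk,
    fun z hz => (hnum z).div (hden z) (mul_ne_zero (pow_ne_zero _ (hz.1.theta1_ne_zero hτ))
      (hz.2.theta1_ne_zero hτ)),
    ⟨_, tendsto_sectionQuotient hτ hD⟩,
    (tendsto_sub_D_mul_sectionQuotient hτ hD hk).imp fun _ h => h.2⟩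

lemma tendsto_sectionBasis (hτ : τ.re = 0) (hD : D ∈ Ioo (0 : ℝ) 1) (k : ℕ) :
    Tendsto (fun p => p ^ k * sectionBasis τ D k p) (𝓝[≠] 0) (𝓝 1) := by
  rcases eq_or_ne k 0 with rfl | hk
  · simp [sectionBasis]
  have h := (tendsto_sectionQuotient (k := k) hτ hD).const_mul (sectionLead τ D k)⁻¹
  rw [inv_mul_cancel₀ (sectionLead_ne_zero hτ hD hk)] at h
  refine h.congr fun p => ?_
  simp only [sectionBasis, if_neg hk]
  ring

lemma sectionBasis_conj (hτ : τ.re = 0) (k : ℕ) (p : ℂ) :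
    (starRingEnd ℂ) (sectionBasis τ D k p) = sectionBasis τ D k ((starRingEnd ℂ) p) := by
  have hτ' : (τ : ℂ).re = 0 := hτ
  simp only [sectionBasis, sectionQuotient, sectionLead]
  split_ifs
  · exact map_one _
  · simp only [map_mul, map_inv₀, map_div₀, map_pow, theta1_conj hτ',
      theta1DerivZero_conj (coe_tau_im_pos τ) hτ', map_sub, map_neg, Complex.conj_ofReal]

/-- The principal parts of `F` at `0` and `D` are matched by a section, up to a simple pole
at `0`: there is no section with only a simple pole at `0`. For `n = 1` the leading coefficient at
`0` is not prescribed, because the pole at `D` determines the section up to constants. -/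
lemma exists_presection_sub (hτ : τ.re = 0) (hD : D ∈ Ioo (0 : ℝ) 1) {n : ℕ} {F : ℂ → ℂ}
    {c : ℂ} (hn : n ≠ 0) (hF0 : Tendsto (fun p => p ^ n * F p) (𝓝[≠] 0) (𝓝 c))
    (hm0 : MeromorphicAt F 0) (hmD : MeromorphicAt F D)
    (hFD : ∃ c, Tendsto (fun p => (p - D) * F p) (𝓝[≠] (D : ℂ)) (𝓝 c)) :
    ∃ Q : ℂ → ℂ, IsPresection τ D n Q ∧
      (2 ≤ n → Tendsto (fun p => p ^ n * Q p) (𝓝[≠] 0) (𝓝 c)) ∧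
      (∃ ρ, Tendsto (fun p => p * (F p - Q p)) (𝓝[≠] 0) (𝓝 ρ)) ∧
      Tendsto (fun p => (p - D) * (F p - Q p)) (𝓝[≠] (D : ℂ)) (𝓝 0) := by
  obtain ⟨n, rfl⟩ : ∃ m, n = m + 1 := Nat.exists_eq_add_one_of_ne_zero hn
  clear hn
  induction n generalizing F c with
  | zero =>
    obtain ⟨d, hd⟩ := hFD
    have hb := isPresection_sectionBasis hτ hD 1
    obtain ⟨e, he0, he⟩ := tendsto_sub_D_mul_sectionQuotient hτ hD one_ne_zero
    obtain ⟨e', he0', he'⟩ : ∃ c, c ≠ 0 ∧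
        Tendsto (fun p => (p - D) * sectionBasis τ D 1 p) (𝓝[≠] (D : ℂ)) (𝓝 c) := by
      refine ⟨_, mul_ne_zero (inv_ne_zero (sectionLead_ne_zero hτ hD one_ne_zero)) he0,
        (he.const_mul _).congr fun p => ?_⟩
      simp only [sectionBasis, one_ne_zero, if_false]
      ring
    refine ⟨fun p => d / e' * sectionBasis τ D 1 p, hb.const_mul _, by omega,
      ⟨c - d / e' * 1, ?_⟩, ?_⟩
    · refine (hF0.sub ((tendsto_sectionBasis hτ hD 1).const_mul (d / e'))).congr fun p => ?_
      simp only [zero_add, pow_one]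
      ring
    · have := hd.sub (he'.const_mul (d / e'))
      rw [div_mul_cancel₀ _ he0', sub_self] at this
      exact this.congr fun p => by ring
  | succ n ih =>
    have hb := isPresection_sectionBasis hτ hD (n + 2)
    set F' : ℂ → ℂ := fun p => F p - c * sectionBasis τ D (n + 2) p with hF'
    have hm0' : MeromorphicAt F' 0 :=
      hm0.sub ((MeromorphicAt.const c _).mul (hb.meromorphicAt 0))
    have hmD' : MeromorphicAt F' D :=
      hmD.sub ((MeromorphicAt.const c _).mul (hb.meromorphicAt D))
    have hlead : Tendsto (fun p => p ^ (n + 2) * F' p) (𝓝[≠] 0) (𝓝 0) := by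
      have := hF0.sub ((tendsto_sectionBasis hτ hD (n + 2)).const_mul c)
      rw [mul_one, sub_self] at this
      exact this.congr fun p => by simp only [hF']; ring
    have h1 := (neg_lt_meromorphicOrderAt_iff hm0' (n + 2)).2 (by simpa using hlead)
    rw [show (-((n + 2 : ℕ) : ℤ) + 1 : ℤ) = -((n + 1 : ℕ) : ℤ) by push_cast; ring] at h1
    obtain ⟨c', hc'⟩ := (neg_le_meromorphicOrderAt_iff hm0' (n + 1)).1 h1
    obtain ⟨d, hd⟩ := hFD
    obtain ⟨e, he⟩ := hb.tendsto_D
    obtain ⟨Q, hQ, -, hQ0, hQD⟩ := ih (F := F') (c := c') hm0' hmD'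
      ⟨d - c * e, (hd.sub (he.const_mul c)).congr fun p => by simp only [hF']; ring⟩
      (by simpa using hc')
    refine ⟨fun p => c * sectionBasis τ D (n + 2) p + Q p,
      (hb.const_mul c).add (hQ.mono (Nat.le_succ _)), fun _ => ?_, ?_, ?_⟩
    · have := ((tendsto_sectionBasis hτ hD (n + 2)).const_mul c).add
        (hQ.tendsto_of_lt (show n + 1 < n + 1 + 1 by omega))
      rw [mul_one, add_zero] at this
      exact this.congr fun p => by ring
    · exact hQ0.imp fun ρ h => h.congr fun p => by simp only [hF']; ring
    · exact hQD.congr fun p => by simp only [hF']; ring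

end Basis

/-! ### Orthogonal sections -/

section Pairing

variable {τ : UpperHalfPlane} {D : ℝ} {w f g h : ℂ → ℂ}

/-- Continuity along the line that covers `γ`. -/
def GammaContinuous (τ : UpperHalfPlane) (f : ℂ → ℂ) : Prop :=
  Continuous fun s : ℝ => f (τ / 2 + s)

lemma gammaContinuous_of_continuousAt (hf : ∀ z : ℂ, z.im = τ.im / 2 → ContinuousAt f z) :
    GammaContinuous τ f := by
  rw [GammaContinuous, continuous_iff_continuousAt]
  intro s
  exact ContinuousAt.comp (g := f) (f := fun s : ℝ => (τ : ℂ) / 2 + s)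
    (hf _ (by simp)) (by fun_prop)

lemma offPoles_of_im_eq {z : ℂ} (hz : z.im = τ.im / 2) : OffPoles τ D z := by
  have := τ.im_pos
  refine offPoles_of_im (by rw [hz]; positivity) ?_
  rw [hz, abs_of_pos (by positivity)]
  linarith

lemma offPoles_tau_div_two_add (s : ℝ) : OffPoles τ D (τ / 2 + s) :=
  offPoles_of_im_eq (by simp)

lemma IsPresection.gammaContinuous {n : ℕ} (hf : IsPresection τ D n f) : GammaContinuous τ f :=
  gammaContinuous_of_continuousAt fun z hz => (hf.analyticAt z (offPoles_of_im_eq hz)).continuousAt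

lemma pairing_comm (f g : ℂ → ℂ) : pairing τ w f g = pairing τ w g f := by
  simp only [pairing, mul_comm (f _)]

lemma pairing_congr_left (h : ∀ s : ℝ, f (τ / 2 + s) = g (τ / 2 + s)) (k : ℂ → ℂ) :
    pairing τ w f k = pairing τ w g k := by
  simp only [pairing, h]

lemma pairing_const_mul_left (a : ℂ) (f g : ℂ → ℂ) :
    pairing τ w (fun z => a * f z) g = a * pairing τ w f g := by
  simp only [pairing, mul_assoc, intervalIntegral.integral_const_mul]

lemma GammaContinuous.intervalIntegrable (hw : GammaContinuous τ w) (hf : GammaContinuous τ f)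
    (hg : GammaContinuous τ g) : IntervalIntegrable
    (fun s : ℝ => f (τ / 2 + s) * g (τ / 2 + s) * Complex.exp (w (τ / 2 + s)))
    MeasureTheory.volume 0 1 :=
  ((Continuous.mul hf hg).mul (Complex.continuous_exp.comp hw)).intervalIntegrable 0 1

lemma pairing_sub_left (hw : GammaContinuous τ w) (hf : GammaContinuous τ f)
    (hg : GammaContinuous τ g) (hh : GammaContinuous τ h) :
    pairing τ w (fun z => f z - g z) h = pairing τ w f h - pairing τ w g h := by
  simp only [pairing, sub_mul]
  exact intervalIntegral.integral_sub (hw.intervalIntegrable hf hh) (hw.intervalIntegrable hg hh)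

lemma pairing_sum_left {ι : Type*} (s : Finset ι) {F : ι → ℂ → ℂ} (hw : GammaContinuous τ w)
    (hF : ∀ i ∈ s, GammaContinuous τ (F i)) (hh : GammaContinuous τ h) :
    pairing τ w (fun z => ∑ i ∈ s, F i z) h = ∑ i ∈ s, pairing τ w (F i) h := by
  simp only [pairing, Finset.sum_mul]
  exact intervalIntegral.integral_finsetSum fun i hi => hw.intervalIntegrable (hF i hi) hh

/-- Orthogonality to the monic sections of smaller degree is orthogonality to all of them. -/
lemma pairing_eq_zero_of_lt (hτ : τ.re = 0) (hw : GammaContinuous τ w) {B : ℕ → ℂ → ℂ}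
    (hB : ∀ k, IsPresection τ D k (B k))
    (hB1 : ∀ k, Tendsto (fun p => p ^ k * B k p) (𝓝[≠] 0) (𝓝 1)) {n m : ℕ} (hmn : m < n)
    (horth : ∀ k < n, pairing τ w (B k) (B n) = 0) (hf : IsPresection τ D m f) :
    pairing τ w f (B n) = 0 := by
  obtain ⟨c, hc⟩ := hf.exists_eq_sum hτ hB hB1
  rw [pairing_congr_left (g := fun z => ∑ k ∈ Finset.range (m + 1), c k * B k z)
    (fun s => hc _ (offPoles_tau_div_two_add s)),
    pairing_sum_left _ hw (fun k _ => ((hB k).const_mul (c k)).gammaContinuous)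
      (hB n).gammaContinuous]
  refine Finset.sum_eq_zero fun k hk => ?_
  rw [pairing_const_mul_left, horth k (by have := Finset.mem_range.1 hk; omega), mul_zero]

/-- All monic sections of degree `n` have the same pairing with the monic orthogonal one. -/
lemma pairing_eq_of_monic (hτ : τ.re = 0) (hw : GammaContinuous τ w) {B : ℕ → ℂ → ℂ}
    (hB : ∀ k, IsPresection τ D k (B k))
    (hB1 : ∀ k, Tendsto (fun p => p ^ k * B k p) (𝓝[≠] 0) (𝓝 1)) {n : ℕ}
    (horth : ∀ k < n, pairing τ w (B k) (B n) = 0) (hf : IsPresection τ D n f)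
    (hf1 : Tendsto (fun p => p ^ n * f p) (𝓝[≠] 0) (𝓝 1)) :
    pairing τ w f (B n) = pairing τ w (B n) (B n) := by
  have hd := hf.sub (hB n)
  have hd0 : Tendsto (fun p => p ^ n * (f p - B n p)) (𝓝[≠] 0) (𝓝 0) := by
    have := hf1.sub (hB1 n)
    rw [sub_self] at this
    exact this.congr fun p => by ring
  rw [← sub_eq_zero, ← pairing_sub_left hw hf.gammaContinuous (hB n).gammaContinuous
    (hB n).gammaContinuous]
  cases n with
  | zero =>
    rw [pairing_congr_left (g := fun _ => 0) (fun s => hd.eq_const hτ (by simpa using hd0)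
      (offPoles_tau_div_two_add s))]
    simp [pairing]
  | succ n =>
    exact pairing_eq_zero_of_lt hτ hw hB hB1 (Nat.lt_succ_self n) horth (hd.of_tendsto_zero hd0)

/-- A function of real type: `conj (f p) = f (conj p)`. -/
def IsRealType (f : ℂ → ℂ) : Prop := ∀ p, (starRingEnd ℂ) (f p) = f ((starRingEnd ℂ) p)

lemma IsPresection.conj_eq (hτ : τ.re = 0) {n : ℕ} (hf : IsPresection τ D n f)
    (hr : IsRealType f) (s : ℝ) :
    (starRingEnd ℂ) (f (τ / 2 + s)) = f (τ / 2 + s) := by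
  rw [hr, ← hf.add_tau]
  congr 1
  rw [coe_tau_eq hτ]
  simp only [map_add, map_div₀, map_mul, Complex.conj_ofReal, Complex.conj_I, map_ofNat]
  ring

/-- The squared norm of a section, as a real integral. -/
noncomputable def gammaNormSq (τ : UpperHalfPlane) (w f : ℂ → ℂ) : ℝ :=
  ∫ s in (0 : ℝ)..1, ‖f (τ / 2 + s)‖ ^ 2 * Real.exp (w (τ / 2 + s)).re

lemma exp_weight (hwreal : ∀ s : ℝ, (w (τ / 2 + s)).im = 0) (s : ℝ) :
    Complex.exp (w (τ / 2 + s)) = (Real.exp (w (τ / 2 + s)).re : ℂ) := by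
  have : w (τ / 2 + s) = ((w (τ / 2 + s)).re : ℂ) := by
    apply Complex.ext <;> simp [hwreal s]
  rw [this, Complex.ofReal_re, Complex.ofReal_exp]

lemma pairing_self (hτ : τ.re = 0) (hwreal : ∀ s : ℝ, (w (τ / 2 + s)).im = 0) {n : ℕ}
    (hf : IsPresection τ D n f) (hr : IsRealType f) :
    pairing τ w f f = (gammaNormSq τ w f : ℂ) := by
  rw [pairing, gammaNormSq, ← intervalIntegral.integral_ofReal]
  refine intervalIntegral.integral_congr fun s _ => ?_
  rw [exp_weight hwreal]
  push_cast
  congr 1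
  rw [← Complex.mul_conj', hf.conj_eq hτ hr]

lemma continuous_gammaNormSq_integrand (hw : GammaContinuous τ w) (hf : GammaContinuous τ f) :
    Continuous fun s : ℝ => ‖f (τ / 2 + s)‖ ^ 2 * Real.exp (w (τ / 2 + s)).re :=
  ((Continuous.norm hf).pow 2).mul (Real.continuous_exp.comp (Complex.continuous_re.comp hw))

lemma gammaNormSq_pos (hw : GammaContinuous τ w) {n : ℕ} (hf : IsPresection τ D n f)
    (hf1 : Tendsto (fun p => p ^ n * f p) (𝓝[≠] 0) (𝓝 1)) : 0 < gammaNormSq τ w f := by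
  refine intervalIntegral.integral_pos one_pos
    (continuous_gammaNormSq_integrand hw hf.gammaContinuous).continuousOn
    (fun s _ => by positivity) ?_
  by_contra! hcon
  have hzero : ∀ s ∈ Icc (0 : ℝ) 1, f (τ / 2 + s) = 0 := by
    intro s hs
    by_contra h0
    have : 0 < ‖f (τ / 2 + s)‖ := norm_pos_iff.2 h0
    have h2 := hcon s hs
    have : 0 < ‖f (τ / 2 + s)‖ ^ 2 * Real.exp (w (τ / 2 + s)).re := by positivity
    linarith
  have htop : meromorphicOrderAt f 0 ≠ ⊤ := by
    intro h
    have h0 := meromorphicOrderAt_eq_top_iff.1 h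
    have : Tendsto (fun p => p ^ n * f p) (𝓝[≠] 0) (𝓝 0) := by
      refine tendsto_const_nhds.congr' ?_
      filter_upwards [h0] with p hp
      rw [hp, mul_zero]
    exact zero_ne_one (tendsto_nhds_unique this hf1)
  have hne := MeromorphicOn.meromorphicOrderAt_ne_top_of_isPreconnected
    (fun z _ => hf.meromorphicAt z) isPreconnected_univ (mem_univ 0)
    (mem_univ ((τ : ℂ) / 2 + (1 / 2 : ℝ))) htop
  rw [meromorphicOrderAt_ne_top_iff_eventually_ne_zero (hf.meromorphicAt _)] at hne
  have ht : Tendsto (fun s : ℝ => (τ : ℂ) / 2 + s) (𝓝[≠] (1 / 2 : ℝ))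
      (𝓝[≠] ((τ : ℂ) / 2 + (1 / 2 : ℝ))) := by
    refine tendsto_nhdsWithin_iff.2 ⟨?_, ?_⟩
    · have : Continuous fun s : ℝ => (τ : ℂ) / 2 + s := by fun_prop
      exact (this.tendsto _).mono_left nhdsWithin_le_nhds
    · filter_upwards [self_mem_nhdsWithin] with s hs h
      exact hs (Complex.ofReal_injective (add_left_cancel h))
  have hI : ∀ᶠ s : ℝ in 𝓝[≠] (1 / 2 : ℝ), s ∈ Icc (0 : ℝ) 1 :=
    nhdsWithin_le_nhds (Icc_mem_nhds (by norm_num) (by norm_num))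
  obtain ⟨s, h1, h2⟩ := ((ht.eventually hne).and hI).exists
  exact h1 (hzero s h2)

end Pairing

/-! ### The Gram–Schmidt process -/

section Ortho

variable {τ : UpperHalfPlane} {D : ℝ} {w : ℂ → ℂ}

/-- The Gram–Schmidt process applied to `sectionBasis`. -/
noncomputable def orthoSection (τ : UpperHalfPlane) (D : ℝ) (w : ℂ → ℂ) (n : ℕ) : ℂ → ℂ := fun p =>
  sectionBasis τ D n p - ∑ m : Fin n,
    pairing τ w (sectionBasis τ D n) (orthoSection τ D w m) /
      pairing τ w (orthoSection τ D w m) (orthoSection τ D w m) * orthoSection τ D w m p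
termination_by n
decreasing_by all_goals exact m.2

lemma orthoSection_eq (n : ℕ) : orthoSection τ D w n = fun p =>
    sectionBasis τ D n p - ∑ m ∈ Finset.range n,
      pairing τ w (sectionBasis τ D n) (orthoSection τ D w m) /
        pairing τ w (orthoSection τ D w m) (orthoSection τ D w m) * orthoSection τ D w m p := by
  ext p
  rw [orthoSection, Finset.sum_range fun m : ℕ =>
    pairing τ w (sectionBasis τ D n) (orthoSection τ D w m) /
        pairing τ w (orthoSection τ D w m) (orthoSection τ D w m) * orthoSection τ D w m p]

lemma pairing_conj (hτ : τ.re = 0) (hwreal : ∀ s : ℝ, (w (τ / 2 + s)).im = 0) {n m : ℕ}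
    {f g : ℂ → ℂ} (hf : IsPresection τ D n f) (hfr : IsRealType f) (hg : IsPresection τ D m g)
    (hgr : IsRealType g) : (starRingEnd ℂ) (pairing τ w f g) = pairing τ w f g := by
  rw [pairing, ← intervalIntegral.intervalIntegral_conj]
  refine intervalIntegral.integral_congr fun s _ => ?_
  simp only [map_mul, hf.conj_eq hτ hfr, hg.conj_eq hτ hgr, exp_weight hwreal, Complex.conj_ofReal]

lemma orthoSection_spec (hτ : τ.re = 0) (hD : D ∈ Ioo (0 : ℝ) 1) (hw : GammaContinuous τ w)
    (hwreal : ∀ s : ℝ, (w (τ / 2 + s)).im = 0) (n : ℕ) :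
    IsPresection τ D n (orthoSection τ D w n) ∧
      Tendsto (fun p => p ^ n * orthoSection τ D w n p) (𝓝[≠] 0) (𝓝 1) ∧
      IsRealType (orthoSection τ D w n) ∧
      ∀ m < n, pairing τ w (orthoSection τ D w n) (orthoSection τ D w m) = 0 := by
  induction n using Nat.strong_induction_on with
  | _ n ih =>
  have hb := isPresection_sectionBasis hτ hD n
  set c : ℕ → ℂ := fun m => pairing τ w (sectionBasis τ D n) (orthoSection τ D w m) /
    pairing τ w (orthoSection τ D w m) (orthoSection τ D w m) with hc
  have hs : ∀ m ∈ Finset.range n, IsPresection τ D m (fun p => c m * orthoSection τ D w m p) :=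
    fun m hm => (ih m (Finset.mem_range.1 hm)).1.const_mul _
  have hsn := isPresection_sum (n := n) _ _ fun m hm => (hs m hm).mono (Finset.mem_range.1 hm).le
  have e : orthoSection τ D w n = fun p => sectionBasis τ D n p -
      ∑ m ∈ Finset.range n, c m * orthoSection τ D w m p := orthoSection_eq n
  refine ⟨?_, ?_, ?_, ?_⟩
  · rw [e]; exact hb.sub hsn
  · have h0 : Tendsto (fun p => ∑ m ∈ Finset.range n, p ^ n * (c m * orthoSection τ D w m p))
        (𝓝[≠] 0) (𝓝 (∑ m ∈ Finset.range n, 0)) :=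
      tendsto_finsetSum _ fun m hm => (hs m hm).tendsto_of_lt (Finset.mem_range.1 hm)
    have := (tendsto_sectionBasis hτ hD n).sub h0
    rw [Finset.sum_const_zero, sub_zero] at this
    refine this.congr fun p => ?_
    rw [e, ← Finset.mul_sum]
    ring
  · intro p
    simp only [e, map_sub, map_sum, map_mul, sectionBasis_conj hτ]
    congr 1
    refine Finset.sum_congr rfl fun m hm => ?_
    obtain ⟨h1, -, h3, -⟩ := ih m (Finset.mem_range.1 hm)
    rw [h3, hc, map_div₀, pairing_conj hτ hwreal hb (sectionBasis_conj hτ n) h1 h3,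
      pairing_conj hτ hwreal h1 h3 h1 h3]
  · intro j hj
    obtain ⟨h1, h2, h3, h4⟩ := ih j hj
    rw [e, pairing_sub_left hw hb.gammaContinuous hsn.gammaContinuous h1.gammaContinuous,
      pairing_sum_left _ hw (fun m hm => (hs m hm).gammaContinuous) h1.gammaContinuous,
      Finset.sum_eq_single j]
    · rw [pairing_const_mul_left, hc]
      have hne : pairing τ w (orthoSection τ D w j) (orthoSection τ D w j) ≠ 0 := by
        rw [pairing_self hτ hwreal h1 h3]
        exact_mod_cast (gammaNormSq_pos hw h1 h2).ne'
      rw [div_mul_cancel₀ _ hne, sub_self]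
    · intro m hm hmj
      rw [pairing_const_mul_left]
      rcases lt_or_gt_of_ne hmj with h | h
      · rw [pairing_comm, h4 m h, mul_zero]
      · rw [(ih m (Finset.mem_range.1 hm)).2.2.2 j h, mul_zero]
    · intro h
      exact absurd (Finset.mem_range.2 hj) h

lemma pairing_orthoSection (hτ : τ.re = 0) (hD : D ∈ Ioo (0 : ℝ) 1) (hw : GammaContinuous τ w)
    (hwreal : ∀ s : ℝ, (w (τ / 2 + s)).im = 0) {n m : ℕ} (h : n ≠ m) :
    pairing τ w (orthoSection τ D w n) (orthoSection τ D w m) = 0 := by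
  rcases lt_or_gt_of_ne h with h | h
  · rw [pairing_comm]; exact (orthoSection_spec hτ hD hw hwreal m).2.2.2 n h
  · exact (orthoSection_spec hτ hD hw hwreal n).2.2.2 m h

/-- Existence of the monic orthogonal sections: the Gram–Schmidt process, after correcting the
values at removable singularities. -/
theorem exists_isMonicOrthogonal (hτ : τ.re = 0) (hD : D ∈ Ioo (0 : ℝ) 1)
    (hw : GammaContinuous τ w) (hwreal : ∀ s : ℝ, (w (τ / 2 + s)).im = 0) :
    ∃ P : ℕ → ℂ → ℂ, IsMonicOrthogonal τ D w P := by
  have hspec := orthoSection_spec hτ hD hw hwreal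
  refine ⟨fun n => toMeromorphicNFOn (orthoSection τ D w n) univ, ?_⟩
  have hev : ∀ n, toMeromorphicNFOn (orthoSection τ D w n) univ =ᶠ[𝓝[≠] 0]
      orthoSection τ D w n := fun n => by
    filter_upwards [((hspec n).1.meromorphicAt 0).eventually_analyticAt] with p hp using
      toMeromorphicNFOn_eq_of_analyticAt (hspec n).1.meromorphicAt hp
  have hlim : ∀ n, Tendsto (fun p => p ^ n * toMeromorphicNFOn (orthoSection τ D w n) univ p)
      (𝓝[≠] 0) (𝓝 1) := fun n => by
    refine (hspec n).2.1.congr' ?_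
    filter_upwards [hev n] with p hp
    rw [hp]
  have hgam : ∀ n, ∀ s : ℝ, toMeromorphicNFOn (orthoSection τ D w n) univ (τ / 2 + s) =
      orthoSection τ D w n (τ / 2 + s) := fun n s =>
    toMeromorphicNFOn_eq_of_analyticAt (hspec n).1.meromorphicAt
      ((hspec n).1.analyticAt _ (offPoles_tau_div_two_add s))
  refine ⟨fun n => (hspec n).1.toMeromorphicNFOn_mem hD, fun n hn => ?_, fun n => ?_,
    fun n m hnm => ?_⟩
  · exact zero_ne_one (tendsto_nhds_unique (tendsto_zero_of_mem_pred hD hn) (hlim n))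
  · have hmem := isPresection_of_mem hD ((hspec n).1.toMeromorphicNFOn_mem hD)
    exact (isBigO_sub_one_iff (hmem.meromorphicAt 0)).2 (hlim n)
  · rw [pairing_congr_left (hgam n), pairing_comm, pairing_congr_left (hgam m),
      pairing_orthoSection hτ hD hw hwreal hnm.symm]

/-- The norms of monic orthogonal sections are those of the Gram–Schmidt process. -/
theorem IsMonicOrthogonal.pairing_eq (hτ : τ.re = 0) (hD : D ∈ Ioo (0 : ℝ) 1)
    (hw : GammaContinuous τ w) (hwreal : ∀ s : ℝ, (w (τ / 2 + s)).im = 0) {P : ℕ → ℂ → ℂ}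
    (hP : IsMonicOrthogonal τ D w P) (n : ℕ) :
    pairing τ w (P n) (P n) = (gammaNormSq τ w (orthoSection τ D w n) : ℂ) := by
  have hspec := orthoSection_spec hτ hD hw hwreal
  have hPs : ∀ k, IsPresection τ D k (P k) := fun k => isPresection_of_mem hD (hP.mem k)
  have hP1 : ∀ k, Tendsto (fun p => p ^ k * P k p) (𝓝[≠] 0) (𝓝 1) := fun k =>
    (isBigO_sub_one_iff ((hPs k).meromorphicAt 0)).1 (hP.monic k)
  rw [← pairing_self hτ hwreal (hspec n).1 (hspec n).2.2.1,
    ← pairing_eq_of_monic hτ hw hPs hP1 (fun k hk => hP.orthogonal k n hk.ne) (hspec n).1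
      (hspec n).2.1, pairing_comm,
    ← pairing_eq_of_monic hτ hw (fun k => (hspec k).1) (fun k => (hspec k).2.1)
      (fun k hk => pairing_orthoSection hτ hD hw hwreal hk.ne) (hPs n) (hP1 n)]

/-- A function that is small on `γ` has a small pairing with `πₙ`, because
`∫ |πₙ| dμ ≤ const ‖πₙ‖`. -/
lemma exists_norm_pairing_le (hτ : τ.re = 0) (hD : D ∈ Ioo (0 : ℝ) 1) (hw : GammaContinuous τ w)
    (hwreal : ∀ s : ℝ, (w (τ / 2 + s)).im = 0) :
    ∃ C : ℝ, 0 < C ∧ ∀ (n : ℕ) (f : ℂ → ℂ) (δ : ℝ), GammaContinuous τ f →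
      (∀ s : ℝ, ‖f (τ / 2 + s)‖ ≤ δ) → ‖pairing τ w f (orthoSection τ D w n)‖ ≤
        C * δ * Real.sqrt (gammaNormSq τ w (orthoSection τ D w n)) := by
  have hwc : Continuous fun s : ℝ => Real.exp (w (τ / 2 + s)).re :=
    Real.continuous_exp.comp (Complex.continuous_re.comp hw)
  set W := ∫ s in (0 : ℝ)..1, Real.exp (w (τ / 2 + s)).re with hW
  have hW0 : 0 ≤ W := intervalIntegral.integral_nonneg zero_le_one fun s _ => (Real.exp_pos _).le
  refine ⟨1 + W, by positivity, fun n f δ hf hδ => ?_⟩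
  have hδ0 : 0 ≤ δ := (norm_nonneg _).trans (hδ 0)
  set u := orthoSection τ D w n with hu
  have hus : IsPresection τ D n u := (orthoSection_spec hτ hD hw hwreal n).1
  set N := gammaNormSq τ w u with hN
  have hN0 : 0 < N := gammaNormSq_pos hw hus (orthoSection_spec hτ hD hw hwreal n).2.1
  set r := Real.sqrt N with hr
  have hr0 : 0 < r := Real.sqrt_pos.2 hN0
  have hrN : r ^ 2 = N := Real.sq_sqrt hN0.le
  have hcu := continuous_gammaNormSq_integrand hw hus.gammaContinuous
  have hI1 : IntervalIntegrable (fun s : ℝ => δ * r⁻¹ *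
      (‖u (τ / 2 + s)‖ ^ 2 * Real.exp (w (τ / 2 + s)).re)) MeasureTheory.volume 0 1 :=
    (continuous_const.mul hcu).intervalIntegrable 0 1
  have hI2 : IntervalIntegrable (fun s : ℝ => δ * r * Real.exp (w (τ / 2 + s)).re)
      MeasureTheory.volume 0 1 := (continuous_const.mul hwc).intervalIntegrable 0 1
  have hle := intervalIntegral.norm_integral_le_of_norm_le (a := (0 : ℝ)) (b := 1) (μ :=
    MeasureTheory.volume) (f := fun s : ℝ => f (τ / 2 + s) * u (τ / 2 + s) *
      Complex.exp (w (τ / 2 + s))) zero_le_one (Eventually.of_forall fun s _ => ?_) (hI1.add hI2)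
  · refine hle.trans (le_of_eq ?_)
    rw [intervalIntegral.integral_add hI1 hI2, intervalIntegral.integral_const_mul,
      intervalIntegral.integral_const_mul, ← hW]
    change δ * r⁻¹ * N + _ = _
    rw [← hrN]
    field_simp
  · rw [norm_mul, norm_mul, Complex.norm_exp]
    -- integrated, this inequality gives `∫ |u| dμ ≤ (1 + W) r`
    have h1 : ‖u (τ / 2 + s)‖ ≤ r⁻¹ * ‖u (τ / 2 + s)‖ ^ 2 + r := by
      have h2 : ‖u (τ / 2 + s)‖ * r ≤ ‖u (τ / 2 + s)‖ ^ 2 + r * r := by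
        nlinarith [sq_nonneg (‖u (τ / 2 + s)‖ - r), norm_nonneg (u (τ / 2 + s))]
      rw [inv_mul_eq_div, div_add' _ _ _ hr0.ne', le_div_iff₀ hr0]
      exact h2
    have h3 : ‖f (τ / 2 + s)‖ * ‖u (τ / 2 + s)‖ ≤ δ * (r⁻¹ * ‖u (τ / 2 + s)‖ ^ 2 + r) :=
      mul_le_mul (hδ s) h1 (norm_nonneg _) hδ0
    calc _ ≤ δ * (r⁻¹ * ‖u (τ / 2 + s)‖ ^ 2 + r) * Real.exp (w (τ / 2 + s)).re :=
          mul_le_mul_of_nonneg_right h3 (Real.exp_pos _).le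
      _ = _ := by ring

end Ortho

/-! ### Approximation by sections -/

section Approximation

variable {τ : UpperHalfPlane} {D : ℝ}

/-- The logarithmic derivative of `θ₁(u; τ)`: a kernel on `ℂ / ℤ` with simple poles of residue `1`
at the lattice and an additive jump under `τ`. -/
noncomputable def thetaKernel (τ : UpperHalfPlane) (u : ℂ) : ℂ :=
  deriv (fun p => theta1 p τ) u / theta1 u τ

lemma thetaKernel_add_one (u : ℂ) : thetaKernel τ (u + 1) = thetaKernel τ u := by
  rw [thetaKernel, thetaKernel, theta1_add_one, ← deriv_comp_add_const,
    show (fun x => theta1 (x + 1) τ) = fun x => -theta1 x τ from funext fun x => theta1_add_one x τ,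
    deriv.fun_neg, neg_div_neg_eq]

lemma OffLattice.analyticAt_thetaKernel (hτ : τ.re = 0) {u : ℂ} (hu : OffLattice τ u) :
    AnalyticAt ℂ (thetaKernel τ) u :=
  (analyticAt_theta1 u).deriv.div (analyticAt_theta1 u) (hu.theta1_ne_zero hτ)

lemma thetaKernel_add_tau (hτ : τ.re = 0) {u : ℂ} (hu : OffLattice τ u) :
    thetaKernel τ (u + τ) = thetaKernel τ u - 2 * π * Complex.I := by
  have h0 := hu.theta1_ne_zero hτ
  have hd := (differentiable_theta1 (coe_tau_im_pos τ) u).hasDerivAt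
  have he : HasDerivAt (fun p : ℂ => -Complex.exp (-(π * Complex.I * (τ + 2 * p))))
      (-(Complex.exp (-(π * Complex.I * (τ + 2 * u))) * -(π * Complex.I * (2 * 1)))) u :=
    (((((hasDerivAt_id u).const_mul 2).const_add (τ : ℂ)).const_mul (π * Complex.I)).neg.cexp).neg
  have h1 := he.fun_mul hd
  have h2 : (fun p => theta1 (p + τ) τ) = fun p : ℂ =>
      -Complex.exp (-(π * Complex.I * (τ + 2 * p))) * theta1 p τ :=
    funext fun p => theta1_add_self p τ
  rw [thetaKernel, thetaKernel, ← deriv_comp_add_const, h2, h1.deriv, theta1_add_self]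
  have := Complex.exp_ne_zero (-(π * Complex.I * (τ + 2 * u)))
  field_simp
  ring

lemma tendsto_mul_thetaKernel (hτ : τ.re = 0) :
    Tendsto (fun u => u * thetaKernel τ u) (𝓝[≠] 0) (𝓝 1) := by
  have h1 : Tendsto (deriv fun p => theta1 p τ) (𝓝[≠] 0) (𝓝 (theta1DerivZero τ)) :=
    (analyticAt_theta1 (τ := τ) 0).deriv.continuousAt.tendsto.mono_left nhdsWithin_le_nhds
  have hd := theta1DerivZero_ne_zero (coe_tau_im_pos τ) hτ
  have := h1.div (tendsto_theta1_div (coe_tau_im_pos τ)) hd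
  rw [div_self hd] at this
  refine this.congr fun u => ?_
  simp only [Pi.div_apply, thetaKernel]
  rw [div_div_eq_mul_div]
  ring

lemma lineInt_comp_sub_tau (hτ : τ.re = 0) (f : ℂ → ℂ) (y : ℝ) :
    lineInt (fun q => f (q - τ)) y = lineInt f (y - τ.im) := by
  refine intervalIntegral.integral_congr fun x _ => ?_
  simp only
  congr 1
  rw [coe_tau_eq hτ]
  push_cast; ring

lemma lineInt_add {f g : ℂ → ℂ} {y : ℝ} (hf : ∀ z : ℂ, z.im = y → ContinuousAt f z)
    (hg : ∀ z : ℂ, z.im = y → ContinuousAt g z) :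
    lineInt (fun q => f q + g q) y = lineInt f y + lineInt g y :=
  intervalIntegral.integral_add (intervalIntegrable_line fun _ _ => hf _ (line_im _ _))
    (intervalIntegrable_line fun _ _ => hg _ (line_im _ _))

lemma offPoles_of_window (hD : D ∈ Ioo (0 : ℝ) 1) {z : ℂ} (h1 : (D - 1) / 2 ≤ z.re)
    (h2 : z.re ≤ (D - 1) / 2 + 1) (h : |z.im| < τ.im) (h0 : z ≠ 0) (hzD : z ≠ D) :
    OffPoles τ D z := by
  obtain ⟨hD0, hD1⟩ := hD
  constructor
  · refine offLattice_of_ne (fun n hn => h0 ?_) h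
    rw [hn, Complex.intCast_re] at h1 h2
    have l1 : (-1 : ℝ) < n := by linarith
    have l2 : (n : ℝ) < 1 := by linarith
    have l1' : -1 < n := by exact_mod_cast l1
    have l2' : n < 1 := by exact_mod_cast l2
    have : n = 0 := by omega
    rw [hn, this, Int.cast_zero]
  · refine offLattice_of_ne (fun n hn => hzD ?_) (by simpa using h)
    have hre := congrArg Complex.re hn
    simp only [Complex.sub_re, Complex.ofReal_re, Complex.intCast_re] at hre
    have l1 : (-1 : ℝ) < n := by linarith
    have l2 : (n : ℝ) < 1 := by linarith
    have l1' : -1 < n := by exact_mod_cast l1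
    have l2' : n < 1 := by exact_mod_cast l2
    have : n = 0 := by omega
    rw [this, Int.cast_zero] at hn
    exact sub_eq_zero.1 hn

/-- The residue theorem in the annulus `|Im p| < y`, for a function whose only singularities
are at `0` and `D`, the latter removable. -/
lemma lineInt_neg_sub_lineInt (hD : D ∈ Ioo (0 : ℝ) 1) {y : ℝ} (hy : 0 < y) (hyT : y < τ.im)
    {f : ℂ → ℂ} {ρ : ℂ} (hper : ∀ z : ℂ, -y ≤ z.im → z.im ≤ y → f (z + 1) = f z)
    (han : ∀ z : ℂ, -y ≤ z.im → z.im ≤ y → OffPoles τ D z → DifferentiableAt ℂ f z)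
    (h0 : Tendsto (fun p => p * f p) (𝓝[≠] 0) (𝓝 ρ))
    (hf : Tendsto (fun p => (p - D) * f p) (𝓝[≠] (D : ℂ)) (𝓝 0)) :
    lineInt f (-y) - lineInt f y = 2 * π * Complex.I * ρ := by
  have hD' := hD
  obtain ⟨hD0, hD1⟩ := hD'
  have hDne : (D : ℂ) ≠ 0 := by exact_mod_cast hD0.ne'
  have := lineInt_sub_lineInt ((D - 1) / 2) (y₁ := -y) (y₂ := y) (by linarith) {0, (D : ℂ)}
    (f := f) (r := fun s => if s = 0 then ρ else 0)
    (by
      intro s hs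
      rw [Finset.mem_insert, Finset.mem_singleton] at hs
      rcases hs with rfl | rfl
      · simp only [Complex.zero_re, Complex.zero_im]
        exact ⟨⟨by linarith, by linarith⟩, by linarith, hy⟩
      · simp only [Complex.ofReal_re, Complex.ofReal_im]
        exact ⟨⟨by linarith, by linarith⟩, by linarith, hy⟩)
    hper
    (by
      intro z a b c d hz
      rw [Finset.mem_insert, Finset.mem_singleton, not_or] at hz
      exact han z c d (offPoles_of_window hD a b (by rw [abs_lt]; constructor <;> linarith)
        hz.1 hz.2))
    (by
      intro s hs
      rw [Finset.mem_insert, Finset.mem_singleton] at hs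
      rcases hs with rfl | rfl
      · simpa using h0
      · simpa [hDne] using hf)
  rw [this, Finset.sum_pair hDne.symm, if_pos rfl, if_neg hDne, add_zero]

/-- The kernel `thetaKernel` is bounded away from its poles. -/
lemma exists_thetaKernel_bound (hτ : τ.re = 0) {ε' : ℝ} (h0 : 0 < ε') (h1 : ε' < τ.im / 2) :
    ∃ B : ℝ, 0 < B ∧ ∀ u : ℂ, ε' ≤ |u.im| → |u.im| ≤ τ.im / 2 → ‖thetaKernel τ u‖ ≤ B := by
  have hT := τ.im_pos
  obtain ⟨B, hB0, hB⟩ := exists_bound_of_periodic (f := thetaKernel τ) (y₁ := ε') (y₂ := τ.im / 2)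
    (fun z _ _ => by rw [thetaKernel_add_one]) (fun z a b => by
      refine ((offLattice_of_im ?_ ?_).analyticAt_thetaKernel hτ).continuousAt
      · linarith
      · rw [abs_of_pos (by linarith)]; linarith)
  obtain ⟨B', hB0', hB'⟩ := exists_bound_of_periodic (f := thetaKernel τ) (y₁ := -(τ.im / 2))
    (y₂ := -ε') (fun z _ _ => by rw [thetaKernel_add_one]) (fun z a b => by
      refine ((offLattice_of_im ?_ ?_).analyticAt_thetaKernel hτ).continuousAt
      · linarith
      · rw [abs_of_neg (by linarith)]; linarith)
  refine ⟨max B B', lt_max_of_lt_left hB0, fun u a b => ?_⟩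
  rcases abs_cases u.im with ⟨h, -⟩ | ⟨h, -⟩ <;> rw [h] at a b
  · exact (hB u a b).trans (le_max_left _ _)
  · exact (hB' u (by linarith) (by linarith)).trans (le_max_right _ _)

/-- **Approximation by sections.** Let `F` be a function in the annulus `|Im p| < Im τ / 2 + ε''`
with the singularities of a monic section, which is small near the boundary. Then the sum of its
two branches on `γ` is close to a monic section: if the section `Q` has the same singularities as
`F`, up to a simple pole at `0`, then Cauchy's formula around `γ` expresses `V(p) = F(p) + F(p - τ)
- Q(p)` by `F` on the boundary lines, up to the constant that the kernel picks up under `τ`. -/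
theorem exists_presection_approx (hτ : τ.re = 0) (hD : D ∈ Ioo (0 : ℝ) 1) {ε' ε'' : ℝ}
    (h0 : 0 < ε') (h1 : ε' < ε'') (h2 : ε'' < τ.im / 2) :
    ∃ C : ℝ, 0 < C ∧ ∀ (n : ℕ) (F : ℂ → ℂ) (B : ℝ), 2 ≤ n → (∀ z, F (z + 1) = F z) →
      (∀ z : ℂ, |z.im| < τ.im / 2 + ε'' → OffPoles τ D z → AnalyticAt ℂ F z) →
      MeromorphicAt F 0 → MeromorphicAt F D →
      Tendsto (fun p => p ^ n * F p) (𝓝[≠] 0) (𝓝 1) →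
      (∃ c, Tendsto (fun p => (p - D) * F p) (𝓝[≠] (D : ℂ)) (𝓝 c)) →
      (∀ z : ℂ, |z.im| = τ.im / 2 + ε' → ‖F z‖ ≤ B) →
      ∃ Q : ℂ → ℂ, IsPresection τ D n Q ∧ Tendsto (fun p => p ^ n * Q p) (𝓝[≠] 0) (𝓝 1) ∧
        ∀ s : ℝ, ‖F (τ / 2 + s) + F (τ / 2 + s - τ) - Q (τ / 2 + s)‖ ≤ C * B := by
  have hT := τ.im_pos
  obtain ⟨M, hM0, hM⟩ := exists_thetaKernel_bound hτ h0 (h1.trans h2)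
  refine ⟨4 * M, by positivity, fun n F B hn hper han hm0 hmD hlim hlimD hB => ?_⟩
  obtain ⟨Q, hQ, hQ1, ⟨ρ, hρ⟩, hQD⟩ := exists_presection_sub hτ hD (by omega : n ≠ 0) hlim hm0 hmD
    hlimD
  set b := τ.im / 2 - ε' with hb
  set t := τ.im / 2 + ε' with ht
  have hb0 : 0 < b := by linarith
  set G : ℂ → ℂ := fun z => F z - Q z with hG
  set V : ℂ → ℂ := fun z => F z - Q z + F (z - τ) with hV
  have hoff : ∀ z : ℂ, b ≤ z.im → z.im ≤ t → OffPoles τ D z := fun z h1 h2 =>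
    offPoles_of_im (by linarith) (by rw [abs_of_pos (by linarith)]; linarith)
  have hoff' : ∀ z : ℂ, b ≤ z.im → z.im ≤ t → OffPoles τ D (z - τ) := fun z h1 h2 =>
    ⟨(hoff z h1 h2).1.sub_tau, by rw [sub_right_comm]; exact (hoff z h1 h2).2.sub_tau⟩
  have hFan : ∀ z : ℂ, b ≤ z.im → z.im ≤ t → AnalyticAt ℂ F z := fun z h1 h2 =>
    han z (by rw [abs_of_pos (by linarith)]; linarith) (hoff z h1 h2)
  have hFan' : ∀ z : ℂ, b ≤ z.im → z.im ≤ t → AnalyticAt ℂ (fun z => F (z - τ)) z := by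
    intro z h1 h2
    refine AnalyticAt.comp (g := F) (f := fun z : ℂ => z - τ) (han _ ?_ (hoff' z h1 h2))
      (by fun_prop)
    rw [Complex.sub_im, UpperHalfPlane.coe_im, abs_lt]
    constructor <;> linarith
  have hQan' : ∀ z : ℂ, b ≤ z.im → z.im ≤ t → AnalyticAt ℂ (fun z => Q (z - τ)) z :=
    fun z h1 h2 => AnalyticAt.comp (g := Q) (f := fun z : ℂ => z - τ)
      (hQ.analyticAt _ (hoff' z h1 h2)) (by fun_prop)
  have hGan : ∀ z : ℂ, b ≤ z.im → z.im ≤ t → AnalyticAt ℂ G z := fun z h1 h2 =>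
    (hFan z h1 h2).sub (hQ.analyticAt z (hoff z h1 h2))
  have hVan : ∀ z : ℂ, b ≤ z.im → z.im ≤ t → AnalyticAt ℂ V z := fun z h1 h2 =>
    (hGan z h1 h2).add (hFan' z h1 h2)
  have hG1 : ∀ z, G (z + 1) = G z := fun z => by simp only [hG, hper, hQ.add_one]
  have hV1 : ∀ z, V (z + 1) = V z := fun z => by
    simp only [hV, hper, hQ.add_one, add_sub_right_comm z 1]
  have hGan0 : ∀ z : ℂ, -b ≤ z.im → z.im ≤ b → OffPoles τ D z → DifferentiableAt ℂ G z :=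
    fun z h1 h2 ho => ((han z (by rw [abs_lt]; constructor <;> linarith) ho).sub
      (hQ.analyticAt z ho)).differentiableAt
  have hQs : ∀ z, Q (z - τ) = Q z := fun z => by rw [← hQ.add_tau (z - τ), sub_add_cancel]
  have hVeq : ∀ z, V z = G (z - τ) + F z := fun z => by
    simp only [hV, hG, hQs]; ring
  have hbt : b ≤ t := by linarith
  -- on each of the two lines, `V` is the sum of a small boundary value of `F` and of a value of `G`
  -- in the annulus, on whose boundary lines the residue theorem can be applied
  have hbot : ∀ K : ℂ → ℂ, (∀ z : ℂ, z.im = b → ContinuousAt K z) →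
      lineInt (fun q => V q * K q) b =
        lineInt (fun q => G q * K q) b + lineInt (fun q => F (q - τ) * K q) b := by
    intro K hK
    rw [← lineInt_add (f := fun q => G q * K q) (g := fun q => F (q - τ) * K q)
      (fun z hz => (hGan z hz.ge (hz.le.trans hbt)).continuousAt.mul (hK z hz))
      (fun z hz => (hFan' z hz.ge (hz.le.trans hbt)).continuousAt.mul (hK z hz))]
    congr 1; ext q; simp only [hV, hG]; ring
  have htop : ∀ K : ℂ → ℂ, (∀ z : ℂ, z.im = t → ContinuousAt K z) →
      lineInt (fun q => V q * K q) t =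
        lineInt (fun q => G q * K (q + τ)) (-b) + lineInt (fun q => F q * K q) t := by
    intro K hK
    have e := lineInt_comp_sub_tau hτ (fun q => G q * K (q + τ)) t
    rw [show t - τ.im = -b by rw [ht, hb]; ring] at e
    rw [← e, ← lineInt_add (f := fun q => G (q - τ) * K (q - τ + τ)) (g := fun q => F q * K q)
      (fun z hz => ?_)
      (fun z hz => (hFan z (hbt.trans hz.ge) hz.le).continuousAt.mul (hK z hz))]
    · congr 1; ext q; simp only [sub_add_cancel, hVeq]; ring
    · simp only [sub_add_cancel]
      exact ((hFan' z (hbt.trans hz.ge) hz.le).sub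
        (hQan' z (hbt.trans hz.ge) hz.le)).continuousAt.mul (hK z hz)
  have hFt : ∀ z : ℂ, z.im = t → ‖F z‖ ≤ B := fun z hz =>
    hB z (by rw [hz, abs_of_pos (by linarith)])
  have hFb : ∀ z : ℂ, z.im = b → ‖F (z - τ)‖ ≤ B := fun z hz => by
    refine hB _ ?_
    rw [Complex.sub_im, UpperHalfPlane.coe_im, hz, abs_of_neg (by linarith)]
    linarith
  have hB0 : 0 ≤ B := (norm_nonneg _).trans (hFt (t * Complex.I) (by simp))
  -- the residue of `G` at `0`
  have hres : 2 * π * Complex.I * ρ = lineInt (fun q => F (q - τ) * 1) b -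
      lineInt (fun q => F q * 1) t := by
    have e1 := lineInt_neg_sub_lineInt hD hb0 (by linarith) (fun z _ _ => hG1 z) hGan0 hρ hQD
    have e2 := lineInt_eq_lineInt hbt (fun z _ _ => hV1 z)
      (fun z a b => (hVan z a b).differentiableAt)
    have e3 := hbot (fun _ => 1) fun z _ => continuousAt_const
    have e4 := htop (fun _ => 1) fun z _ => continuousAt_const
    simp only [mul_one] at e3 e4 ⊢
    linear_combination -e1 - e2 + e3 - e4
  -- the constant is the contribution of the additive jump of the kernel under `τ`
  refine ⟨fun z => Q z + lineInt G (-b), hQ.add ((isPresection_const _).mono (Nat.zero_le n)),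
    ?_, fun s => ?_⟩
  · have := (hQ1 hn).add ((isPresection_const (τ := τ) (D := D) (lineInt G (-b))).tendsto_of_lt
      (show 0 < n by omega))
    rw [add_zero] at this
    exact this.congr fun p => by ring
  · set p : ℂ := τ / 2 + s with hp
    have hpim : p.im = τ.im / 2 := by simp [hp]
    set Z : ℂ → ℂ := fun q => thetaKernel τ (q - p) with hZ
    have hZ1 : ∀ q, Z (q + 1) = Z q := fun q => by
      simp only [hZ, add_sub_right_comm q 1, thetaKernel_add_one]
    have hZan : ∀ q : ℂ, OffLattice τ (q - p) → AnalyticAt ℂ Z q := fun q hq =>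
      AnalyticAt.comp (g := thetaKernel τ) (f := fun q : ℂ => q - p)
        (hq.analyticAt_thetaKernel hτ) (by fun_prop)
    have hqp : ∀ q : ℂ, (q - p).im = q.im - τ.im / 2 := fun q => by rw [Complex.sub_im, hpim]
    have hqp1 : ∀ q : ℂ, q.im ≠ τ.im / 2 → |q.im - τ.im / 2| < τ.im → OffLattice τ (q - p) :=
      fun q a b => offLattice_of_im (by rw [hqp]; exact sub_ne_zero.2 a) (by rwa [hqp])
    -- Cauchy's formula for `V`
    have hV0 : lineInt (fun q => V q * Z q) b - lineInt (fun q => V q * Z q) t =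
        2 * π * Complex.I * V p := by
      have := lineInt_sub_lineInt (p.re - 1 / 2) hbt {p} (f := fun q => V q * Z q) (r := V)
        (by
          intro q hq
          rw [Finset.mem_singleton] at hq
          subst hq
          exact ⟨⟨by linarith, by linarith⟩, by linarith, by linarith⟩)
        (fun z _ _ => by rw [hV1, hZ1])
        (by
          intro z a1 a2 a3 a4 hz
          rw [Finset.mem_singleton] at hz
          have hoz : OffLattice τ (z - p) := by
            refine offLattice_of_ne (fun m hm => hz ?_) (by
              rw [hqp, abs_lt]; constructor <;> linarith)
            have hre := congrArg Complex.re hm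
            simp only [Complex.sub_re, Complex.intCast_re] at hre
            have l1 : (-1 : ℝ) < m := by linarith
            have l2 : (m : ℝ) < 1 := by linarith
            have l1' : -1 < m := by exact_mod_cast l1
            have l2' : m < 1 := by exact_mod_cast l2
            have : m = 0 := by omega
            rw [this, Int.cast_zero] at hm
            exact sub_eq_zero.1 hm
          exact ((hVan z a3 a4).mul (hZan z hoz)).differentiableAt)
        (by
          intro q hq
          rw [Finset.mem_singleton] at hq
          subst hq
          have htend : Tendsto (fun z : ℂ => z - p) (𝓝[≠] p) (𝓝[≠] 0) := by
            refine tendsto_nhdsWithin_iff.2 ⟨?_, ?_⟩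
            · have : Tendsto (fun z : ℂ => z - p) (𝓝 p) (𝓝 (p - p)) :=
                Continuous.tendsto (by fun_prop) _
              rw [sub_self] at this
              exact this.mono_left nhdsWithin_le_nhds
            · filter_upwards [self_mem_nhdsWithin] with z hz
              exact sub_ne_zero.2 hz
          have hVc := (hVan p (by linarith) (by linarith)).continuousAt.tendsto
          have := ((tendsto_mul_thetaKernel hτ).comp htend).mul
            (hVc.mono_left (nhdsWithin_le_nhds (s := {p}ᶜ)))
          rw [one_mul] at this
          exact this.congr fun z => by simp only [Function.comp, hZ]; ring)
      rw [this, Finset.sum_singleton]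
    have e1 := hbot Z fun z hz => (hZan z (hqp1 z (by linarith) (by
      rw [abs_lt]; constructor <;> linarith))).continuousAt
    have e2 := htop Z fun z hz => (hZan z (hqp1 z (by linarith) (by
      rw [abs_lt]; constructor <;> linarith))).continuousAt
    have e3 : lineInt (fun q => G q * Z (q + τ)) (-b) =
        lineInt (fun q => G q * Z q) (-b) + -(2 * π * Complex.I) * lineInt G (-b) := by
      have hGc : ∀ z : ℂ, z.im = -b → ContinuousAt G z := fun z hz =>
        (hGan0 z hz.ge (by linarith) (offPoles_of_im (by linarith) (by
          rw [hz, abs_of_neg (by linarith)]; linarith))).continuousAt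
      have hoz : ∀ z : ℂ, z.im = -b → OffLattice τ (z - p) := fun z hz =>
        hqp1 z (by linarith) (by rw [abs_lt]; constructor <;> linarith)
      have e4 : -(2 * π * Complex.I) * lineInt G (-b) =
          lineInt (fun q => -(2 * π * Complex.I) * G q) (-b) := by
        simp only [lineInt, intervalIntegral.integral_const_mul]
      rw [e4, ← lineInt_add (f := fun q => G q * Z q) (g := fun q => -(2 * π * Complex.I) * G q)
        (fun z hz => (hGc z hz).mul (hZan z (hoz z hz)).continuousAt)
        (fun z hz => continuousAt_const.mul (hGc z hz))]
      refine intervalIntegral.integral_congr fun x _ => ?_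
      simp only [hZ]
      rw [add_sub_right_comm, thetaKernel_add_tau hτ (hoz _ (line_im x (-b)))]
      ring
    have e5 : lineInt (fun q => G q * Z q) (-b) - lineInt (fun q => G q * Z q) b =
        2 * π * Complex.I * (ρ * thetaKernel τ (-p)) := by
      have hZ0 : ∀ q : ℂ, -b ≤ q.im → q.im ≤ b → AnalyticAt ℂ Z q := fun q a1 a2 =>
        hZan q (hqp1 q (by linarith) (by rw [abs_lt]; constructor <;> linarith))
      refine lineInt_neg_sub_lineInt hD hb0 (by linarith) (fun z _ _ => by rw [hG1, hZ1])
        (fun z a1 a2 ho => (hGan0 z a1 a2 ho).mul (hZ0 z a1 a2).differentiableAt) ?_ ?_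
      · have hc := (hZ0 0 (by simp; linarith) (by simp; linarith)).continuousAt.tendsto
        have hz0 : Z 0 = thetaKernel τ (-p) := by simp only [hZ, zero_sub]
        rw [hz0] at hc
        exact (hρ.mul (hc.mono_left nhdsWithin_le_nhds)).congr fun z => by simp only [hG]; ring
      · have hc := (hZ0 D (by simp; linarith) (by simp; linarith)).continuousAt.tendsto
        have := hQD.mul (hc.mono_left (nhdsWithin_le_nhds (s := {(D : ℂ)}ᶜ)))
        rw [zero_mul] at this
        exact this.congr fun z => by simp only [hG]; ring
    have hkey : 2 * π * Complex.I * (V p - lineInt G (-b)) =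
        lineInt (fun q => F (q - τ) * Z q) b - lineInt (fun q => F q * Z q) t -
          (lineInt (fun q => F (q - τ) * 1) b - lineInt (fun q => F q * 1) t) *
            thetaKernel τ (-p) := by
      linear_combination -hV0 + e1 - e2 - e3 - e5 - thetaKernel τ (-p) * hres
    have hZb : ∀ z : ℂ, z.im = b → ‖Z z‖ ≤ M := fun z hz => hM _
      (by rw [hqp, abs_of_neg (by linarith)]; linarith)
      (by rw [hqp, abs_of_neg (by linarith)]; linarith)
    have hZt : ∀ z : ℂ, z.im = t → ‖Z z‖ ≤ M := fun z hz => hM _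
      (by rw [hqp, abs_of_pos (by linarith)]; linarith)
      (by rw [hqp, abs_of_pos (by linarith)]; linarith)
    have hZp : ‖thetaKernel τ (-p)‖ ≤ M := hM _
      (by rw [Complex.neg_im, hpim, abs_neg, abs_of_pos (by linarith)]; linarith)
      (by rw [Complex.neg_im, hpim, abs_neg, abs_of_pos (by linarith)])
    have b1 : ‖lineInt (fun q => F (q - τ) * Z q) b‖ ≤ B * M := norm_lineInt_le fun z hz => by
      rw [norm_mul]; exact mul_le_mul (hFb z hz) (hZb z hz) (norm_nonneg _) hB0
    have b2 : ‖lineInt (fun q => F q * Z q) t‖ ≤ B * M := norm_lineInt_le fun z hz => by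
      rw [norm_mul]; exact mul_le_mul (hFt z hz) (hZt z hz) (norm_nonneg _) hB0
    have b3 : ‖lineInt (fun q => F (q - τ) * 1) b‖ ≤ B := norm_lineInt_le fun z hz => by
      rw [mul_one]; exact hFb z hz
    have b4 : ‖lineInt (fun q => F q * 1) t‖ ≤ B := norm_lineInt_le fun z hz => by
      rw [mul_one]; exact hFt z hz
    have hfin : ‖2 * π * Complex.I * (V p - lineInt G (-b))‖ ≤ 4 * M * B := by
      rw [hkey]
      refine (norm_sub_le _ _).trans ?_
      rw [norm_mul]
      have c1 := norm_sub_le (lineInt (fun q => F (q - τ) * Z q) b)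
        (lineInt (fun q => F q * Z q) t)
      have c2 := norm_sub_le (lineInt (fun q => F (q - τ) * 1) b) (lineInt (fun q => F q * 1) t)
      have c3 := mul_le_mul (c2.trans (add_le_add b3 b4)) hZp (norm_nonneg _) (by linarith)
      linarith
    have hpi : (1 : ℝ) ≤ ‖(2 * π * Complex.I : ℂ)‖ := by
      rw [norm_mul, norm_mul, Complex.norm_I, Complex.norm_real, Real.norm_eq_abs,
        abs_of_pos Real.pi_pos, Complex.norm_ofNat]
      linarith [Real.pi_gt_three]
    rw [norm_mul] at hfin
    have hVp : F p + F (p - τ) - (Q p + lineInt G (-b)) = V p - lineInt G (-b) := by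
      simp only [hV]; ring
    rw [hVp]
    exact (le_mul_of_one_le_left (norm_nonneg _) hpi).trans hfin

end Approximation

/-! ### The leading asymptotics -/

section Trial

variable {τ : UpperHalfPlane} {D : ℝ} {w φ : ℂ → ℂ} {n : ℕ}

/-- `θ₂(p; 2τ)` for even and `θ₃(p; 2τ)` for odd `n`. -/
noncomputable def parityTheta (τ : UpperHalfPlane) (n : ℕ) (p : ℂ) : ℂ :=
  if Even n then theta2 p (2 * τ) else theta3 p (2 * τ)

/-- `θ₂ / θ₄` for even and `θ₃ / θ₄` for odd `n`: this ratio changes sign under `2τ`, and under `1`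
it is multiplied by `(-1)ⁿ⁺¹`. -/
noncomputable def parityRatio (τ : UpperHalfPlane) (n : ℕ) (p : ℂ) : ℂ :=
  parityTheta τ n p / theta4 p (2 * τ)

lemma parityTheta_congr {m : ℕ} (h : Even n ↔ Even m) : parityTheta τ n = parityTheta τ m := by
  ext p; simp only [parityTheta, h]

lemma parityTheta_add_one (p : ℂ) :
    parityTheta τ n (p + 1) = -((-1) ^ n * parityTheta τ n p) := by
  rw [parityTheta, parityTheta]
  split_ifs with h
  · rw [h.neg_one_pow, theta2_add_one, one_mul]
  · rw [(Nat.not_even_iff_odd.1 h).neg_one_pow, theta3_add_one, neg_one_mul, neg_neg]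

lemma parityRatio_add_one (p : ℂ) :
    parityRatio τ n (p + 1) = -((-1) ^ n * parityRatio τ n p) := by
  rw [parityRatio, parityRatio, parityTheta_add_one, theta4_add_one]
  ring

lemma parityTheta_eq_mul (p : ℂ) : parityTheta τ (n + 1) p =
    halfPeriodFactor (p - τ) (2 * τ) * parityTheta τ n (p - τ) := by
  have e : p = p - τ + 2 * τ / 2 := by ring
  simp only [parityTheta, Nat.even_add_one]
  by_cases h : Even n
  · simp only [h, not_true, if_false, if_true]
    conv_lhs => rw [e]
    exact theta3_add_half _ _
  · simp only [h, not_false_iff, if_false, if_true]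
    conv_lhs => rw [e]
    exact theta2_add_half _ _

lemma parityRatio_sub_tau (p : ℂ) :
    parityRatio τ n (p - τ) = Complex.I * parityTheta τ (n + 1) p / theta1 p (2 * τ) := by
  have e : p = p - τ + 2 * τ / 2 := by ring
  have h1 : theta1 p (2 * τ) =
      Complex.I * halfPeriodFactor (p - τ) (2 * τ) * theta4 (p - τ) (2 * τ) := by
    conv_lhs => rw [e]
    exact theta1_add_half _ _
  rw [parityTheta_eq_mul, h1, parityRatio,
    show Complex.I * (halfPeriodFactor (p - τ) (2 * τ) * parityTheta τ n (p - τ)) =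
      (Complex.I * halfPeriodFactor (p - τ) (2 * τ)) * parityTheta τ n (p - τ) by ring,
    mul_div_mul_left _ _ (mul_ne_zero Complex.I_ne_zero (halfPeriodFactor_ne_zero _ _))]

lemma parityRatio_sub_tau_sub_tau (p : ℂ) :
    parityRatio τ n (p - τ - τ) = -parityRatio τ n p := by
  have e : p = p - τ + 2 * τ / 2 := by ring
  have h4 : theta4 p (2 * τ) =
      Complex.I * halfPeriodFactor (p - τ) (2 * τ) * theta1 (p - τ) (2 * τ) := by
    conv_lhs => rw [e]
    exact theta4_add_half _ _
  have h2 : parityTheta τ n p =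
      halfPeriodFactor (p - τ) (2 * τ) * parityTheta τ (n + 1) (p - τ) := by
    rw [← parityTheta_eq_mul]
    exact congrFun (parityTheta_congr (by rw [Nat.even_add_one, Nat.even_add_one, not_not])) p
  rw [parityRatio_sub_tau, parityRatio, h2, h4]
  have hI := Complex.I_ne_zero
  have hh := halfPeriodFactor_ne_zero (p - τ) (2 * τ)
  rw [mul_right_comm, mul_comm, mul_comm (Complex.I * _), ← mul_div_mul_left _ (theta1 _ _) hh]
  rw [← mul_div_mul_left (halfPeriodFactor (p - τ) (2 * τ) * (parityTheta τ (n + 1) (p - τ)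
    * Complex.I)) _ hI, ← neg_div]
  congr 1
  · linear_combination (halfPeriodFactor (p - τ) (2 * τ) * parityTheta τ (n + 1) (p - τ)) *
      Complex.I_mul_I
  · ring

lemma analyticAt_parityTheta (p : ℂ) : AnalyticAt ℂ (parityTheta τ n) p := by
  have h2 : (parityTheta τ n) = if Even n then (fun p => theta2 p (2 * τ))
      else fun p => theta3 p (2 * τ) := by
    ext p; simp only [parityTheta]; split_ifs <;> rfl
  rw [h2]
  split_ifs
  · exact (differentiable_theta2 (two_tau_im_pos τ)).analyticAt p
  · exact (differentiable_theta3 (two_tau_im_pos τ)).analyticAt p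

lemma analyticAt_parityRatio (hτ : τ.re = 0) {p : ℂ} (hp : |p.im| < τ.im) :
    AnalyticAt ℂ (parityRatio τ n) p :=
  (analyticAt_parityTheta p).div ((differentiable_theta4 (two_tau_im_pos τ)).analyticAt p)
    (theta4_two_ne_zero_of_im hτ hp)

lemma parityTheta_zero_ne_zero (hτ : τ.re = 0) (n : ℕ) : parityTheta τ n 0 ≠ 0 := by
  rw [parityTheta]
  split_ifs
  · have := (offLattice_ofReal (τ := τ) (x := 1 / 2) (by norm_num) (by norm_num)
      ).theta1_two_ne_zero hτ
    rw [theta2_eq_theta1, zero_add]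
    simpa using this
  · exact theta3_zero_ne_zero (two_tau_im_pos τ) (two_tau_re hτ)

lemma parityRatio_zero_ne_zero (hτ : τ.re = 0) (n : ℕ) : parityRatio τ n 0 ≠ 0 :=
  div_ne_zero (parityTheta_zero_ne_zero hτ n) (theta4_zero_ne_zero hτ)

/-- The constant that makes `trialFun` monic at `0`. -/
noncomputable def trialConst (τ : UpperHalfPlane) (D : ℝ) (φ : ℂ → ℂ) (n : ℕ) : ℂ :=
  φ 0 * gInv τ (-D) / parityRatio τ n 0

/-- The factors of `trialFun` that depend on `n` only through its parity. -/
noncomputable def trialFactor (τ : UpperHalfPlane) (D : ℝ) (φ : ℂ → ℂ) (n : ℕ) (p : ℂ) : ℂ :=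
  trialConst τ D φ n * (φ p)⁻¹ * gExp τ (p - D) * parityRatio τ n p

/-- The leading asymptotics of `πₙ` off `γ`: a function on the closed annulus `|Im p| ≤ Im τ / 2`
and slightly beyond, with the poles of a monic section, whose branches on both sides of `γ` add up
to a function orthogonal to the sections of smaller degree. -/
noncomputable def trialFun (τ : UpperHalfPlane) (D : ℝ) (φ : ℂ → ℂ) (n : ℕ) (p : ℂ) : ℂ :=
  gExp τ p ^ n * trialFactor τ D φ n p

lemma trialFactor_add_one (hφ1 : ∀ p, φ (p + 1) = φ p) (p : ℂ) :
    trialFactor τ D φ n (p + 1) = (-1) ^ n * trialFactor τ D φ n p := by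
  rw [trialFactor, trialFactor, hφ1, add_sub_right_comm, gExp_add_one, parityRatio_add_one]
  ring

lemma trialFun_add_one (hφ1 : ∀ p, φ (p + 1) = φ p) (p : ℂ) :
    trialFun τ D φ n (p + 1) = trialFun τ D φ n p := by
  rw [trialFun, trialFun, trialFactor_add_one hφ1, gExp_add_one, neg_pow, ← mul_assoc,
    mul_right_comm _ _ ((-1 : ℂ) ^ n), ← mul_pow, neg_one_mul, neg_neg, one_pow, one_mul]

lemma analyticAt_gInv_sub (hτ : τ.re = 0) {z : ℂ} (hz : |z.im| < τ.im) :
    AnalyticAt ℂ (fun p => gInv τ (p - D)) z :=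
  AnalyticAt.comp (g := gInv τ) (f := fun p : ℂ => p - D)
    (analyticAt_gInv hτ (by simpa using hz)) (by fun_prop)

lemma analyticAt_gExp_sub (hτ : τ.re = 0) {z : ℂ} (hz : OffLattice τ (z - D)) :
    AnalyticAt ℂ (fun p => gExp τ (p - D)) z :=
  AnalyticAt.comp (g := gExp τ) (f := fun p : ℂ => p - D) (hz.analyticAt_gExp hτ) (by fun_prop)

lemma analyticAt_trialFactor (hτ : τ.re = 0) (hφ0 : ∀ p, φ p ≠ 0) {z : ℂ}
    (hφ : AnalyticAt ℂ φ z) (hz : |z.im| < τ.im) (ho : OffLattice τ (z - D)) :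
    AnalyticAt ℂ (trialFactor τ D φ n) z :=
  ((analyticAt_const.mul (hφ.inv (hφ0 z))).mul (analyticAt_gExp_sub hτ ho)).mul
    (analyticAt_parityRatio hτ hz)

lemma analyticAt_trialFun (hτ : τ.re = 0) (hφ0 : ∀ p, φ p ≠ 0) {z : ℂ}
    (hφ : AnalyticAt ℂ φ z) (hz : |z.im| < τ.im) (ho : OffPoles τ D z) :
    AnalyticAt ℂ (trialFun τ D φ n) z :=
  ((ho.1.analyticAt_gExp hτ).pow n).mul (analyticAt_trialFactor hτ hφ0 hφ hz ho.2)

lemma meromorphicAt_trialFun (hτ : τ.re = 0) {z : ℂ} (hφ : AnalyticAt ℂ φ z)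
    (hz : |z.im| < τ.im) : MeromorphicAt (trialFun τ D φ n) z := by
  have h1 : MeromorphicAt (fun p => gExp τ (p - D)) z :=
    (meromorphicAt_gExp (τ := τ) (z - D)).comp_analyticAt (f := gExp τ) (g := fun p : ℂ => p - D)
      (by fun_prop)
  exact ((meromorphicAt_gExp z).pow n).mul ((((MeromorphicAt.const _ z).mul
    hφ.meromorphicAt.inv).mul h1).mul (analyticAt_parityRatio hτ hz).meromorphicAt)

lemma tendsto_trialFun_zero (hτ : τ.re = 0) (hD : D ∈ Ioo (0 : ℝ) 1) (hφ0 : ∀ p, φ p ≠ 0)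
    (hφ : AnalyticAt ℂ φ 0) :
    Tendsto (fun p => p ^ n * trialFun τ D φ n p) (𝓝[≠] 0) (𝓝 1) := by
  have ho : OffLattice τ (-D : ℂ) := (offLattice_ofReal hD.1 hD.2).neg
  have hc := (analyticAt_trialFactor (n := n) hτ hφ0 hφ (by simpa using τ.im_pos)
    (by rwa [zero_sub])).continuousAt.tendsto.mono_left (nhdsWithin_le_nhds (s := {(0 : ℂ)}ᶜ))
  have h := ((tendsto_mul_gExp hτ).pow n).mul hc
  have e : (1 : ℂ) ^ n * trialFactor τ D φ n 0 = 1 := by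
    have h1 := parityRatio_zero_ne_zero hτ n
    have h2 := gInv_ne_zero hτ ho
    have h3 := hφ0 0
    rw [trialFactor, trialConst, gExp, zero_sub]
    field_simp
    simp
  rw [e] at h
  exact h.congr fun p => by rw [trialFun]; ring

lemma tendsto_trialFun_D (hτ : τ.re = 0) (hD : D ∈ Ioo (0 : ℝ) 1) (hφ0 : ∀ p, φ p ≠ 0)
    (hφ : AnalyticAt ℂ φ D) :
    ∃ c, Tendsto (fun p => (p - D) * trialFun τ D φ n p) (𝓝[≠] (D : ℂ)) (𝓝 c) := by
  have hle := nhdsWithin_le_nhds (a := (D : ℂ)) (s := {(D : ℂ)}ᶜ)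
  have htend : Tendsto (fun z : ℂ => z - D) (𝓝[≠] (D : ℂ)) (𝓝[≠] 0) := by
    refine tendsto_nhdsWithin_iff.2 ⟨?_, ?_⟩
    · have : Tendsto (fun z : ℂ => z - D) (𝓝 (D : ℂ)) (𝓝 ((D : ℂ) - D)) :=
        Continuous.tendsto (by fun_prop) _
      rw [sub_self] at this
      exact this.mono_left nhdsWithin_le_nhds
    · filter_upwards [self_mem_nhdsWithin] with z hz
      exact sub_ne_zero.2 hz
  have h1 := (((offLattice_ofReal (τ := τ) hD.1 hD.2).analyticAt_gExp hτ).pow n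
    ).continuousAt.tendsto.mono_left hle
  have h2 := (hφ.inv (hφ0 D)).continuousAt.tendsto.mono_left hle
  have h3 := (tendsto_mul_gExp hτ).comp htend
  have h4 := (analyticAt_parityRatio (n := n) hτ (p := (D : ℂ))
    (by simpa using τ.im_pos)).continuousAt.tendsto.mono_left hle
  refine ⟨_, ((((h1.mul h2).mul h3).mul h4).const_mul (trialConst τ D φ n)).congr fun p => ?_⟩
  simp only [trialFun, trialFactor, Function.comp, Pi.pow_apply, Pi.inv_apply]
  ring

/-- The trial function is exponentially smaller than `exp (n ℓ)` on the far sides of `γ`. -/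
lemma exists_norm_trialFun_le (hτ : τ.re = 0) (hφ0 : ∀ p, φ p ≠ 0) (hφ1 : ∀ p, φ (p + 1) = φ p)
    {ε' ρ : ℝ} (h0 : 0 < ε') (h1 : ε' < τ.im / 2)
    (hφ : ∀ z : ℂ, |z.im| = τ.im / 2 + ε' → AnalyticAt ℂ φ z)
    (hg : ∀ p : ℂ, |p.im| = τ.im / 2 - ε' → ‖gInv τ p‖ ≤ Real.exp (-(ell τ + ρ))) :
    ∃ C : ℝ, 0 < C ∧ ∀ (n : ℕ) (z : ℂ), |z.im| = τ.im / 2 + ε' →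
      ‖trialFun τ D φ n z‖ ≤ C * (Real.exp (ell τ) ^ n * Real.exp (-(n * ρ))) := by
  have hT := τ.im_pos
  have hfac : ∀ n : ℕ, ∃ C : ℝ, 0 < C ∧ ∀ z : ℂ, |z.im| = τ.im / 2 + ε' →
      ‖trialFactor τ D φ n z‖ ≤ C := by
    intro n
    have hper : ∀ z : ℂ, ‖trialFactor τ D φ n (z + 1)‖ = ‖trialFactor τ D φ n z‖ := fun z => by
      rw [trialFactor_add_one hφ1, norm_mul, norm_pow, norm_neg, norm_one, one_pow, one_mul]
    have hc : ∀ z : ℂ, |z.im| = τ.im / 2 + ε' → ContinuousAt (trialFactor τ D φ n) z := by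
      intro z hz
      have hlt : |z.im| < τ.im := by linarith
      have hne : z.im ≠ 0 := fun h => by rw [h, abs_zero] at hz; linarith
      exact (analyticAt_trialFactor hτ hφ0 (hφ z hz) hlt
        (offPoles_of_im hne hlt : OffPoles τ D z).2).continuousAt
    obtain ⟨B, hB0, hB⟩ := exists_bound_of_periodic (f := trialFactor τ D φ n)
      (y₁ := τ.im / 2 + ε') (y₂ := τ.im / 2 + ε') (fun z _ _ => hper z) (fun z a b => hc z (by
        rw [le_antisymm b a, abs_of_pos (by linarith)]))
    obtain ⟨B', hB0', hB'⟩ := exists_bound_of_periodic (f := trialFactor τ D φ n)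
      (y₁ := -(τ.im / 2 + ε')) (y₂ := -(τ.im / 2 + ε')) (fun z _ _ => hper z)
      (fun z a b => hc z (by rw [le_antisymm b a, abs_of_neg (by linarith), neg_neg]))
    refine ⟨max B B', lt_max_of_lt_left hB0, fun z hz => ?_⟩
    rcases abs_cases z.im with ⟨h, -⟩ | ⟨h, -⟩ <;> rw [h] at hz
    · exact (hB z hz.ge hz.le).trans (le_max_left _ _)
    · exact (hB' z (by linarith) (by linarith)).trans (le_max_right _ _)
  have hgE : ∀ z : ℂ, |z.im| = τ.im / 2 + ε' → ‖gExp τ z‖ ≤ Real.exp (ell τ) * Real.exp (-ρ) := by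
    have hgen : ∀ z z' : ℂ, gExp τ z = gConst τ ^ 2 / gExp τ z' → |z'.im| = τ.im / 2 - ε' →
        ‖gExp τ z‖ ≤ Real.exp (ell τ) * Real.exp (-ρ) := by
      intro z z' h hz'
      rw [h, norm_div, norm_pow, norm_gConst hτ, gExp, norm_inv, div_inv_eq_mul]
      refine (mul_le_mul_of_nonneg_left (hg z' hz') (by positivity)).trans (le_of_eq ?_)
      rw [sq, ← Real.exp_add, ← Real.exp_add, ← Real.exp_add]
      congr 1; ring
    intro z hz
    rcases abs_cases z.im with ⟨h, -⟩ | ⟨h, -⟩ <;> rw [h] at hz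
    · refine hgen z (z - τ) ?_ ?_
      · have := gExp_add_tau hτ (z - τ)
        rwa [sub_add_cancel] at this
      · rw [Complex.sub_im, UpperHalfPlane.coe_im, hz, abs_of_neg (by linarith)]; ring
    · refine hgen z (z + τ) ?_ ?_
      · have := gExp_sub_tau hτ (z + τ)
        rwa [add_sub_cancel_right] at this
      · rw [Complex.add_im, UpperHalfPlane.coe_im, show z.im = -(τ.im / 2 + ε') by linarith,
          abs_of_pos (by linarith)]; ring
  obtain ⟨C₀, hC₀, h₀⟩ := hfac 0
  obtain ⟨C₁, hC₁, h₁⟩ := hfac 1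
  refine ⟨max C₀ C₁, lt_max_of_lt_left hC₀, fun n z hz => ?_⟩
  have hpar : ‖trialFactor τ D φ n z‖ ≤ max C₀ C₁ := by
    have hcongr : ∀ m : ℕ, (Even n ↔ Even m) → trialFactor τ D φ n z = trialFactor τ D φ m z := by
      intro m hm
      simp only [trialFactor, trialConst, parityRatio, parityTheta_congr hm]
    rcases Nat.even_or_odd n with h | h
    · rw [hcongr 0 (by simp [h])]; exact (h₀ z hz).trans (le_max_left _ _)
    · rw [hcongr 1 (by simpa using h)]; exact (h₁ z hz).trans (le_max_right _ _)
  rw [trialFun, norm_mul, norm_pow, mul_comm]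
  refine mul_le_mul hpar ?_ (by positivity) (by positivity)
  refine (pow_le_pow_left₀ (norm_nonneg _) (hgE z hz) n).trans (le_of_eq ?_)
  rw [mul_pow, ← Real.exp_nat_mul (-ρ)]
  congr 2; ring

/-- The leading term with all its theta constants at `2τ` expressed by `gConst`; the exponent
`(-1)ⁿ` is contained in the quotient of the `parityTheta`. -/
lemma leadingTerm_eq (hτ : τ.re = 0) (n : ℕ) : leadingTerm τ D w n =
    2 * π * Complex.exp (-2 * szegoInfty τ w) * (theta1 D (2 * τ) / theta4 D (2 * τ)) ^ 2 /
      gConst τ * (parityTheta τ (n + 1) 0 / parityTheta τ n 0) * (gConst τ ^ 2) ^ n := by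
  have hk := gConst_ne_zero hτ
  have h2 : Complex.exp (2 * ((n : ℂ) - 1) * ell τ - 2 * szegoInfty τ w) =
      Complex.exp (-2 * szegoInfty τ w) * (gConst τ ^ 2) ^ n / gConst τ ^ 2 := by
    have e := exp_two_ell hτ
    push_cast at e
    rw [← e, eq_div_iff (Complex.exp_ne_zero _), ← Complex.exp_nat_mul, ← Complex.exp_add,
      ← Complex.exp_add]
    congr 1; ring
  have hDτ : theta1 (D + τ) (2 * τ) =
      Complex.I * halfPeriodFactor D (2 * τ) * theta4 D (2 * τ) := by
    rw [← theta1_add_half]; congr 1; ring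
  have h3 : Complex.exp (-Complex.I * π * τ) * (Complex.exp (-2 * Complex.I * π * D) *
      theta1 D (2 * τ) ^ 2 / theta1 (D + τ) (2 * τ) ^ 2) =
      -(theta1 D (2 * τ) / theta4 D (2 * τ)) ^ 2 := by
    have hh : halfPeriodFactor D (2 * τ) ^ 2 =
        Complex.exp (-Complex.I * π * τ) * Complex.exp (-2 * Complex.I * π * D) := by
      rw [halfPeriodFactor, ← Complex.exp_nat_mul, ← Complex.exp_add]
      congr 1; push_cast; ring
    rw [← mul_div_assoc, ← mul_assoc, ← hh, hDτ, mul_pow, mul_pow, Complex.I_sq, div_pow,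
      mul_assoc, neg_one_mul, div_neg, mul_div_mul_left _ _
      (pow_ne_zero 2 (halfPeriodFactor_ne_zero _ _))]
  have h4 : (theta3 0 (2 * τ) / theta2 0 (2 * τ)) ^ ((-1 : ℤ) ^ n) =
      parityTheta τ (n + 1) 0 / parityTheta τ n 0 := by
    rcases Nat.even_or_odd n with h | h
    · rw [h.neg_one_pow, zpow_one, parityTheta, parityTheta, if_pos h,
        if_neg (by rw [Nat.even_add_one, not_not]; exact h)]
    · have h' := Nat.not_even_iff_odd.2 h
      rw [h.neg_one_pow, zpow_neg_one, inv_div, parityTheta, parityTheta, if_neg h',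
        if_pos (by rw [Nat.even_add_one]; exact h')]
  rw [leadingTerm, h2, h4, mul_assoc (-(2 * π : ℂ) * _), h3,
    show theta1DerivZero (2 * τ) / theta4 0 (2 * τ) = gConst τ from rfl]
  field_simp

/-- **Exact orthogonality of the trial function.** Times the weight, the sum of both branches on `γ`
is the jump across `γ` of a single function, so that its pairing with a section is a residue. -/
lemma pairing_trialFun (hτ : τ.re = 0) (hD : D ∈ Ioo (0 : ℝ) 1) {ε' : ℝ} (hε' : 0 < ε')
    (hφ0 : ∀ p, φ p ≠ 0) (hφ1 : ∀ p, φ (p + 1) = φ p)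
    (hφ : ∀ z : ℂ, |z.im| < τ.im / 2 + ε' → AnalyticAt ℂ φ z)
    (hφw : ∀ q : ℂ, |q.im - τ.im / 2| < ε' → φ q * φ (q - τ) = Complex.exp (w q))
    (hφS : φ 0 ^ 2 = Complex.exp (-2 * szegoInfty τ w)) {f : ℂ → ℂ} (hf : IsPresection τ D n f)
    (hf1 : Tendsto (fun p => p ^ n * f p) (𝓝[≠] 0) (𝓝 1)) :
    pairing τ w (fun q => trialFun τ D φ n q + trialFun τ D φ n (q - τ)) f =
      leadingTerm τ D w n := by
  have hT := τ.im_pos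
  set c := trialConst τ D φ n with hc
  set Ψ : ℂ → ℂ := fun p => c * (gConst τ ^ 2) ^ (n + 1) *
    (gInv τ p ^ n * gInv τ (p - D) * φ p * parityRatio τ n (p - τ) * f p) with hΨ
  have hk := gConst_ne_zero hτ
  have hMan : ∀ z : ℂ, OffLattice τ z → AnalyticAt ℂ (fun p => parityRatio τ n (p - τ)) z := by
    intro z hz
    have e : (fun p => parityRatio τ n (p - τ)) =
        fun p => Complex.I * parityTheta τ (n + 1) p / theta1 p (2 * τ) :=
      funext fun p => parityRatio_sub_tau p
    rw [e]
    exact (analyticAt_const.mul (analyticAt_parityTheta z)).div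
      ((differentiable_theta1 (two_tau_im_pos τ)).analyticAt z) (hz.theta1_two_ne_zero hτ)
  have hΨan : ∀ z : ℂ, -(τ.im / 2) ≤ z.im → z.im ≤ τ.im / 2 → OffPoles τ D z →
      AnalyticAt ℂ Ψ z := by
    intro z h1 h2 ho
    have hlt : |z.im| < τ.im := by rw [abs_lt]; constructor <;> linarith
    exact analyticAt_const.mul ((((((analyticAt_gInv hτ hlt).pow n).mul
      (analyticAt_gInv_sub hτ hlt)).mul (hφ z (by rw [abs_lt]; constructor <;> linarith))).mul
      (hMan z ho.1)).mul (hf.analyticAt z ho))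
  have hΨ1 : ∀ z, Ψ (z + 1) = Ψ z := by
    intro z
    have hsq : ((-1 : ℂ) ^ n) * (-1) ^ n = 1 := by rw [← mul_pow]; simp
    simp only [hΨ]
    rw [gInv_add_one, add_sub_right_comm, add_sub_right_comm, gInv_add_one, hφ1,
      parityRatio_add_one, hf.add_one, neg_pow]
    linear_combination (c * (gConst τ ^ 2) ^ (n + 1) *
      (gInv τ z ^ n * gInv τ (z - D) * φ z * parityRatio τ n (z - τ) * f z)) * hsq
  -- the jump relation on `γ`
  have hjump : ∀ q : ℂ, q.im = τ.im / 2 →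
      (trialFun τ D φ n q + trialFun τ D φ n (q - τ)) * f q * Complex.exp (w q) =
        Ψ q - Ψ (q - τ) := by
    intro q hq
    have ho : OffPoles τ D q := offPoles_of_im_eq hq
    have hfs : f (q - τ) = f q := by rw [← hf.add_tau (q - τ), sub_add_cancel]
    have hE0 := gExp_ne_zero hτ ho.1
    have hE0' := gExp_ne_zero hτ ho.2
    have hinv : ∀ p, gInv τ p = (gExp τ p)⁻¹ := fun p => by rw [gExp, inv_inv]
    rw [← hφw q (by rw [hq, sub_self, abs_zero]; exact hε')]
    simp only [hΨ, trialFun, trialFactor, hinv, hfs, parityRatio_sub_tau_sub_tau, ← hc]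
    rw [sub_right_comm, gExp_sub_tau hτ, gExp_sub_tau hτ]
    have hq0 := hφ0 q
    have hq1 := hφ0 (q - τ)
    generalize gExp τ q = E at hE0 ⊢
    generalize gExp τ (q - D) = E' at hE0' ⊢
    generalize φ q = a at hq0 ⊢
    generalize φ (q - τ) = a' at hq1 ⊢
    generalize parityRatio τ n q = m
    generalize parityRatio τ n (q - τ) = m'
    generalize f q = y
    generalize gConst τ = k at hk ⊢
    simp only [div_pow, inv_div, inv_pow]
    field_simp
    ring
  have hpair : pairing τ w (fun q => trialFun τ D φ n q + trialFun τ D φ n (q - τ)) f =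
      lineInt Ψ (τ.im / 2) - lineInt Ψ (-(τ.im / 2)) := by
    have e := lineInt_comp_sub_tau hτ Ψ (τ.im / 2)
    rw [show τ.im / 2 - τ.im = -(τ.im / 2) by ring] at e
    rw [← e]
    have hc1 : ∀ z : ℂ, z.im = τ.im / 2 → ContinuousAt Ψ z := fun z hz =>
      (hΨan z (by linarith) hz.le (offPoles_of_im_eq hz)).continuousAt
    have hc2 : ∀ z : ℂ, z.im = τ.im / 2 → ContinuousAt (fun q => Ψ (q - τ)) z := by
      intro z hz
      have hz' : (z - τ).im = -(τ.im / 2) := by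
        rw [Complex.sub_im, UpperHalfPlane.coe_im, hz]; ring
      refine ContinuousAt.comp (g := Ψ) (f := fun q : ℂ => q - τ) (hΨan _ hz'.ge (by linarith)
        (offPoles_of_im (by linarith) ?_)).continuousAt (by fun_prop)
      rw [hz', abs_of_neg (by linarith)]; linarith
    rw [lineInt, lineInt, ← intervalIntegral.integral_sub
      (intervalIntegrable_line fun x _ => hc1 _ (line_im _ _))
      (intervalIntegrable_line fun x _ => hc2 _ (line_im _ _))]
    refine intervalIntegral.integral_congr fun s _ => ?_
    have := hjump (s + (τ.im / 2 : ℝ) * Complex.I) (line_im _ _)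
    rw [← tau_div_two_add hτ] at this
    simp only [← tau_div_two_add hτ]
    exact this
  -- the residue at `0`
  set m := Complex.I * parityTheta τ (n + 1) 0 / theta1DerivZero (2 * τ) with hm
  have hMlim : Tendsto (fun p => p * parityRatio τ n (p - τ)) (𝓝[≠] 0) (𝓝 m) := by
    have h1 := (analyticAt_parityTheta (τ := τ) (n := n + 1) 0).continuousAt.tendsto.mono_left
      (nhdsWithin_le_nhds (s := {(0 : ℂ)}ᶜ))
    have h2 := (h1.const_mul Complex.I).div (tendsto_theta1_div (two_tau_im_pos τ))
      (theta1DerivZero_ne_zero (two_tau_im_pos τ) (two_tau_re hτ))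
    refine h2.congr fun p => ?_
    rw [parityRatio_sub_tau, Pi.div_apply, div_div_eq_mul_div]
    ring
  have hle0 := nhdsWithin_le_nhds (a := (0 : ℂ)) (s := {(0 : ℂ)}ᶜ)
  have hleD := nhdsWithin_le_nhds (a := (D : ℂ)) (s := {(D : ℂ)}ᶜ)
  have hcD0 := (analyticAt_gInv_sub (τ := τ) (D := D) hτ (z := 0)
    (by simpa using hT)).continuousAt.tendsto.mono_left hle0
  have hφ00 := (hφ 0 (by simp; linarith)).continuousAt.tendsto.mono_left hle0
  have hlim0 : Tendsto (fun p => p * Ψ p) (𝓝[≠] 0)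
      (𝓝 (c * (gConst τ ^ 2) ^ (n + 1) * (1 ^ n * gInv τ (-D) * φ 0 * m * 1))) := by
    rw [zero_sub] at hcD0
    refine (((((((tendsto_gInv_div hτ).pow n).mul hcD0).mul hφ00).mul hMlim).mul hf1).const_mul
      (c * (gConst τ ^ 2) ^ (n + 1))).congr' ?_
    filter_upwards [self_mem_nhdsWithin] with p hp
    have hp' : p ≠ 0 := hp
    simp only [hΨ, div_pow]
    field_simp
  have hlimD : Tendsto (fun p => (p - D) * Ψ p) (𝓝[≠] (D : ℂ)) (𝓝 0) := by
    obtain ⟨d, hd⟩ := hf.tendsto_D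
    have hoD : OffLattice τ (D : ℂ) := offLattice_ofReal hD.1 hD.2
    have hDim : |(D : ℂ).im| < τ.im := by simpa using hT
    have t1 := ((analyticAt_gInv hτ hDim).pow n).continuousAt.tendsto.mono_left hleD
    have t2 := (analyticAt_gInv_sub (D := D) hτ hDim).continuousAt.tendsto.mono_left hleD
    have t3 := (hφ D (by simp; linarith)).continuousAt.tendsto.mono_left hleD
    have t4 := (hMan D hoD).continuousAt.tendsto.mono_left hleD
    rw [sub_self, gInv_zero] at t2
    have := ((((t1.mul t2).mul t3).mul t4).mul hd).const_mul (c * (gConst τ ^ 2) ^ (n + 1))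
    rw [mul_zero, zero_mul, zero_mul, zero_mul, mul_zero] at this
    refine this.congr fun p => ?_
    simp only [hΨ, Pi.pow_apply]
    ring
  have hres := lineInt_neg_sub_lineInt hD (y := τ.im / 2) (by linarith) (by linarith)
    (fun z _ _ => hΨ1 z) (fun z a b ho => (hΨan z a b ho).differentiableAt) hlim0 hlimD
  rw [hpair, ← neg_sub, hres, leadingTerm_eq hτ, ← hφS, hm, hc, trialConst, gInv_neg, gInv,
    parityRatio, one_pow]
  have hp0 := parityTheta_zero_ne_zero hτ n
  have h40 := theta4_zero_ne_zero hτ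
  have h10 := theta1DerivZero_ne_zero (two_tau_im_pos τ) (two_tau_re hτ)
  have h4D : theta4 D (2 * τ) ≠ 0 :=
    (offLattice_ofReal hD.1 hD.2).theta4_two_ne_zero hτ
  have hk1 : theta1DerivZero (2 * τ) = gConst τ * theta4 0 (2 * τ) := by
    rw [gConst, div_mul_cancel₀ _ h40]
  rw [hk1]
  generalize parityTheta τ (n + 1) 0 = y
  generalize parityTheta τ n 0 = x at hp0 ⊢
  generalize theta4 0 (2 * τ) = u at h40 ⊢
  generalize theta4 D (2 * τ) = v at h4D ⊢
  generalize gConst τ = k at hk ⊢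
  rw [pow_succ]
  field_simp
  linear_combination -(φ 0 ^ 2 * theta1 D (2 * τ) ^ 2 * y) * Complex.I_sq

end Trial

/-! ### The norms of the orthogonal sections -/

variable {τ : UpperHalfPlane} {D : ℝ} {w : ℂ → ℂ}

lemma leadingTerm_ne_zero (hτ : τ.re = 0) (hD : D ∈ Ioo (0 : ℝ) 1) (n : ℕ) :
    leadingTerm τ D w n ≠ 0 := by
  have ho := offLattice_ofReal (τ := τ) hD.1 hD.2
  have h1 := ho.theta1_two_ne_zero hτ
  have h4 := ho.theta4_two_ne_zero hτ
  have hk := gConst_ne_zero hτ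
  have hp := parityTheta_zero_ne_zero hτ n
  have hp' := parityTheta_zero_ne_zero hτ (n + 1)
  have hπ := Complex.ofReal_ne_zero.2 Real.pi_ne_zero
  have he := Complex.exp_ne_zero (-2 * szegoInfty τ w)
  have h2 : (2 : ℂ) ≠ 0 := two_ne_zero
  rw [leadingTerm_eq hτ]
  exact mul_ne_zero (mul_ne_zero (div_ne_zero (mul_ne_zero (mul_ne_zero (mul_ne_zero h2 hπ) he)
    (pow_ne_zero 2 (div_ne_zero h1 h4))) hk) (div_ne_zero hp' hp))
    (pow_ne_zero n (pow_ne_zero 2 hk))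

/-- Apart from the factor `exp (2nℓ)`, the leading term depends on the parity of `n` only. -/
lemma exists_le_norm_leadingTerm (hτ : τ.re = 0) (hD : D ∈ Ioo (0 : ℝ) 1) :
    ∃ K : ℝ, 0 < K ∧ ∀ n : ℕ, (K * Real.exp (ell τ) ^ n) ^ 2 ≤ ‖leadingTerm τ D w n‖ := by
  set A : ℕ → ℝ := fun n => ‖leadingTerm τ D w n‖ / (Real.exp (ell τ) ^ n) ^ 2 with hA
  have hE : ∀ n : ℕ, 0 < (Real.exp (ell τ) ^ n) ^ 2 := fun n => by positivity
  have hper : ∀ n, A (n + 2) = A n := by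
    intro n
    have hpar : ∀ m, parityTheta τ (m + 2) 0 = parityTheta τ m 0 := fun m => by
      simp only [parityTheta, Nat.even_add, even_two, iff_true]
    have e : leadingTerm τ D w (n + 2) = leadingTerm τ D w n * (gConst τ ^ 2) ^ 2 := by
      rw [leadingTerm_eq hτ, leadingTerm_eq hτ, add_right_comm, hpar, hpar]
      ring
    simp only [hA]
    rw [e, norm_mul, norm_pow, norm_pow, norm_gConst hτ, div_eq_div_iff (hE _).ne' (hE _).ne']
    ring
  have hpos : ∀ n, 0 < A n := fun n => div_pos (norm_pos_iff.2 (leadingTerm_ne_zero hτ hD n)) (hE n)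
  have hmin : 0 < min (A 0) (A 1) := lt_min (hpos 0) (hpos 1)
  have hle : ∀ n, min (A 0) (A 1) ≤ A n ∧ min (A 0) (A 1) ≤ A (n + 1) := by
    intro n
    induction n with
    | zero => exact ⟨min_le_left _ _, min_le_right _ _⟩
    | succ n ih => exact ⟨ih.2, (hper n).symm ▸ ih.1⟩
  refine ⟨√(min (A 0) (A 1)), Real.sqrt_pos.2 hmin, fun n => ?_⟩
  rw [mul_pow, Real.sq_sqrt hmin.le, ← le_div_iff₀ (hE n)]
  exact (hle n).1

/-- A bound for the error by the geometric mean of the norm and its leading term gives one in terms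
of the leading term alone. -/
lemma norm_sub_le_of_le_mul_sqrt {h : ℝ} {κ : ℂ} {a e k : ℝ} (hh : 0 ≤ h) (ha : 0 ≤ a) (he : 0 ≤ e)
    (he1 : e ≤ 1) (hkκ : k ^ 2 ≤ ‖κ‖) (hd : ‖(h : ℂ) - κ‖ ≤ a * e * k * √h) :
    ‖(h : ℂ) - κ‖ ≤ a * (1 + a) * e * ‖κ‖ := by
  set x := √h with hx
  set t := √‖κ‖ with ht
  have hx0 : 0 ≤ x := Real.sqrt_nonneg _
  have hx2 : x ^ 2 = h := Real.sq_sqrt hh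
  have ht0 : 0 ≤ t := Real.sqrt_nonneg _
  have ht2 : t ^ 2 = ‖κ‖ := Real.sq_sqrt (norm_nonneg _)
  have hkt : k ≤ t := Real.le_sqrt_of_sq_le hkκ
  have hd' : ‖(h : ℂ) - κ‖ ≤ a * e * t * x := hd.trans (by gcongr)
  have hsum : x ^ 2 ≤ t ^ 2 + a * t * x := by
    have h1 : h ≤ ‖κ‖ + ‖(h : ℂ) - κ‖ := by
      calc h = ‖(h : ℂ)‖ := by rw [Complex.norm_real, Real.norm_of_nonneg hh]
        _ = ‖κ + (h - κ)‖ := by rw [add_sub_cancel]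
        _ ≤ _ := norm_add_le _ _
    have h2 : a * e * t * x ≤ a * t * x := by
      calc a * e * t * x ≤ a * 1 * t * x := by gcongr
        _ = a * t * x := by ring
    rw [hx2, ht2]
    linarith
  have hxt : x ≤ (1 + a) * t := by
    by_contra! hlt
    have h1 : t < x := by nlinarith [mul_nonneg ha ht0]
    nlinarith [mul_pos (sub_pos.2 hlt) (ht0.trans_lt h1), mul_nonneg ht0 (sub_pos.2 h1).le]
  calc ‖(h : ℂ) - κ‖ ≤ a * e * t * x := hd'
    _ ≤ a * e * t * ((1 + a) * t) := by gcongr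
    _ = a * (1 + a) * e * ‖κ‖ := by rw [← ht2]; ring

/-- **Asymptotics of the norms.** The trial function has the leading term as its pairing with `πₙ`,
a nearby section has the norm, and the difference of the two is controlled on `γ`. -/
theorem exists_norm_gammaNormSq_sub_leadingTerm_le (hτ : τ.re = 0) (hD : D ∈ Ioo (0 : ℝ) 1) {ε : ℝ}
    (hε : 0 < ε) (hετ : ε < τ.im / 2)
    (hw : AnalyticOnNhd ℂ w {p : ℂ | |p.im - τ.im / 2| < ε})
    (hwper : ∀ p : ℂ, |p.im - τ.im / 2| < ε → w (p + 1) = w p)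
    (hwreal : ∀ s : ℝ, (w (τ / 2 + s)).im = 0) (hwγ : GammaContinuous τ w) :
    ∃ C : ℝ, ∀ n : ℕ, 2 ≤ n →
      ‖(gammaNormSq τ w (orthoSection τ D w n) : ℂ) - leadingTerm τ D w n‖ ≤
        C * Real.exp (-(n * rate τ ε)) * ‖leadingTerm τ D w n‖ := by
  have hT := τ.im_pos
  obtain ⟨ε₁, h10, h1ε, hg⟩ := exists_norm_gInv_le hτ hε hετ
  obtain ⟨ε₂, h12, h2ε⟩ := exists_between h1ε
  obtain ⟨φ, hφ0, hφ1, hφ, hφw, hφS⟩ :=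
    exists_factorization hτ (h10.trans h12) h2ε hετ hw hwper
  have hφr : ∀ x : ℝ, AnalyticAt ℂ φ x := fun x => hφ x (by simp; linarith)
  obtain ⟨A, hA, hF⟩ := exists_norm_trialFun_le (D := D) (φ := φ) (ρ := rate τ ε) hτ hφ0 hφ1 h10
    (h1ε.trans hετ) (fun z hz => hφ z (by linarith)) hg
  obtain ⟨B, hB, hQ⟩ := exists_presection_approx (τ := τ) (D := D) hτ hD h10 h12 (h2ε.trans hετ)
  obtain ⟨C, hC, hpair⟩ := exists_norm_pairing_le hτ hD hwγ hwreal
  obtain ⟨K, hK, hlead⟩ := exists_le_norm_leadingTerm (w := w) hτ hD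
  set a := C * (B * A) / K with ha
  refine ⟨a * (1 + a), fun n hn => ?_⟩
  set F := trialFun τ D φ n with hFdef
  set E := Real.exp (ell τ) ^ n with hE
  set e := Real.exp (-(n * rate τ ε)) with he
  have hFan : ∀ z : ℂ, |z.im| < τ.im / 2 + ε₂ → OffPoles τ D z → AnalyticAt ℂ F z :=
    fun z hz ho => analyticAt_trialFun hτ hφ0 (hφ z hz) (by linarith) ho
  obtain ⟨Q, hQs, hQ1, hQF⟩ := hQ n F (A * (E * e)) hn (trialFun_add_one hφ1) hFan
    (meromorphicAt_trialFun hτ (by simpa using hφr 0) (by simpa using hT))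
    (meromorphicAt_trialFun hτ (hφr D) (by simpa using hT))
    (tendsto_trialFun_zero hτ hD hφ0 (by simpa using hφr 0))
    (tendsto_trialFun_D hτ hD hφ0 (hφr D)) (hF n)
  obtain ⟨hs, hs1, hsr, -⟩ := orthoSection_spec (D := D) hτ hD hwγ hwreal n
  have hRc : GammaContinuous τ (fun q => F q + F (q - τ)) := by
    refine gammaContinuous_of_continuousAt fun z hz => ?_
    have hz' : (z - τ).im = -(τ.im / 2) := by
      rw [Complex.sub_im, UpperHalfPlane.coe_im, hz]; ring
    have h1 : ContinuousAt F z := (hFan z (by rw [hz, abs_of_pos (by positivity)]; linarith)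
      (offPoles_of_im_eq hz)).continuousAt
    have habs : |(z - τ).im| = τ.im / 2 := by rw [hz', abs_neg, abs_of_pos (by positivity)]
    have h2 : ContinuousAt F (z - τ) := (hFan _ (by linarith)
      (offPoles_of_im (by linarith) (by linarith))).continuousAt
    exact h1.add (ContinuousAt.comp (g := F) (f := fun q : ℂ => q - τ) h2 (by fun_prop))
  have hself := pairing_self hτ hwreal hs hsr
  have hQn : pairing τ w Q (orthoSection τ D w n) =
      gammaNormSq τ w (orthoSection τ D w n) := by
    rw [← hself]
    refine pairing_eq_of_monic hτ hwγ (fun k => (orthoSection_spec hτ hD hwγ hwreal k).1)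
      (fun k => (orthoSection_spec hτ hD hwγ hwreal k).2.1) (fun k hk => ?_) hQs hQ1
    exact pairing_orthoSection hτ hD hwγ hwreal hk.ne
  have hdiff := hpair n (fun q => (F q + F (q - τ)) - Q q) (B * (A * (E * e)))
    (Continuous.sub hRc hQs.gammaContinuous) hQF
  rw [pairing_sub_left hwγ hRc hQs.gammaContinuous hs.gammaContinuous, hQn,
    pairing_trialFun hτ hD (h10.trans h12) hφ0 hφ1 hφ hφw hφS hs hs1, norm_sub_rev] at hdiff
  have he1 : e ≤ 1 := Real.exp_le_one_iff.2 (neg_nonpos.2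
    (mul_nonneg (Nat.cast_nonneg n) (rate_pos hτ hε hετ).le))
  refine norm_sub_le_of_le_mul_sqrt (gammaNormSq_pos hwγ hs hs1).le (by positivity)
    (Real.exp_nonneg _) he1 (hlead n) (hdiff.trans_eq ?_)
  rw [ha, ← hE]
  field_simp

end EllipticOrthogonality

theorem mainTheorem5 (τ : UpperHalfPlane) (hτ : τ.re = 0) (D : ℝ) (hD : D ∈ Set.Ioo (0 : ℝ) 1)
    (ε : ℝ) (hε : 0 < ε) (hετ : ε < τ.im / 2) (w : ℂ → ℂ)
    (hw : AnalyticOnNhd ℂ w {p : ℂ | |p.im - τ.im / 2| < ε})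
    (hwper : ∀ p : ℂ, |p.im - τ.im / 2| < ε → w (p + 1) = w p)
    (hwreal : ∀ s : ℝ, (w (τ / 2 + s)).im = 0) :
    0 < EllipticOrthogonality.rate τ ε ∧
    (∃ P : ℕ → ℂ → ℂ, EllipticOrthogonality.IsMonicOrthogonal τ D w P) ∧
    ∀ P : ℕ → ℂ → ℂ, EllipticOrthogonality.IsMonicOrthogonal τ D w P →
      ∃ r : ℕ → ℂ,
        (r =O[Filter.atTop] fun n : ℕ =>
          Real.exp (-(n * EllipticOrthogonality.rate τ ε))) ∧
        ∀ n : ℕ, EllipticOrthogonality.pairing τ w (P n) (P n) =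
          EllipticOrthogonality.leadingTerm τ D w n * (1 + r n) := by
  have hwγ : EllipticOrthogonality.GammaContinuous τ w :=
    EllipticOrthogonality.gammaContinuous_of_continuousAt fun z hz =>
      (hw z (by simpa [hz] using hε)).continuousAt
  refine ⟨EllipticOrthogonality.rate_pos hτ hε hετ,
    EllipticOrthogonality.exists_isMonicOrthogonal hτ hD hwγ hwreal, fun P hP => ?_⟩
  obtain ⟨C, hC⟩ := EllipticOrthogonality.exists_norm_gammaNormSq_sub_leadingTerm_le hτ hD hε hετ
    hw hwper hwreal hwγ
  have h0 := EllipticOrthogonality.leadingTerm_ne_zero (w := w) hτ hD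
  refine ⟨fun n => EllipticOrthogonality.pairing τ w (P n) (P n) /
    EllipticOrthogonality.leadingTerm τ D w n - 1, IsBigO.of_bound C ?_, fun n => ?_⟩
  · filter_upwards [eventually_ge_atTop 2] with n hn
    rw [hP.pairing_eq hτ hD hwγ hwreal, div_sub_one (h0 n), norm_div, Real.norm_of_nonneg
      (Real.exp_nonneg _), div_le_iff₀ (norm_pos_iff.2 (h0 n))]
    exact hC n hn
  · rw [add_sub_cancel, mul_div_cancel₀ _ (h0 n)]
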